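/- Let $\mathcal V$ be a symmetric monoidal closed category with unit object $I$ and internal hom $[-,-]$, whose underlying ordinary category is locally small, complete and cocomplete. Call a $\mathcal V$-category small if its isomorphism classes of objects form a small set. For a small $\mathcal V$-category $\mathcal K$ and a $\mathcal V$-category $\mathcal A$, $[\mathcal K,\mathcal A]$ denotes the $\mathcal V$-category of $\mathcal V$-functors, with $[\mathcal K,\mathcal A](F,G)=\int_k\mathcal A(Fk,Gk)$. For $\mathcal V$-functors $\varphi:\mathcal K^{op}\to\mathcal V$ and $S:\mathcal K\to\mathcal A$ with $\mathcal K$ small, the weighted colimit $\varphi * S\in\mathcal A$, if it exists, is defined by a $\mathcal V$-natural isomorphism $\mathcal A(\varphi * S,a)\cong[\mathcal K^{op},\mathcal V](\varphi,\mathcal A(S-,a))$. An object $a$ of $\mathcal A$ is a small projective if $\mathcal A(a,-):\mathcal A\to\mathcal V$ preserves all small weighted colimits that exist in $\mathcal A$. Let $\mathcal B$ be a small $\mathcal V$-category, with Yoneda embeddings $Y:\mathcal B\to[\mathcal B^{op},\mathcal V]$ and $Y':\mathcal B^{op}\to[\mathcal B,\mathcal V]$. Let $\mathcal Q(\mathcal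 B)$ and $\mathcal Q(\mathcal B^{op})$ be the full sub-$\mathcal V$-categories of small projectives in $[\mathcal B^{op},\mathcal V]$ and in $[\mathcal B,\mathcal V]$ respectively. Define $\mathcal V$-functors $$L:[\mathcal B^{op},\mathcal V]\to[\mathcal B,\mathcal V]^{op},\quad L(\varphi)=[\mathcal B^{op},\mathcal V](\varphi,Y-),\qquad R:[\mathcal B,\mathcal V]^{op}\to[\mathcal B^{op},\mathcal V],\quad R(\psi)=[\mathcal B,\mathcal V](\psi,Y'-).$$ A $\mathcal V$-functor $\varphi:\mathcal B^{op}\to\mathcal V$ is the same as a module $\overline\varphi:\mathcal I\nrightarrow\mathcal B$, and a $\mathcal V$-functor $\psi:\mathcal B\to\mathcal V$ is the same as a module $\underline\psi:\mathcal B\nrightarrow\mathcal I$, where $\mathcal I$ is the unit $\mathcal V$-category. An adjunction $\overline\varphi\dashv\underline\psi$ of modules consists of a unit $I\to\int^{b}\psi b\otimes\varphi b=\varphi * \psi$ and a counit $\varphi b\otimes\psi c\to\mathcal B(b,c)$, $\mathcal V$-natural in $b$ and $c$, satisfying the two triangle identities. Then: 1. $L$ is left adjoint to $R$ as $\mathcal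 V$-functors, through the canonical isomorphism $[\mathcal B,\mathcal V](\psi,L\varphi)\cong[\mathcal B^{op},\mathcal V](\varphi,R\psi)$ that identifies both sides with families $\varphi b\otimes\psi c\to\mathcal B(b,c)$ (the Isbell adjunction). 2. $L$ and $R$ send small projectives to small projectives, and the adjunction restricts, with its unit and counit, to an equivalence of $\mathcal V$-categories $(\mathcal Q(\mathcal B^{op}))^{op}\simeq\mathcal Q(\mathcal B)$. 3. This equivalence sends a right adjoint module to its left adjoint, and back: if $\overline\varphi\dashv\underline\psi$, then $\varphi$ and $\psi$ are small projectives, $\varphi\cong R\psi$ and $\psi\cong L\varphi$; if $\psi$ is a small projective, then $\overline{R\psi}\dashv\underline\psi$; if $\varphi$ is a small projective, then $\overline\varphi\dashv\underline{L\varphi}$. 4. If $\varphi\in\mathcal Q(\mathcal B)$ and $\psi\in\mathcal Q(\mathcal B^{op})$ correspond, that is, $\varphi\cong R\psi$, then there is a $\mathcal V$-natural isomorphism $[\mathcal B,\mathcal V](\psi,-)\cong\varphi * -:[\mathcal B,\mathcal V]\to\mathcal V$. -/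

import Mathlib

open CategoryTheory MonoidalCategory BraidedCategory Limits Opposite
open scoped MonoidalClosed

universe v u w w₁ w₂ w₃

namespace Isbell

set_option linter.unusedSectionVars false

/-- The hom-object of a `V`-category. -/
notation "Hom⟪" X ", " Y "⟫" => EnrichedCategory.Hom X Y

section Elements

variable {V : Type u} [Category.{v} V] [MonoidalCategory V]
variable {C : Type w} [EnrichedCategory V C] {D : Type w₁} [EnrichedCategory V D]

/-- Composition of generalized elements `f : A ⟶ C(X, Y)` and `g : B ⟶ C(Y, Z)` of hom-objects,
in diagrammatic order. -/
abbrev ecmp {X Y Z : C} {A B : V} (f : A ⟶ Hom⟪X, Y⟫) (g : B ⟶ Hom⟪Y, Z⟫) :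
    A ⊗ B ⟶ Hom⟪X, Z⟫ :=
  (f ⊗ₘ g) ≫ eComp V X Y Z

/-- Precomposition of a generalized element of `C(Y, Z)` with a morphism `X ⟶ Y` of the
underlying category. -/
def preC {X Y Z : C} {A : V} (f : 𝟙_ V ⟶ Hom⟪X, Y⟫) (g : A ⟶ Hom⟪Y, Z⟫) : A ⟶ Hom⟪X, Z⟫ :=
  (λ_ A).inv ≫ ecmp f g

/-- Postcomposition of a generalized element of `C(X, Y)` with a morphism `Y ⟶ Z` of the
underlying category. -/
def postC {X Y Z : C} {A : V} (f : A ⟶ Hom⟪X, Y⟫) (g : 𝟙_ V ⟶ Hom⟪Y, Z⟫) : A ⟶ Hom⟪X, Z⟫ :=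
  (ρ_ A).inv ≫ ecmp f g

lemma ecmp_assoc {W X Y Z : C} {A₁ A₂ A₃ : V} (f : A₁ ⟶ Hom⟪W, X⟫)
    (g : A₂ ⟶ Hom⟪X, Y⟫) (h : A₃ ⟶ Hom⟪Y, Z⟫) :
    ecmp (ecmp f g) h = (α_ _ _ _).hom ≫ ecmp f (ecmp g h) := by
  have := e_assoc' V W X Y Z
  calc _ = ((f ⊗ₘ g) ⊗ₘ h) ≫ eComp V W X Y ▷ _ ≫ eComp V W Y Z := by
        rw [← tensorHom_id, tensorHom_comp_tensorHom_assoc, Category.comp_id]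
    _ = _ := by
        rw [← this, associator_naturality_assoc]
        simp [ecmp, MonoidalCategory.tensorHom_def]

lemma ecmp_map (F : EnrichedFunctor V C D) {X Y Z : C} {A B : V}
    (f : A ⟶ Hom⟪X, Y⟫) (g : B ⟶ Hom⟪Y, Z⟫) :
    ecmp f g ≫ F.map X Z = ecmp (f ≫ F.map X Y) (g ≫ F.map Y Z) := by
  simp [ecmp]

lemma comp_ecmp {X Y Z : C} {A A' B B' : V} (a : A' ⟶ A) (b : B' ⟶ B)
    (f : A ⟶ Hom⟪X, Y⟫) (g : B ⟶ Hom⟪Y, Z⟫) :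
    (a ⊗ₘ b) ≫ ecmp f g = ecmp (a ≫ f) (b ≫ g) := by
  simp [ecmp]

lemma ecmp_id {X Y : C} {A : V} (f : A ⟶ Hom⟪X, Y⟫) :
    ecmp f (eId V Y) = (ρ_ A).hom ≫ f := by
  have := e_comp_id V X Y
  rw [← cancel_epi (ρ_ A).inv]
  simp only [Iso.inv_hom_id_assoc]
  calc _ = f ≫ (ρ_ _).inv ≫ _ ◁ eId V Y ≫ eComp V X Y Y := by
        rw [ecmp, MonoidalCategory.tensorHom_def]
        simp
    _ = _ := by rw [this]; simp

lemma id_ecmp {X Y : C} {A : V} (f : A ⟶ Hom⟪X, Y⟫) :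
    ecmp (eId V X) f = (λ_ A).hom ≫ f := by
  have := e_id_comp V X Y
  rw [← cancel_epi (λ_ A).inv]
  simp only [Iso.inv_hom_id_assoc]
  calc _ = f ≫ (λ_ _).inv ≫ eId V X ▷ _ ≫ eComp V X X Y := by
        rw [ecmp, MonoidalCategory.tensorHom_def']
        simp
    _ = _ := by rw [this]; simp

lemma preC_ecmp {W X Y Z : C} {A B : V} (f : 𝟙_ V ⟶ Hom⟪W, X⟫) (g : A ⟶ Hom⟪X, Y⟫)
    (h : B ⟶ Hom⟪Y, Z⟫) : preC f (ecmp g h) = ecmp (preC f g) h := by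
  have h1 := ecmp_assoc f g h
  have h2 : ecmp (preC f g) h = (λ_ A).inv ▷ B ≫ ecmp (ecmp f g) h := by
    rw [← tensorHom_id, comp_ecmp]; simp [preC]
  rw [h2, h1]
  simp [preC]

lemma ecmp_postC {W X Y Z : C} {A B : V} (f : A ⟶ Hom⟪W, X⟫) (g : B ⟶ Hom⟪X, Y⟫)
    (h : 𝟙_ V ⟶ Hom⟪Y, Z⟫) : ecmp f (postC g h) = postC (ecmp f g) h := by
  have h1 := ecmp_assoc f g h
  have h2 : ecmp f (postC g h) = A ◁ (ρ_ B).inv ≫ ecmp f (ecmp g h) := by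
    rw [← id_tensorHom, comp_ecmp]; simp [postC]
  rw [h2, postC, h1]
  simp

lemma postC_ecmp {W X Y Z : C} {A B : V} (f : A ⟶ Hom⟪W, X⟫) (g : 𝟙_ V ⟶ Hom⟪X, Y⟫)
    (h : B ⟶ Hom⟪Y, Z⟫) : ecmp (postC f g) h = ecmp f (preC g h) := by
  have h1 := ecmp_assoc f g h
  have h2 : ecmp f (preC g h) = A ◁ (λ_ B).inv ≫ ecmp f (ecmp g h) := by
    rw [← id_tensorHom, comp_ecmp]; simp [preC]
  have h3 : ecmp (postC f g) h = (ρ_ A).inv ▷ B ≫ ecmp (ecmp f g) h := by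
    rw [← tensorHom_id, comp_ecmp]; simp [postC]
  rw [h2, h3, h1]
  simp

lemma comp_preC {X Y Z : C} {A A' : V} (a : A' ⟶ A) (f : 𝟙_ V ⟶ Hom⟪X, Y⟫)
    (g : A ⟶ Hom⟪Y, Z⟫) : a ≫ preC f g = preC f (a ≫ g) := by
  simp only [preC, leftUnitor_inv_naturality_assoc, ← id_tensorHom, comp_ecmp, Category.id_comp]

lemma comp_postC {X Y Z : C} {A A' : V} (a : A' ⟶ A) (f : A ⟶ Hom⟪X, Y⟫)
    (g : 𝟙_ V ⟶ Hom⟪Y, Z⟫) : a ≫ postC f g = postC (a ≫ f) g := by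
  simp only [postC, rightUnitor_inv_naturality_assoc, ← tensorHom_id, comp_ecmp, Category.id_comp]

lemma preC_postC {W X Y Z : C} {A : V} (f : 𝟙_ V ⟶ Hom⟪W, X⟫) (g : A ⟶ Hom⟪X, Y⟫)
    (h : 𝟙_ V ⟶ Hom⟪Y, Z⟫) : preC f (postC g h) = postC (preC f g) h := by
  rw [postC, ← comp_preC, preC_ecmp, postC]

lemma preC_preC {W X Y Z : C} {A : V} (f : 𝟙_ V ⟶ Hom⟪W, X⟫) (g : 𝟙_ V ⟶ Hom⟪X, Y⟫)
    (h : A ⟶ Hom⟪Y, Z⟫) : preC f (preC g h) = preC (preC f g) h := by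
  rw [preC.eq_1 g h, ← comp_preC, preC_ecmp, preC.eq_1 (preC f g) h]

lemma postC_postC {W X Y Z : C} {A : V} (f : A ⟶ Hom⟪W, X⟫) (g : 𝟙_ V ⟶ Hom⟪X, Y⟫)
    (h : 𝟙_ V ⟶ Hom⟪Y, Z⟫) : postC (postC f g) h = postC f (preC g h) := by
  rw [postC.eq_1 (postC f g) h, postC_ecmp, postC.eq_1 f (preC g h)]

@[simp] lemma eId_preC {X Y : C} {A : V} (f : A ⟶ Hom⟪X, Y⟫) : preC (eId V X) f = f := by
  simp [preC, id_ecmp]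

@[simp] lemma postC_eId {X Y : C} {A : V} (f : A ⟶ Hom⟪X, Y⟫) : postC f (eId V Y) = f := by
  simp [postC, ecmp_id]

lemma preC_map (F : EnrichedFunctor V C D) {X Y Z : C} {A : V}
    (f : 𝟙_ V ⟶ Hom⟪X, Y⟫) (g : A ⟶ Hom⟪Y, Z⟫) :
    preC f g ≫ F.map X Z = preC (f ≫ F.map X Y) (g ≫ F.map Y Z) := by
  rw [preC, Category.assoc, ecmp_map, preC]

lemma postC_map (F : EnrichedFunctor V C D) {X Y Z : C} {A : V}
    (f : A ⟶ Hom⟪X, Y⟫) (g : 𝟙_ V ⟶ Hom⟪Y, Z⟫) :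
    postC f g ≫ F.map X Z = postC (f ≫ F.map X Y) (g ≫ F.map Y Z) := by
  rw [postC, Category.assoc, ecmp_map, postC]

lemma preC_eq_postC {X Y Z : C} (f : 𝟙_ V ⟶ Hom⟪X, Y⟫) (g : 𝟙_ V ⟶ Hom⟪Y, Z⟫) :
    preC f g = postC f g := by
  simp [preC, postC, unitors_inv_equal]

end Elements

section Natural

variable {V : Type u} [Category.{v} V] [MonoidalCategory V] [SymmetricCategory V]
variable {C : Type w} [EnrichedCategory V C] {D : Type w₁} [EnrichedCategory V D]
  {E : Type w₂} [EnrichedCategory V E]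

/-- `A`-graded `V`-natural families `A ⟶ D(F X, G X)` between `V`-functors: the generalized
elements, of shape `A`, of the object of `V`-natural transformations `F ⟶ G`. -/
abbrev GNat (A : V) (F G : EnrichedFunctor V C D) :=
  GradedNatTrans ((Center.ofBraided V).obj A) F G

/-- `V`-natural transformations.  (Mathlib's morphisms of `EnrichedFunctor`s are natural
transformations of underlying functors, which is weaker than `V`-naturality in general; they are
never used here.) -/
abbrev VNat (F G : EnrichedFunctor V C D) := GNat (𝟙_ V) F G

namespace GNat

/-- The component at `X`. -/
def ap {A : V} {F G : EnrichedFunctor V C D} (p : GNat A F G) (X : C) :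
    A ⟶ Hom⟪F.obj X, G.obj X⟫ := p.app X

/-- Constructor from components and the `V`-naturality hexagon. -/
def mk' {A : V} {F G : EnrichedFunctor V C D}
    (app : ∀ X, A ⟶ Hom⟪F.obj X, G.obj X⟫)
    (h : ∀ X Y, (β_ A Hom⟪X, Y⟫).hom ≫ ecmp (F.map X Y) (app Y) = ecmp (app X) (G.map X Y)) :
    GNat A F G := ⟨app, h⟩

@[simp] lemma mk'_ap {A : V} {F G : EnrichedFunctor V C D}
    (app : ∀ X, A ⟶ Hom⟪F.obj X, G.obj X⟫) (h) (X : C) : (mk' app h).ap X = app X := rfl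

lemma ext' {A : V} {F G : EnrichedFunctor V C D} {p q : GNat A F G}
    (h : ∀ X, p.ap X = q.ap X) : p = q := GradedNatTrans.ext (funext h)

lemma nat {A : V} {F G : EnrichedFunctor V C D} (p : GNat A F G) (X Y : C) :
    (β_ A Hom⟪X, Y⟫).hom ≫ ecmp (F.map X Y) (p.ap Y) = ecmp (p.ap X) (G.map X Y) :=
  p.naturality X Y

lemma nat_elt {A B : V} {F G : EnrichedFunctor V C D} (p : GNat A F G) {X Y : C}
    (h : B ⟶ Hom⟪X, Y⟫) :
    (β_ A B).hom ≫ ecmp (h ≫ F.map X Y) (p.ap Y) = ecmp (p.ap X) (h ≫ G.map X Y) := by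
  have := A ◁ h ≫= p.nat X Y
  rw [braiding_naturality_right_assoc, ← tensorHom_id, comp_ecmp, ← id_tensorHom, comp_ecmp] at this
  simpa using this

lemma nat_unit {A : V} {F G : EnrichedFunctor V C D} (p : GNat A F G) {X Y : C}
    (h : 𝟙_ V ⟶ Hom⟪X, Y⟫) :
    preC (h ≫ F.map X Y) (p.ap Y) = postC (p.ap X) (h ≫ G.map X Y) := by
  rw [postC, ← p.nat_elt h, preC]
  simp [← Category.assoc]

/-- Reindexing of a graded family. -/
def reindex {A A' : V} {F G : EnrichedFunctor V C D} (a : A' ⟶ A) (p : GNat A F G) :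
    GNat A' F G :=
  mk' (fun X => a ≫ p.ap X) (fun X Y => by
    have := a ▷ _ ≫= p.nat X Y
    rw [braiding_naturality_left_assoc, ← tensorHom_id, comp_ecmp, ← id_tensorHom,
      comp_ecmp] at this
    simpa using this)

@[simp] lemma reindex_ap {A A' : V} {F G : EnrichedFunctor V C D} (a : A' ⟶ A) (p : GNat A F G)
    (X : C) : (p.reindex a).ap X = a ≫ p.ap X := rfl

/-- The identity family. -/
def idFam (F : EnrichedFunctor V C D) : VNat F F :=
  mk' (fun X => eId V (F.obj X)) (fun X Y => by
    rw [ecmp_id, id_ecmp]; simp)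

/-- Vertical composition of graded families. -/
def compFam {A B : V} {F G H : EnrichedFunctor V C D} (p : GNat A F G) (q : GNat B G H) :
    GNat (A ⊗ B) F H :=
  mk' (fun X => ecmp (p.ap X) (q.ap X)) (fun X Y => by
    have e1 := p.nat X Y
    have e2 := q.nat X Y
    calc (β_ (A ⊗ B) Hom⟪X, Y⟫).hom ≫ ecmp (F.map X Y) (ecmp (p.ap Y) (q.ap Y))
        = (α_ _ _ _).hom ≫ A ◁ (β_ B _).hom ≫ (α_ _ _ _).inv ≫ (β_ A _).hom ▷ B ≫
          ecmp (ecmp (F.map X Y) (p.ap Y)) (q.ap Y) := by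
          rw [ecmp_assoc]; simp
      _ = (α_ _ _ _).hom ≫ A ◁ (β_ B _).hom ≫ (α_ _ _ _).inv ≫
          ecmp (ecmp (p.ap X) (G.map X Y)) (q.ap Y) := by
          rw [← e1, ← tensorHom_id, comp_ecmp]; simp
      _ = (α_ _ _ _).hom ≫ A ◁ (β_ B _).hom ≫ ecmp (p.ap X) (ecmp (G.map X Y) (q.ap Y)) := by
          rw [ecmp_assoc]; simp
      _ = (α_ _ _ _).hom ≫ ecmp (p.ap X) (ecmp (q.ap X) (H.map X Y)) := by
          rw [← e2, ← id_tensorHom, comp_ecmp]; simp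
      _ = _ := by rw [ecmp_assoc])

@[simp] lemma idFam_ap (F : EnrichedFunctor V C D) (X : C) : (idFam F).ap X = eId V (F.obj X) := rfl

@[simp] lemma compFam_ap {A B : V} {F G H : EnrichedFunctor V C D} (p : GNat A F G)
    (q : GNat B G H) (X : C) : (p.compFam q).ap X = ecmp (p.ap X) (q.ap X) := rfl

/-- Restriction of a family along a `V`-functor. -/
def whisker {A : V} {F G : EnrichedFunctor V C D} (T : EnrichedFunctor V E C) (p : GNat A F G) :
    GNat A (T.comp V F) (T.comp V G) :=
  mk' (fun X => p.ap (T.obj X)) (fun X Y => p.nat_elt (T.map X Y))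

/-- Postcomposition of a family with a `V`-functor. -/
def post {A : V} {F G : EnrichedFunctor V C D} (p : GNat A F G) (H : EnrichedFunctor V D E) :
    GNat A (F.comp V H) (G.comp V H) :=
  mk' (fun X => p.ap X ≫ H.map _ _) (fun X Y => by
    have := p.nat X Y =≫ H.map _ _
    rw [Category.assoc, ecmp_map, ecmp_map] at this
    exact this)

@[simp] lemma whisker_ap {A : V} {F G : EnrichedFunctor V C D} (T : EnrichedFunctor V E C)
    (p : GNat A F G) (X : E) : (p.whisker T).ap X = p.ap (T.obj X) := rfl

@[simp] lemma post_ap {A : V} {F G : EnrichedFunctor V C D} (p : GNat A F G)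
    (H : EnrichedFunctor V D E) (X : C) : (p.post H).ap X = p.ap X ≫ H.map _ _ := rfl

end GNat

end Natural

section Small

/-- A `V`-category is small when its set of isomorphism classes of objects is small, i.e. has the
size of the hom-sets of `V`. -/
class VSmall (V : Type u) [Category.{v} V] [MonoidalCategory V]
    (C : Type w) [EnrichedCategory V C] : Prop where
  small_isoClasses : Small.{v} (Quotient (isIsomorphicSetoid (ForgetEnrichment V C)))

instance (V : Type u) [Category.{v} V] [MonoidalCategory V]
    (C : Type v) [EnrichedCategory V C] : VSmall V C where
  small_isoClasses :=
    small_of_surjective (α := C) (f := fun X => Quotient.mk _ (ForgetEnrichment.of V X))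
      Quotient.mk_surjective

instance (V : Type u) [Category.{v} V] [MonoidalCategory V] [BraidedCategory V]
    (C : Type w) [EnrichedCategory V C] [h : VSmall V C] : VSmall V Cᵒᵖ where
  small_isoClasses := by
    have := h.small_isoClasses
    refine small_of_surjective
      (f := Quotient.lift (s := isIsomorphicSetoid (ForgetEnrichment V C))
        (fun X => (Quotient.mk (isIsomorphicSetoid (ForgetEnrichment V Cᵒᵖ))
          (ForgetEnrichment.of V (op (ForgetEnrichment.to V X))))) ?_) ?_
    · rintro X Y ⟨e⟩
      exact Quotient.sound
        ⟨(forgetEnrichmentOppositeEquivalence V C).inverse.mapIso e.symm.op⟩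
    · intro X
      induction X using Quotient.inductionOn with
      | h X => exact ⟨Quotient.mk _ (ForgetEnrichment.of V (unop (ForgetEnrichment.to V X))), rfl⟩

/-- A small set of representatives of the isomorphism classes of objects, with inverse
isomorphisms in the underlying category. -/
lemma VSmall.exists_reps (V : Type u) [Category.{v} V] [MonoidalCategory V]
    (C : Type w) [EnrichedCategory V C] [h : VSmall V C] :
    ∃ (σ : Type v) (s : σ → C), ∀ X : C, ∃ (i : σ) (f : 𝟙_ V ⟶ Hom⟪X, s i⟫)
      (g : 𝟙_ V ⟶ Hom⟪s i, X⟫), preC f g = eId V X ∧ preC g f = eId V (s i) := by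
  have := h.small_isoClasses
  refine ⟨Shrink.{v} (Quotient (isIsomorphicSetoid (ForgetEnrichment V C))),
    fun i => ForgetEnrichment.to V (Quotient.out ((equivShrink _).symm i)), fun X => ?_⟩
  have e : ForgetEnrichment.of V X ≅ Quotient.out ((equivShrink _).symm (equivShrink _
      (Quotient.mk (isIsomorphicSetoid (ForgetEnrichment V C)) (ForgetEnrichment.of V X)))) := by
    rw [Equiv.symm_apply_apply]
    exact (Classical.choice (Quotient.mk_out (s := isIsomorphicSetoid (ForgetEnrichment V C))
      (ForgetEnrichment.of V X))).symm
  refine ⟨_, ForgetEnrichment.homTo V e.hom, ForgetEnrichment.homTo V e.inv, ?_, ?_⟩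
  · have := congrArg (ForgetEnrichment.homTo V) e.hom_inv_id
    rw [ForgetEnrichment.homTo_comp, ForgetEnrichment.homTo_id] at this
    simpa [preC] using this
  · have := congrArg (ForgetEnrichment.homTo V) e.inv_hom_id
    rw [ForgetEnrichment.homTo_comp, ForgetEnrichment.homTo_id] at this
    simpa [preC] using this

end Small

section Extension

variable {V : Type u} [Category.{v} V] [MonoidalCategory V] [SymmetricCategory V]
variable {C : Type w} [EnrichedCategory V C] {D : Type w₁} [EnrichedCategory V D]
  {F G : EnrichedFunctor V C D}

/-- A graded family is determined by its components at representatives of the objects. -/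
lemma GNat.ext_of_reps {σ : Type w₂} (s : σ → C)
    (hs : ∀ X : C, ∃ (i : σ) (f : 𝟙_ V ⟶ Hom⟪X, s i⟫)
      (g : 𝟙_ V ⟶ Hom⟪s i, X⟫), preC f g = eId V X ∧ preC g f = eId V (s i))
    {A : V} {p q : GNat A F G} (h : ∀ i, p.ap (s i) = q.ap (s i)) : p = q := by
  apply GNat.ext'
  intro X
  obtain ⟨i, f, g, hfg, -⟩ := hs X
  have key : ∀ r : GNat A F G, r.ap X =
      postC (preC (f ≫ F.map _ _) (r.ap (s i))) (g ≫ G.map _ _) := by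
    intro r
    rw [r.nat_unit, postC_postC, ← preC_map, hfg, G.map_id, postC_eId]
  rw [key p, key q, h]

/-- A family which is natural on representatives of the objects extends to all objects. -/
lemma GNat.exists_of_reps {σ : Type w₂} (s : σ → C)
    (hs : ∀ X : C, ∃ (i : σ) (f : 𝟙_ V ⟶ Hom⟪X, s i⟫)
      (g : 𝟙_ V ⟶ Hom⟪s i, X⟫), preC f g = eId V X ∧ preC g f = eId V (s i))
    {A : V} (p : ∀ i, A ⟶ Hom⟪F.obj (s i), G.obj (s i)⟫)
    (hp : ∀ i j, (β_ A Hom⟪s i, s j⟫).hom ≫ ecmp (F.map (s i) (s j)) (p j) =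
      ecmp (p i) (G.map (s i) (s j))) :
    ∃ q : GNat A F G, ∀ i, q.ap (s i) = p i := by
  choose r f g hfg hgf using hs
  have hp' : ∀ i j {B : V} (h : B ⟶ Hom⟪s i, s j⟫),
      (β_ A B).hom ≫ ecmp (h ≫ F.map _ _) (p j) = ecmp (p i) (h ≫ G.map _ _) := by
    intro i j B h
    have := A ◁ h ≫= hp i j
    rw [braiding_naturality_right_assoc, ← tensorHom_id, comp_ecmp, ← id_tensorHom,
      comp_ecmp] at this
    simpa using this
  refine ⟨GNat.mk' (fun X => preC (f X ≫ F.map _ _) (postC (p (r X)) (g X ≫ G.map _ _))) ?_, ?_⟩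
  · intro X Y
    have h1 := hp' (r X) (r Y) (preC (g X) (postC (𝟙 Hom⟪X, Y⟫) (f Y)))
    have h2 := congrArg (fun t => preC (f X ≫ F.map _ _) (postC t (g Y ≫ G.map _ _))) h1
    simp only [preC_map, postC_map, Category.id_comp] at h2
    rw [← comp_postC, ← comp_preC, ← preC_ecmp, ← preC_postC, preC_preC, ← preC_map, hfg,
      F.map_id, eId_preC, postC_ecmp, ← ecmp_postC, ← preC_postC] at h2
    rw [h2, ← ecmp_postC, ← preC_postC, postC_postC, ← preC_map, hfg, G.map_id, postC_eId,
      ← postC_ecmp, preC_ecmp]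
  · intro i
    have h1 := hp' i (r (s i)) (f (s i))
    have h2 : preC (f (s i) ≫ F.map _ _) (p (r (s i))) =
        postC (p i) (f (s i) ≫ G.map _ _) := by
      rw [postC, ← h1, preC]
      simp [← Category.assoc]
    rw [GNat.mk'_ap, preC_postC, h2, postC_postC, ← preC_map, hfg, G.map_id, postC_eId]

end Extension

section Multi

variable {V : Type u} [Category.{v} V]

lemma exists_multiequalizer [HasLimits V] {σ : Type v} (L : σ → V) (R : σ → σ → V)
    (a : ∀ i j, L i ⟶ R i j) (b : ∀ i j, L j ⟶ R i j) :
    ∃ (H : V) (π : ∀ i, H ⟶ L i), (∀ i j, π i ≫ a i j = π j ≫ b i j) ∧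
      ∀ (A : V) (p : ∀ i, A ⟶ L i), (∀ i j, p i ≫ a i j = p j ≫ b i j) →
        ∃! f : A ⟶ H, ∀ i, f ≫ π i = p i := by
  let s : (∏ᶜ L) ⟶ ∏ᶜ (fun ij : σ × σ => R ij.1 ij.2) :=
    Pi.lift (fun ij => Pi.π L ij.1 ≫ a ij.1 ij.2)
  let t : (∏ᶜ L) ⟶ ∏ᶜ (fun ij : σ × σ => R ij.1 ij.2) :=
    Pi.lift (fun ij => Pi.π L ij.2 ≫ b ij.1 ij.2)
  refine ⟨equalizer s t, fun i => equalizer.ι s t ≫ Pi.π L i, fun i j => ?_, fun A p hp => ?_⟩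
  · have := equalizer.condition s t =≫ Pi.π _ (i, j)
    simpa [s, t] using this
  · have h : Pi.lift p ≫ s = Pi.lift p ≫ t := by
      apply Pi.hom_ext
      intro ij
      simpa [s, t] using hp ij.1 ij.2
    refine ⟨equalizer.lift (Pi.lift p) h, fun i => by simp, fun f hf => ?_⟩
    · apply equalizer.hom_ext
      apply Pi.hom_ext
      intro i
      simpa using hf i

lemma exists_multicoequalizer [HasColimits V] {σ : Type v} (L : σ → V) (R : σ → σ → V)
    (a : ∀ i j, R i j ⟶ L i) (b : ∀ i j, R i j ⟶ L j) :
    ∃ (H : V) (ι : ∀ i, L i ⟶ H), (∀ i j, a i j ≫ ι i = b i j ≫ ι j) ∧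
      ∀ (A : V) (p : ∀ i, L i ⟶ A), (∀ i j, a i j ≫ p i = b i j ≫ p j) →
        ∃! f : H ⟶ A, ∀ i, ι i ≫ f = p i := by
  let s : (∐ (fun ij : σ × σ => R ij.1 ij.2)) ⟶ ∐ L :=
    Sigma.desc (fun ij => a ij.1 ij.2 ≫ Sigma.ι L ij.1)
  let t : (∐ (fun ij : σ × σ => R ij.1 ij.2)) ⟶ ∐ L :=
    Sigma.desc (fun ij => b ij.1 ij.2 ≫ Sigma.ι L ij.2)
  refine ⟨coequalizer s t, fun i => Sigma.ι L i ≫ coequalizer.π s t, fun i j => ?_,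
    fun A p hp => ?_⟩
  · have := Sigma.ι (fun ij : σ × σ => R ij.1 ij.2) (i, j) ≫= coequalizer.condition s t
    simpa [s, t] using this
  · have h : s ≫ Sigma.desc p = t ≫ Sigma.desc p := by
      apply Sigma.hom_ext
      intro ij
      simpa [s, t] using hp ij.1 ij.2
    refine ⟨coequalizer.desc (Sigma.desc p) h, fun i => by simp, fun f hf => ?_⟩
    · apply coequalizer.hom_ext
      apply Sigma.hom_ext
      intro i
      simpa using hf i

end Multi

section FunctorCategory

variable {V : Type u} [Category.{v} V] [MonoidalCategory V] [SymmetricCategory V]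
  [MonoidalClosed V]
variable {C : Type w} [EnrichedCategory V C] {D : Type w₁} [EnrichedCategory V D]

/-- The end `∫_X D(F X, G X)` exists when `C` is small. -/
theorem exists_end [HasLimits V] [VSmall V C] (F G : EnrichedFunctor V C D) :
    ∃ (H : V) (π : GNat H F G), ∀ (A : V) (p : GNat A F G), ∃! f : A ⟶ H, π.reindex f = p := by
  obtain ⟨σ, s, hs⟩ := VSmall.exists_reps V C
  let a : ∀ i j : σ, (Hom⟪F.obj (s i), G.obj (s i)⟫ : V) ⟶
      (ihom Hom⟪s i, s j⟫).obj Hom⟪F.obj (s i), G.obj (s j)⟫ := fun i j =>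
    MonoidalClosed.curry ((β_ _ _).hom ≫ ecmp (𝟙 _) (G.map (s i) (s j)))
  let b : ∀ i j : σ, (Hom⟪F.obj (s j), G.obj (s j)⟫ : V) ⟶
      (ihom Hom⟪s i, s j⟫).obj Hom⟪F.obj (s i), G.obj (s j)⟫ := fun i j =>
    MonoidalClosed.curry (ecmp (F.map (s i) (s j)) (𝟙 _))
  have hab : ∀ {A : V} (p : ∀ i, A ⟶ Hom⟪F.obj (s i), G.obj (s i)⟫) (i j : σ),
      (p i ≫ a i j = p j ≫ b i j ↔
        (β_ A Hom⟪s i, s j⟫).hom ≫ ecmp (F.map (s i) (s j)) (p j) =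
          ecmp (p i) (G.map (s i) (s j))) := by
    intro A p i j
    have e1 : p i ≫ a i j = MonoidalClosed.curry
        ((β_ _ _).hom ≫ ecmp (p i) (G.map (s i) (s j))) := by
      rw [← MonoidalClosed.curry_natural_left, braiding_naturality_right_assoc, ← tensorHom_id,
        comp_ecmp]
      simp
    have e2 : p j ≫ b i j = MonoidalClosed.curry (ecmp (F.map (s i) (s j)) (p j)) := by
      rw [← MonoidalClosed.curry_natural_left, ← id_tensorHom, comp_ecmp]
      simp
    rw [e1, e2, MonoidalClosed.curry_injective.eq_iff]
    constructor
    · intro h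
      rw [← h]
      simp
    · intro h
      rw [← h]
      simp
  obtain ⟨H, π₀, hπ₀, huniv⟩ := exists_multiequalizer _ _ a b
  obtain ⟨π, hπ⟩ := GNat.exists_of_reps s hs (F := F) (G := G) π₀
    (fun i j => (hab π₀ i j).1 (hπ₀ i j))
  refine ⟨H, π, fun A p => ?_⟩
  obtain ⟨f, hf, hf'⟩ := huniv A (fun i => p.ap (s i)) (fun i j =>
    (hab (fun i => p.ap (s i)) i j).2 (p.nat _ _))
  refine ⟨f, ?_, fun g hg => hf' g fun i => ?_⟩
  · apply GNat.ext_of_reps s hs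
    intro i
    rw [GNat.reindex_ap, hπ]
    exact hf i
  · rw [← hg, GNat.reindex_ap, hπ]

variable [HasLimits V] [VSmall V C]

/-- The hom-object `[C, D](F, G) = ∫_X D(F X, G X)` of the functor `V`-category. -/
noncomputable def natObj (F G : EnrichedFunctor V C D) : V := (exists_end F G).choose

/-- The universal `V`-natural family `[C, D](F, G) ⟶ D(F X, G X)`. -/
noncomputable def natFam (F G : EnrichedFunctor V C D) : GNat (natObj F G) F G :=
  (exists_end F G).choose_spec.choose

/-- The projection `[C, D](F, G) ⟶ D(F X, G X)` of the end. -/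
noncomputable def natπ (F G : EnrichedFunctor V C D) (X : C) :
    natObj F G ⟶ Hom⟪F.obj X, G.obj X⟫ := (natFam F G).ap X

/-- The morphism into the end induced by a `V`-natural family. -/
noncomputable def natLift {F G : EnrichedFunctor V C D} {A : V} (p : GNat A F G) :
    A ⟶ natObj F G := ((exists_end F G).choose_spec.choose_spec A p).choose

@[simp]
lemma natLift_π {F G : EnrichedFunctor V C D} {A : V} (p : GNat A F G) (X : C) :
    natLift p ≫ natπ F G X = p.ap X := by
  have := ((exists_end F G).choose_spec.choose_spec A p).choose_spec.1
  exact congrArg (fun q => GNat.ap q X) this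

lemma natObj_ext {F G : EnrichedFunctor V C D} {A : V} {f g : A ⟶ natObj F G}
    (h : ∀ X, f ≫ natπ F G X = g ≫ natπ F G X) : f = g := by
  have := ((exists_end F G).choose_spec.choose_spec A ((natFam F G).reindex g))
  exact this.unique (GNat.ext' h) rfl

/-- The functor `V`-category `[C, D]`, for small `C`. -/
noncomputable instance functorCategory : EnrichedCategory V (EnrichedFunctor V C D) where
  Hom F G := natObj F G
  id F := natLift (GNat.idFam F)
  comp F G H := natLift ((natFam F G).compFam (natFam G H))
  id_comp F G := by
    apply natObj_ext
    intro X
    rw [Category.assoc, Category.assoc, natLift_π, Category.id_comp, GNat.compFam_ap,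
      ← tensorHom_id, comp_ecmp]
    erw [natLift_π]
    simp [id_ecmp]
    rfl
  comp_id F G := by
    apply natObj_ext
    intro X
    rw [Category.assoc, Category.assoc, natLift_π, Category.id_comp, GNat.compFam_ap,
      ← id_tensorHom, comp_ecmp]
    erw [natLift_π]
    simp [ecmp_id]
    rfl
  assoc F G H K := by
    apply natObj_ext
    intro X
    simp only [Category.assoc, natLift_π, GNat.compFam_ap]
    rw [← tensorHom_id, comp_ecmp, ← id_tensorHom, comp_ecmp]
    erw [natLift_π, natLift_π]
    rw [GNat.compFam_ap, GNat.compFam_ap, Category.id_comp, Category.id_comp, ecmp_assoc]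
    simp

@[simp] lemma eId_π (F : EnrichedFunctor V C D) (X : C) :
    eId V F ≫ natπ F F X = eId V (F.obj X) := natLift_π _ _

lemma ecmp_π {F G H : EnrichedFunctor V C D} {A B : V} (f : A ⟶ Hom⟪F, G⟫) (g : B ⟶ Hom⟪G, H⟫)
    (X : C) : ecmp f g ≫ natπ F H X = ecmp (f ≫ natπ F G X) (g ≫ natπ G H X) := by
  have : eComp V F G H ≫ natπ F H X = ecmp (natπ F G X) (natπ G H X) := natLift_π _ _
  rw [Category.assoc, this, comp_ecmp]

lemma preC_π {F G H : EnrichedFunctor V C D} {A : V} (f : 𝟙_ V ⟶ Hom⟪F, G⟫) (g : A ⟶ Hom⟪G, H⟫)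
    (X : C) : preC f g ≫ natπ F H X = preC (f ≫ natπ F G X) (g ≫ natπ G H X) := by
  rw [preC, Category.assoc, ecmp_π, preC]

lemma postC_π {F G H : EnrichedFunctor V C D} {A : V} (f : A ⟶ Hom⟪F, G⟫) (g : 𝟙_ V ⟶ Hom⟪G, H⟫)
    (X : C) : postC f g ≫ natπ F H X = postC (f ≫ natπ F G X) (g ≫ natπ G H X) := by
  rw [postC, Category.assoc, ecmp_π, postC]

lemma functorHom_ext {F G : EnrichedFunctor V C D} {A : V} {f g : A ⟶ Hom⟪F, G⟫}
    (h : ∀ X, f ≫ natπ F G X = g ≫ natπ F G X) : f = g := natObj_ext h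

end FunctorCategory

section Opposites

variable {V : Type u} [Category.{v} V] [MonoidalCategory V] [SymmetricCategory V]
variable {C : Type w} [EnrichedCategory V C] {D : Type w₁} [EnrichedCategory V D]

lemma eComp_op (X Y Z : Cᵒᵖ) :
    eComp V X Y Z = (β_ _ _).hom ≫ eComp V Z.unop Y.unop X.unop := rfl

lemma ecmp_op {X Y Z : C} {A B : V} (f : A ⟶ Hom⟪X, Y⟫) (g : B ⟶ Hom⟪Y, Z⟫) :
    ecmp (C := Cᵒᵖ) (X := op Z) (Y := op Y) (Z := op X) g f = (β_ _ _).hom ≫ ecmp f g := by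
  show (g ⊗ₘ f) ≫ (β_ _ _).hom ≫ eComp V X Y Z = _
  rw [braiding_naturality_assoc]

/-- The opposite `Cᵒᵖ ⟶ Dᵒᵖ` of a `V`-functor `C ⟶ D`. -/
def opFunctor (F : EnrichedFunctor V C D) : EnrichedFunctor V Cᵒᵖ Dᵒᵖ where
  obj X := op (F.obj X.unop)
  map X Y := F.map Y.unop X.unop
  map_id X := F.map_id X.unop
  map_comp X Y Z := by
    have := F.map_comp Z.unop Y.unop X.unop
    rw [eComp_op, Category.assoc]
    erw [this]
    rw [eComp_op, ← braiding_naturality_assoc]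

/-- The `V`-functor `C ⟶ Dᵒᵖ` corresponding to a `V`-functor `Cᵒᵖ ⟶ D`. -/
def rightOp (F : EnrichedFunctor V Cᵒᵖ D) : EnrichedFunctor V C Dᵒᵖ where
  obj X := op (F.obj (op X))
  map X Y := F.map (op Y) (op X)
  map_id X := F.map_id (op X)
  map_comp X Y Z := by
    have := F.map_comp (op Z) (op Y) (op X)
    have h := ecmp_op (C := D) (F.map (op Z) (op Y)) (F.map (op Y) (op X))
    refine Eq.trans ?_ h.symm
    refine Eq.trans ?_ (congrArg (fun t => (β_ _ _).hom ≫ t) this)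
    rw [eComp_op, Category.assoc]
    exact (SymmetricCategory.symmetry_assoc _ _ _).symm

end Opposites

section HomFunctors

variable {V : Type u} [Category.{v} V] [MonoidalCategory V] [MonoidalClosed V]

lemma uncurry_comp {X Y Z A B : V} (f : A ⟶ (ihom X).obj Y) (g : B ⟶ (ihom Y).obj Z) :
    MonoidalClosed.uncurry ((f ⊗ₘ g) ≫ MonoidalClosed.comp X Y Z) =
      (α_ _ _ _).inv ≫ MonoidalClosed.uncurry f ▷ B ≫ MonoidalClosed.uncurry g := by
  rw [MonoidalClosed.comp_eq, ← MonoidalClosed.curry_natural_left, MonoidalClosed.uncurry_curry,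
    MonoidalClosed.uncurry_eq, MonoidalClosed.uncurry_eq, MonoidalClosed.compTranspose_eq,
    ← id_tensorHom, associator_inv_naturality_assoc]
  simp only [MonoidalCategory.tensorHom_def, id_whiskerRight, Category.id_comp, comp_whiskerRight,
    Category.assoc, whisker_exchange_assoc]
  rfl

lemma uncurry_ecmp {X Y Z A B : V} (f : A ⟶ Hom⟪X, Y⟫) (g : B ⟶ Hom⟪Y, Z⟫) :
    MonoidalClosed.uncurry (ecmp f g) =
      (α_ _ _ _).inv ≫ MonoidalClosed.uncurry f ▷ B ≫ MonoidalClosed.uncurry g :=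
  uncurry_comp f g

/-- The representable `V`-functor `C(X, -) : C ⟶ V`. -/
def homFunctor (V : Type u) [Category.{v} V] [MonoidalCategory V] [MonoidalClosed V]
    {C : Type w} [EnrichedCategory V C] (X : C) : EnrichedFunctor V C V where
  obj Y := Hom⟪X, Y⟫
  map Y Z := MonoidalClosed.curry (eComp V X Y Z)
  map_id Y := by
    rw [← MonoidalClosed.curry_natural_left]
    show _ = MonoidalClosed.curry (ρ_ _).hom
    congr 1
    have := e_comp_id V X Y
    rw [Iso.inv_comp_eq] at this
    simpa using this
  map_comp Y Z W := by
    have := e_assoc' V X Y Z W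
    rw [← Category.assoc] at this
    apply MonoidalClosed.uncurry_injective
    rw [← MonoidalClosed.curry_natural_left, MonoidalClosed.uncurry_curry]
    erw [uncurry_ecmp]
    rw [MonoidalClosed.uncurry_curry, MonoidalClosed.uncurry_curry, ← e_assoc' V X Y Z W]
    simp

end HomFunctors

section Yoneda

variable {V : Type u} [Category.{v} V] [MonoidalCategory V] [SymmetricCategory V]
  [MonoidalClosed V]
variable {C : Type w} [EnrichedCategory V C] {𝒜 : Type w₁} [EnrichedCategory V 𝒜]

lemma coy_nat (a a' x y : 𝒜) :
    (β_ (Hom⟪a', a⟫ : V) Hom⟪x, y⟫).hom ≫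
      (MonoidalClosed.curry (eComp V a x y) ⊗ₘ
        MonoidalClosed.curry ((β_ _ _).hom ≫ eComp V a' a y)) ≫ MonoidalClosed.comp _ _ _ =
    (MonoidalClosed.curry ((β_ _ _).hom ≫ eComp V a' a x) ⊗ₘ
        MonoidalClosed.curry (eComp V a' x y)) ≫ MonoidalClosed.comp _ _ _ := by
  apply MonoidalClosed.uncurry_injective
  rw [MonoidalClosed.uncurry_natural_left, uncurry_comp, uncurry_comp]
  simp only [MonoidalClosed.uncurry_curry]
  rw [braiding_naturality_left_assoc, comp_whiskerRight, Category.assoc,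
    ← e_assoc', braiding_tensor_left_hom]
  simp only [Category.assoc, Iso.inv_hom_id_assoc]
  rw [← MonoidalCategory.whiskerLeft_comp_assoc, SymmetricCategory.symmetry]
  simp

/-- The contravariant action `𝒜(a', a) ⟶ [𝒜(a, x), 𝒜(a', x)]`, as a `V`-natural family in `x`. -/
def coyFam (a a' : 𝒜) : GNat (Hom⟪a', a⟫ : V) (homFunctor V a) (homFunctor V a') :=
  GNat.mk' (fun x => (homFunctor V (op x)).map (op a) (op a')) (fun x y => coy_nat a a' x y)

@[simp] lemma coyFam_ap (a a' x : 𝒜) :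
    (coyFam (V := V) a a').ap x = (homFunctor V (op x)).map (op a) (op a') := rfl

/-- The covariant action `𝒜(a, a') ⟶ [𝒜(x, a), 𝒜(x, a')]`, as a `V`-natural family in
`x : 𝒜ᵒᵖ`. -/
def yonFam (a a' : 𝒜) : GNat (Hom⟪a, a'⟫ : V) (homFunctor V (op a)) (homFunctor V (op a')) :=
  GNat.mk' (fun x => (homFunctor V x.unop).map a a') (fun x y => by
    have := (coyFam (V := V) (op a) (op a')).nat x y
    have e : ∀ z : 𝒜ᵒᵖ, (coyFam (V := V) (op a) (op a')).ap z =
        (homFunctor V z.unop).map a a' := by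
      intro z
      apply MonoidalClosed.uncurry_injective
      refine (MonoidalClosed.uncurry_curry _).trans
        (Eq.trans ?_ (MonoidalClosed.uncurry_curry _).symm)
      exact (SymmetricCategory.symmetry_assoc _ _ _)
    rw [e, e] at this
    exact this)

@[simp] lemma yonFam_ap (a a' : 𝒜) (x : 𝒜ᵒᵖ) :
    (yonFam (V := V) a a').ap x = (homFunctor V x.unop).map a a' := rfl

variable [HasLimits V] [VSmall V C]

/-- For `T : C ⟶ 𝒜` with `C` small, the `V`-functor `𝒜ᵒᵖ ⟶ [C, V]`, `a ↦ 𝒜(a, T -)`. -/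
noncomputable def conerve (T : EnrichedFunctor V C 𝒜) :
    EnrichedFunctor V 𝒜ᵒᵖ (EnrichedFunctor V C V) where
  obj a := T.comp V (homFunctor V a.unop)
  map a a' := natLift ((coyFam a.unop a'.unop).whisker T)
  map_id a := by
    apply functorHom_ext
    intro x
    rw [Category.assoc, natLift_π, eId_π]
    exact (homFunctor V (op (T.obj x))).map_id a
  map_comp a b c := by
    apply functorHom_ext
    intro x
    rw [Category.assoc, natLift_π]
    erw [ecmp_π]
    rw [natLift_π, natLift_π]
    exact (homFunctor V (op (T.obj x))).map_comp a b c

variable (V C) in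
/-- The Yoneda embedding `Y' : Cᵒᵖ ⟶ [C, V]`, `c ↦ C(c, -)`. -/
noncomputable def coyonedaEmb : EnrichedFunctor V Cᵒᵖ (EnrichedFunctor V C V) where
  obj c := homFunctor V c.unop
  map c c' := natLift (coyFam c.unop c'.unop)
  map_id a := by
    apply functorHom_ext
    intro x
    rw [Category.assoc, natLift_π, eId_π]
    exact (homFunctor V (op x)).map_id a
  map_comp a b c := by
    apply functorHom_ext
    intro x
    rw [Category.assoc, natLift_π]
    erw [ecmp_π]
    rw [natLift_π, natLift_π]
    exact (homFunctor V (op x)).map_comp a b c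

variable (V C) in
/-- The Yoneda embedding `Y : C ⟶ [Cᵒᵖ, V]`, `c ↦ C(-, c)`. -/
noncomputable def yonedaEmb : EnrichedFunctor V C (EnrichedFunctor V Cᵒᵖ V) where
  obj c := homFunctor V (op c)
  map c c' := natLift (yonFam c c')
  map_id a := by
    apply functorHom_ext
    intro x
    rw [Category.assoc, natLift_π, eId_π]
    exact (homFunctor V x.unop).map_id a
  map_comp a b c := by
    apply functorHom_ext
    intro x
    rw [Category.assoc, natLift_π]
    erw [ecmp_π]
    rw [natLift_π, natLift_π]
    exact (homFunctor V x.unop).map_comp a b c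

/-- For `S : C ⟶ 𝒜` with `C` small, the `V`-functor `S̃ : 𝒜 ⟶ [Cᵒᵖ, V]`, `a ↦ 𝒜(S -, a)`. -/
noncomputable def nerve (S : EnrichedFunctor V C 𝒜) :
    EnrichedFunctor V 𝒜 (EnrichedFunctor V Cᵒᵖ V) where
  obj a := (opFunctor S).comp V (homFunctor V (op a))
  map a a' := natLift ((yonFam a a').whisker (opFunctor S))
  map_id a := by
    apply functorHom_ext
    intro x
    rw [Category.assoc, natLift_π, eId_π]
    exact (homFunctor V (S.obj x.unop)).map_id a
  map_comp a b c := by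
    apply functorHom_ext
    intro x
    rw [Category.assoc, natLift_π]
    erw [ecmp_π]
    rw [natLift_π, natLift_π]
    exact (homFunctor V (S.obj x.unop)).map_comp a b c

end Yoneda

section WeightedColimits

variable {V : Type u} [Category.{v} V] [MonoidalCategory V] [SymmetricCategory V]
  [MonoidalClosed V]
variable {K : Type w} [EnrichedCategory V K] {𝒜 : Type w₁} [EnrichedCategory V 𝒜]
  {ℬ : Type w₂} [EnrichedCategory V ℬ]

/-- The action `F X ⊗ K(X, Y) ⟶ F Y` of a `V`-valued `V`-functor. -/
def act (F : EnrichedFunctor V K V) (X Y : K) : F.obj X ⊗ Hom⟪X, Y⟫ ⟶ F.obj Y :=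
  MonoidalClosed.uncurry (F.map X Y)

lemma uncurry_curry' {X Y : V} (f : X ⟶ Y) :
    MonoidalClosed.uncurry (MonoidalClosed.curry' f) = (ρ_ X).hom ≫ f :=
  MonoidalClosed.uncurry_curry _

/-- A `V`-natural transformation between `V`-valued `V`-functors, from morphisms `F X ⟶ G X`
compatible with the actions of the hom-objects. -/
def VNat.ofHom {F G : EnrichedFunctor V K V} (f : ∀ X, F.obj X ⟶ G.obj X)
    (hf : ∀ X Y, act F X Y ≫ f Y = f X ▷ _ ≫ act G X Y) : VNat F G :=
  GNat.mk' (fun X => MonoidalClosed.curry' (f X)) (fun X Y => by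
    apply MonoidalClosed.uncurry_injective
    rw [MonoidalClosed.uncurry_natural_left]
    refine (congrArg (fun t => _ ◁ _ ≫ t) (uncurry_ecmp _ _)).trans
      (Eq.trans ?_ (uncurry_ecmp _ _).symm)
    simp only [uncurry_curry', comp_whiskerRight, Category.assoc]
    have := hf X Y
    simp only [act] at this
    rw [← this]
    simp)

variable [HasLimits V]

section

variable [VSmall V K]

lemma nerveMap_aux (F : EnrichedFunctor V 𝒜 ℬ) (x y c : 𝒜) {B : V} (s : B ⟶ Hom⟪y, x⟫) :
    ((Hom⟪x, c⟫ : V) ◁ s ≫ (β_ _ _).hom ≫ eComp V y x c) ≫ F.map y c =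
      F.map x c ▷ B ≫ (Hom⟪F.obj x, F.obj c⟫ : V) ◁ (s ≫ F.map y x) ≫ (β_ _ _).hom ≫
        eComp V (F.obj y) (F.obj x) (F.obj c) := by
  simp only [Category.assoc, F.map_comp, MonoidalCategory.whiskerLeft_comp,
    MonoidalCategory.tensorHom_def, braiding_naturality_right_assoc,
    braiding_naturality_left_assoc, whisker_exchange_assoc]

lemma act_nerve (S : EnrichedFunctor V K 𝒜) (c : 𝒜) (X Y : Kᵒᵖ) :
    act ((nerve S).obj c) X Y = (Hom⟪S.obj X.unop, c⟫ : V) ◁ S.map Y.unop X.unop ≫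
      (β_ _ _).hom ≫ eComp V (S.obj Y.unop) (S.obj X.unop) c := by
  show MonoidalClosed.uncurry (S.map Y.unop X.unop ≫ MonoidalClosed.curry ((β_ _ _).hom ≫
    eComp V (S.obj Y.unop) (S.obj X.unop) c)) = _
  rw [MonoidalClosed.uncurry_natural_left, MonoidalClosed.uncurry_curry]

/-- The `V`-natural transformation `𝒜(S -, c) ⟶ ℬ(F S -, F c)` given by a `V`-functor `F`. -/
noncomputable def nerveMap (F : EnrichedFunctor V 𝒜 ℬ) (S : EnrichedFunctor V K 𝒜) (c : 𝒜) :
    VNat ((nerve S).obj c) ((nerve (S.comp V F)).obj (F.obj c)) :=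
  VNat.ofHom (fun X => F.map (S.obj X.unop) c) (fun X Y => by
    rw [act_nerve, act_nerve]
    exact nerveMap_aux F _ _ c (S.map Y.unop X.unop))

/-- The canonical morphism `𝒜(c, a) ⟶ [Kᵒᵖ, V](φ, 𝒜(S -, a))` induced by a `V`-natural
transformation `μ : φ ⟶ 𝒜(S -, c)`. -/
noncomputable def colimitComparison (φ : EnrichedFunctor V Kᵒᵖ V) (S : EnrichedFunctor V K 𝒜)
    {c : 𝒜} (μ : VNat φ ((nerve S).obj c)) (a : 𝒜) :
    (Hom⟪c, a⟫ : V) ⟶ Hom⟪φ, (nerve S).obj a⟫ :=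
  preC (natLift μ) ((nerve S).map c a)

/-- `c`, with the unit `μ : φ ⟶ 𝒜(S -, c)`, is the `φ`-weighted colimit `φ * S` of `S`:
`𝒜(c, a) ≅ [Kᵒᵖ, V](φ, 𝒜(S -, a))`. -/
def IsWeightedColimit (φ : EnrichedFunctor V Kᵒᵖ V) (S : EnrichedFunctor V K 𝒜)
    {c : 𝒜} (μ : VNat φ ((nerve S).obj c)) : Prop :=
  ∀ a : 𝒜, IsIso (colimitComparison φ S μ a)

/-- Composite of `V`-natural transformations. -/
def VNat.comp {F G H : EnrichedFunctor V K 𝒜} (α : VNat F G) (β : VNat G H) : VNat F H :=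
  (α.compFam β).reindex (λ_ (𝟙_ V)).inv

end

/-- A `V`-functor is cocontinuous if it preserves all small weighted colimits that exist in its
domain. -/
def Cocontinuous (F : EnrichedFunctor V 𝒜 ℬ) : Prop :=
  ∀ (K : Type v) [EnrichedCategory V K] (φ : EnrichedFunctor V Kᵒᵖ V)
    (S : EnrichedFunctor V K 𝒜) (c : 𝒜) (μ : VNat φ ((nerve S).obj c)),
    IsWeightedColimit φ S μ →
      IsWeightedColimit φ (S.comp V F) (c := F.obj c) (VNat.comp μ (nerveMap F S c))

variable (V) in
/-- An object `a` is a small projective if `𝒜(a, -) : 𝒜 ⟶ V` is cocontinuous. -/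
def IsSmallProjective (a : 𝒜) : Prop := Cocontinuous (homFunctor V a)

end WeightedColimits

section Coend

variable {V : Type u} [Category.{v} V] [MonoidalCategory V] [SymmetricCategory V]
  [MonoidalClosed V] [HasLimits V]
variable {K : Type w} [EnrichedCategory V K] [VSmall V K]

/-- The transpose of `p : W ⟶ [Y, [X, a]]`. -/
def tr {W X Y a : V} (p : W ⟶ (ihom Y).obj ((ihom X).obj a)) : X ⊗ (Y ⊗ W) ⟶ a :=
  MonoidalClosed.uncurry (MonoidalClosed.uncurry p)

lemma tr_injective {W X Y a : V} {p q : W ⟶ (ihom Y).obj ((ihom X).obj a)} (h : tr p = tr q) : p = q :=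
  MonoidalClosed.uncurry_injective (MonoidalClosed.uncurry_injective h)

lemma comp_tr {W W' X Y a : V} (f : W' ⟶ W) (p : W ⟶ (ihom Y).obj ((ihom X).obj a)) :
    tr (f ≫ p) = X ◁ Y ◁ f ≫ tr p := by
  rw [tr, MonoidalClosed.uncurry_natural_left, MonoidalClosed.uncurry_natural_left, tr]

/-- The right action. -/
lemma tr_left (φ : EnrichedFunctor V Kᵒᵖ V) (X a : V) (i j : Kᵒᵖ) {W : V}
    (p : W ⟶ Hom⟪φ.obj i, (Hom⟪X, a⟫ : V)⟫) :
    tr ((β_ W Hom⟪j, i⟫).hom ≫ ecmp (φ.map j i) p) =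
      X ◁ (φ.obj j ◁ (β_ _ _).hom ≫ (α_ _ _ _).inv ≫ act φ j i ▷ W) ≫ tr p := by
  rw [comp_tr, tr]
  refine (congrArg (fun t => _ ≫ MonoidalClosed.uncurry t) (uncurry_ecmp _ _)).trans ?_
  rw [MonoidalClosed.uncurry_natural_left, MonoidalClosed.uncurry_natural_left]
  simp only [MonoidalCategory.whiskerLeft_comp, Category.assoc]
  rfl

lemma tr_aux {Xi Xj Y W B a : V} (p : W ⟶ (ihom Y).obj ((ihom Xj).obj a))
    (x : B ⟶ (ihom Xi).obj Xj) :
    MonoidalClosed.uncurry ((α_ Y W B).inv ≫ MonoidalClosed.uncurry p ▷ B ≫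
      (ihom Xj).obj a ◁ x ≫ (β_ _ _).hom ≫ MonoidalClosed.comp Xi Xj a) =
    Xi ◁ ((α_ _ _ _).inv ≫ (β_ (Y ⊗ W) B).hom) ≫ (α_ _ _ _).inv ≫
      MonoidalClosed.uncurry x ▷ (Y ⊗ W) ≫ tr p := by
  rw [MonoidalClosed.uncurry_natural_left, MonoidalClosed.uncurry_natural_left,
    braiding_naturality_right_assoc, MonoidalClosed.uncurry_natural_left,
    MonoidalClosed.uncurry_natural_left, MonoidalClosed.comp_eq, MonoidalClosed.uncurry_curry,
    MonoidalClosed.compTranspose_eq, tr, MonoidalClosed.uncurry_eq (MonoidalClosed.uncurry p),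
    MonoidalClosed.uncurry_eq x]
  simp only [MonoidalCategory.whiskerLeft_comp, Category.assoc]
  rw [← MonoidalCategory.whiskerLeft_comp_assoc Xi (MonoidalClosed.uncurry p ▷ B),
    braiding_naturality_left]
  simp only [MonoidalCategory.whiskerLeft_comp, Category.assoc]
  congr 2
  rw [← whisker_exchange_assoc]
  simp [whisker_exchange_assoc]

lemma tr_right (X : EnrichedFunctor V K V) (Y a : V) (i j : K) {W : V}
    (p : W ⟶ (ihom Y).obj ((ihom (X.obj j)).obj a)) :
    tr (ecmp p (((nerve X).obj a).map (op j) (op i))) =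
      X.obj i ◁ ((α_ _ _ _).inv ≫ (β_ (Y ⊗ W) (Hom⟪i, j⟫ : V)).hom) ≫ (α_ _ _ _).inv ≫
        act X i j ▷ (Y ⊗ W) ≫ tr p := by
  refine (congrArg MonoidalClosed.uncurry (uncurry_ecmp _ _)).trans ?_
  have h : MonoidalClosed.uncurry (((nerve X).obj a).map (op j) (op i)) =
      ((ihom (X.obj j)).obj a) ◁ X.map i j ≫ (β_ _ _).hom ≫ MonoidalClosed.comp _ _ _ :=
    act_nerve X a (op j) (op i)
  refine (congrArg (fun t => MonoidalClosed.uncurry (_ ≫ _ ≫ t)) h).trans ?_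
  exact tr_aux p (X.map i j)

lemma nat_left (φ : EnrichedFunctor V Kᵒᵖ V) (X a : V) (i j : Kᵒᵖ) {W : V}
    (p : W ⟶ Hom⟪φ.obj i, (Hom⟪X, a⟫ : V)⟫) :
    ((α_ X (φ.obj j ⊗ Hom⟪j, i⟫) W).hom ≫ X ◁ ((α_ _ _ _).hom ≫ φ.obj j ◁ (β_ _ W).hom)) ≫
      tr ((β_ W Hom⟪j, i⟫).hom ≫ ecmp (φ.map j i) p) =
    (X ◁ act φ j i) ▷ W ≫ (α_ _ _ _).hom ≫ tr p := by
  rw [tr_left, Category.assoc, ← MonoidalCategory.whiskerLeft_comp_assoc, Category.assoc,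
    ← MonoidalCategory.whiskerLeft_comp_assoc (φ.obj j), SymmetricCategory.symmetry]
  simp

lemma nat_right_aux {Xi Xj Y W B a : V} (x : Xi ⊗ B ⟶ Xj) (t : Xj ⊗ (Y ⊗ W) ⟶ a) :
    ((α_ Xi (Y ⊗ B) W).hom ≫ Xi ◁ ((α_ _ _ _).hom ≫ Y ◁ (β_ _ W).hom)) ≫
      Xi ◁ ((α_ _ _ _).inv ≫ (β_ (Y ⊗ W) B).hom) ≫ (α_ _ _ _).inv ≫ x ▷ (Y ⊗ W) ≫ t =
    (Xi ◁ (β_ _ _).hom ≫ (α_ _ _ _).inv ≫ x ▷ Y) ▷ W ≫ (α_ _ _ _).hom ≫ t := by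
  have h : (α_ Y B W).hom ≫ Y ◁ (β_ B W).hom ≫ (α_ _ _ _).inv ≫ (β_ (Y ⊗ W) B).hom =
      (β_ Y B).hom ▷ W ≫ (α_ _ _ _).hom := by
    rw [braiding_tensor_left_hom, Iso.inv_hom_id_assoc,
      ← MonoidalCategory.whiskerLeft_comp_assoc Y, SymmetricCategory.symmetry]
    simp
  rw [Category.assoc, ← MonoidalCategory.whiskerLeft_comp_assoc, Category.assoc, h]
  simp

lemma nat_right (X : EnrichedFunctor V K V) (Y a : V) (i j : K) {W : V}
    (p : W ⟶ (ihom Y).obj ((ihom (X.obj j)).obj a)) :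
    ((α_ (X.obj i) (Y ⊗ (Hom⟪i, j⟫ : V)) W).hom ≫
      X.obj i ◁ ((α_ _ _ _).hom ≫ Y ◁ (β_ _ W).hom)) ≫
      tr (ecmp p (((nerve X).obj a).map (op j) (op i))) =
    (X.obj i ◁ (β_ _ _).hom ≫ (α_ _ _ _).inv ≫ act X i j ▷ Y) ▷ W ≫ (α_ _ _ _).hom ≫ tr p :=
  (congrArg (fun t => _ ≫ t) (tr_right X Y a i j p)).trans (nat_right_aux _ _)

lemma nat_iff (φ : EnrichedFunctor V Kᵒᵖ V) (X : EnrichedFunctor V K V) (a : V) (i j : K) {W : V}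
    (p : W ⟶ (ihom (φ.obj (op i))).obj ((ihom (X.obj i)).obj a))
    (q : W ⟶ (ihom (φ.obj (op j))).obj ((ihom (X.obj j)).obj a)) :
    (β_ W (Hom⟪op j, op i⟫ : V)).hom ≫
        ecmp (Z := ((nerve X).obj a).obj (op i)) (φ.map (op j) (op i)) p =
      ecmp (Y := ((nerve X).obj a).obj (op j)) q (((nerve X).obj a).map (op j) (op i)) ↔
    (X.obj i ◁ act φ (op j) (op i)) ▷ W ≫ (α_ _ _ _).hom ≫ tr p =
      (X.obj i ◁ (β_ (φ.obj (op j)) (Hom⟪i, j⟫ : V)).hom ≫ (α_ _ _ _).inv ≫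
        act X i j ▷ φ.obj (op j)) ▷ W ≫ (α_ _ _ _).hom ≫ tr q := by
  have h1 := nat_left φ (X.obj i) a (op i) (op j) p
  have h2 := nat_right X (φ.obj (op j)) a i j q
  constructor
  · intro h
    exact h1.symm.trans ((congrArg (fun t => _ ≫ tr t) h).trans h2)
  · intro h
    apply tr_injective
    exact (cancel_epi ((α_ (X.obj i) (φ.obj (op j) ⊗ Hom⟪op j, op i⟫) W).hom ≫
      X.obj i ◁ ((α_ _ _ _).hom ≫ φ.obj (op j) ◁ (β_ _ W).hom))).1 (h1.trans (h.trans h2.symm))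

/-- The transpose `X ⊗ Y ⟶ [W, a]` of `p : W ⟶ [Y, [X, a]]`. -/
def tq {W X Y a : V} (p : W ⟶ (ihom Y).obj ((ihom X).obj a)) : X ⊗ Y ⟶ (ihom W).obj a :=
  MonoidalClosed.curry ((β_ W (X ⊗ Y)).hom ≫ (α_ _ _ _).hom ≫ tr p)

lemma whisker_tr {W X Y a M : V} (m : M ⟶ X ⊗ Y) (p : W ⟶ (ihom Y).obj ((ihom X).obj a)) :
    m ▷ W ≫ (α_ _ _ _).hom ≫ tr p = (β_ _ _).hom ≫ MonoidalClosed.uncurry (m ≫ tq p) := by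
  rw [MonoidalClosed.uncurry_natural_left, tq, MonoidalClosed.uncurry_curry,
    braiding_naturality_right_assoc, SymmetricCategory.symmetry_assoc]

lemma tq_injective {W X Y a : V} {p q : W ⟶ (ihom Y).obj ((ihom X).obj a)} (h : tq p = tq q) :
    p = q := by
  apply tr_injective
  have := MonoidalClosed.curry_injective h
  rwa [cancel_epi, cancel_epi] at this

lemma tq_surjective {W X Y a : V} (r : X ⊗ Y ⟶ (ihom W).obj a) :
    ∃ p : W ⟶ (ihom Y).obj ((ihom X).obj a), tq p = r := by
  refine ⟨MonoidalClosed.curry (MonoidalClosed.curry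
    ((α_ _ _ _).inv ≫ (β_ _ _).hom ≫ MonoidalClosed.uncurry r)), ?_⟩
  apply MonoidalClosed.uncurry_injective
  rw [tq, tr, MonoidalClosed.uncurry_curry, MonoidalClosed.uncurry_curry,
    MonoidalClosed.uncurry_curry, Iso.hom_inv_id_assoc, SymmetricCategory.symmetry_assoc]

lemma nat_iff' (φ : EnrichedFunctor V Kᵒᵖ V) (X : EnrichedFunctor V K V) (a : V) (i j : K) {W : V}
    (p : W ⟶ (ihom (φ.obj (op i))).obj ((ihom (X.obj i)).obj a))
    (q : W ⟶ (ihom (φ.obj (op j))).obj ((ihom (X.obj j)).obj a)) :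
    (β_ W (Hom⟪op j, op i⟫ : V)).hom ≫
        ecmp (Z := ((nerve X).obj a).obj (op i)) (φ.map (op j) (op i)) p =
      ecmp (Y := ((nerve X).obj a).obj (op j)) q (((nerve X).obj a).map (op j) (op i)) ↔
    X.obj i ◁ act φ (op j) (op i) ≫ tq p =
      (X.obj i ◁ (β_ (φ.obj (op j)) (Hom⟪i, j⟫ : V)).hom ≫ (α_ _ _ _).inv ≫
        act X i j ▷ φ.obj (op j)) ≫ tq q := by
  rw [nat_iff φ X a i j p q, whisker_tr, whisker_tr]
  constructor
  · intro h
    exact MonoidalClosed.uncurry_injective ((cancel_epi (β_ _ W).hom).1 h)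
  · intro h
    exact congrArg (fun t => (β_ _ W).hom ≫ MonoidalClosed.uncurry t) h

lemma tq_curry {X Y a : V} (f : X ⊗ Y ⟶ a) :
    tq (MonoidalClosed.curry' (MonoidalClosed.curry f)) =
      f ≫ MonoidalClosed.curry (λ_ a).hom := by
  rw [tq, tr, MonoidalClosed.curry', MonoidalClosed.uncurry_curry,
    MonoidalClosed.uncurry_natural_left, MonoidalClosed.uncurry_curry,
    ← MonoidalClosed.curry_natural_left]
  congr 1
  simp

/-- The transpose `X c ⊗ φ c ⟶ H` of a component of `φ ⟶ [X -, H]`. -/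
noncomputable def coproj {φ : EnrichedFunctor V Kᵒᵖ V} {X : EnrichedFunctor V K V} {H : V}
    (μ : VNat φ ((nerve X).obj H)) (c : K) : X.obj c ⊗ φ.obj (op c) ⟶ H :=
  MonoidalClosed.uncurry (MonoidalClosed.uncurry' (μ.ap (op c)))

lemma uncurry_preC {Y Z T A : V} (f : 𝟙_ V ⟶ Hom⟪Y, Z⟫) (g : A ⟶ Hom⟪Z, T⟫) :
    MonoidalClosed.uncurry (preC f g) =
      MonoidalClosed.uncurry' f ▷ A ≫ MonoidalClosed.uncurry g := by
  rw [preC]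
  refine (MonoidalClosed.uncurry_natural_left _ _).trans ?_
  refine (congrArg (fun t => _ ≫ t) (uncurry_ecmp _ _)).trans ?_
  simp [MonoidalClosed.uncurry']

lemma tq_comparison {φ : EnrichedFunctor V Kᵒᵖ V} {X : EnrichedFunctor V K V} {H : V}
    (μ : VNat φ ((nerve X).obj H)) {a A : V} (f : A ⟶ (Hom⟪H, a⟫ : V)) (c : K) :
    tq (X := X.obj c) (Y := φ.obj (op c)) (a := a)
      ((f ≫ colimitComparison φ X μ a) ≫ natπ _ _ (op c)) =
      coproj μ c ≫ MonoidalClosed.curry ((β_ _ _).hom ≫ MonoidalClosed.uncurry f) := by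
  have h1 : (f ≫ colimitComparison φ X μ a) ≫ natπ _ _ (op c) =
      preC (μ.ap (op c)) (f ≫ (homFunctor V (X.obj c)).map H a) := by
    rw [colimitComparison, comp_preC]
    refine (preC_π _ _ _).trans ?_
    rw [natLift_π, Category.assoc]
    congr 2
    exact natLift_π _ _
  have h2 : tr (X := X.obj c) (Y := φ.obj (op c)) (a := a)
      ((f ≫ colimitComparison φ X μ a) ≫ natπ _ _ (op c)) =
      (α_ _ _ _).inv ≫ coproj μ c ▷ A ≫ MonoidalClosed.uncurry f := by
    rw [tr]
    refine (congrArg (fun t => MonoidalClosed.uncurry (MonoidalClosed.uncurry t)) h1).trans ?_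
    refine (congrArg MonoidalClosed.uncurry (uncurry_preC _ _)).trans ?_
    have h3 : MonoidalClosed.uncurry (f ≫ (homFunctor V (X.obj c)).map H a) =
        _ ◁ f ≫ eComp V (X.obj c) H a := by
      refine (MonoidalClosed.uncurry_natural_left _ _).trans ?_
      congr 1
      exact MonoidalClosed.uncurry_curry _
    refine (congrArg (fun t => MonoidalClosed.uncurry (_ ≫ t)) h3).trans ?_
    refine Eq.trans ?_ (uncurry_ecmp (MonoidalClosed.uncurry' (μ.ap (op c))) f)
    congr 1
    rw [ecmp, MonoidalCategory.tensorHom_def, Category.assoc]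
    rfl
  rw [tq]
  refine (congrArg (fun t => MonoidalClosed.curry (_ ≫ _ ≫ t)) h2).trans ?_
  rw [← MonoidalClosed.curry_natural_left]
  simp

lemma preC_op {X Y Z : K} {A : V} (f : A ⟶ Hom⟪X, Y⟫) (g : 𝟙_ V ⟶ Hom⟪Y, Z⟫) :
    preC (C := Kᵒᵖ) (X := op Z) (Y := op Y) (Z := op X) g f = postC f g := by
  rw [preC, postC]
  refine (congrArg (fun t => _ ≫ t) (ecmp_op f g)).trans ?_
  simp only [← Category.assoc]
  congr 2
  simp

/-- Weighted colimits exist in `V`. -/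
theorem exists_weightedColimit [HasColimits V] (φ : EnrichedFunctor V Kᵒᵖ V)
    (X : EnrichedFunctor V K V) :
    ∃ (H : V) (μ : VNat φ ((nerve X).obj H)), IsWeightedColimit φ X μ := by
  obtain ⟨σ, s, hs⟩ := VSmall.exists_reps V K
  have hs' : ∀ c : Kᵒᵖ, ∃ (i : σ) (f : 𝟙_ V ⟶ Hom⟪c, op (s i)⟫)
      (g : 𝟙_ V ⟶ Hom⟪op (s i), c⟫), preC f g = eId V c ∧ preC g f = eId V (op (s i)) := by
    intro c
    obtain ⟨i, f, g, h1, h2⟩ := hs c.unop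
    exact ⟨i, g, f, (preC_op f g).trans ((preC_eq_postC f g).symm.trans h1),
      (preC_op g f).trans ((preC_eq_postC g f).symm.trans h2)⟩
  obtain ⟨H, ι, hι, huniv⟩ := exists_multicoequalizer
    (fun i : σ => X.obj (s i) ⊗ φ.obj (op (s i)))
    (fun i j => X.obj (s i) ⊗ (φ.obj (op (s j)) ⊗ (Hom⟪s i, s j⟫ : V)))
    (fun i j => X.obj (s i) ◁ act φ (op (s j)) (op (s i)))
    (fun i j => X.obj (s i) ◁ (β_ (φ.obj (op (s j))) (Hom⟪s i, s j⟫ : V)).hom ≫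
      (α_ _ _ _).inv ≫ act X (s i) (s j) ▷ φ.obj (op (s j)))
  obtain ⟨μ, hμ⟩ := GNat.exists_of_reps (F := φ) (G := (nerve X).obj H) (A := 𝟙_ V)
    (fun i => op (s i)) hs' (fun i => MonoidalClosed.curry' (MonoidalClosed.curry (ι i))) (by
      intro j i
      refine (nat_iff' φ X H (s i) (s j) _ _).2 ?_
      refine (congrArg (fun t => _ ≫ t) (tq_curry (ι i))).trans
        (Eq.trans ?_ (congrArg (fun t => _ ≫ t) (tq_curry (ι j))).symm)
      rw [← Category.assoc, hι, Category.assoc])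
  have hco : ∀ i, coproj μ (s i) = ι i := by
    intro i
    rw [coproj, hμ]
    refine (congrArg MonoidalClosed.uncurry (MonoidalClosed.uncurry'_curry' _)).trans ?_
    exact MonoidalClosed.uncurry_curry _
  refine ⟨H, μ, fun a => ?_⟩
  apply isIso_of_yoneda_map_bijective
  intro A
  constructor
  · intro f f' hff
    have h1 : ∀ i, ι i ≫ MonoidalClosed.curry ((β_ _ _).hom ≫ MonoidalClosed.uncurry f) =
        ι i ≫ MonoidalClosed.curry ((β_ _ _).hom ≫ MonoidalClosed.uncurry f') := by
      intro i
      rw [← hco, ← tq_comparison, ← tq_comparison]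
      exact congrArg (fun t => tq (X := X.obj (s i)) (Y := φ.obj (op (s i))) (a := a)
        (t ≫ natπ _ _ (op (s i)))) hff
    have h2 := MonoidalClosed.curry_injective ((huniv _ _ (fun i j => by
      rw [← Category.assoc, hι, Category.assoc])).unique h1 (fun _ => rfl))
    exact MonoidalClosed.uncurry_injective ((cancel_epi (β_ _ _).hom).1 h2)
  · intro g
    obtain ⟨r, hr, -⟩ := huniv _ (fun i => tq (X := X.obj (s i)) (Y := φ.obj (op (s i))) (a := a)
      (g ≫ natπ _ _ (op (s i)))) (fun i j => (nat_iff' φ X a (s i) (s j) _ _).1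
        (((natFam _ _).reindex g).nat (op (s j)) (op (s i))))
    have hf : MonoidalClosed.curry ((β_ _ _).hom ≫ MonoidalClosed.uncurry
        (MonoidalClosed.curry ((β_ _ _).hom ≫ MonoidalClosed.uncurry r))) = r := by
      apply MonoidalClosed.uncurry_injective
      rw [MonoidalClosed.uncurry_curry, MonoidalClosed.uncurry_curry,
        SymmetricCategory.symmetry_assoc]
    refine ⟨MonoidalClosed.curry ((β_ _ _).hom ≫ MonoidalClosed.uncurry r), ?_⟩
    have key : (natFam φ ((nerve X).obj a)).reindex (MonoidalClosed.curry ((β_ _ _).hom ≫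
        MonoidalClosed.uncurry r) ≫ colimitComparison φ X μ a) = (natFam _ _).reindex g := by
      apply GNat.ext_of_reps _ hs'
      intro i
      refine tq_injective (X := X.obj (s i)) (Y := φ.obj (op (s i))) (a := a) ?_
      refine (tq_comparison μ _ (s i)).trans ?_
      rw [hf, hco]
      exact hr i
    apply functorHom_ext
    intro c
    exact congrArg (fun t => GNat.ap t c) key

/-- The family of opposites of the components. -/
def GNat.op {C : Type w₁} [EnrichedCategory V C] {D : Type w₂} [EnrichedCategory V D]
    {F G : EnrichedFunctor V C D} {A : V} (p : GNat A F G) :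
    GNat A (opFunctor G) (opFunctor F) :=
  GNat.mk' (fun X => p.ap X.unop) (fun X Y => by
    have h1 := ecmp_op (C := D) (p.ap Y.unop) (G.map Y.unop X.unop)
    have h2 := ecmp_op (C := D) (F.map Y.unop X.unop) (p.ap X.unop)
    have h3 := p.nat Y.unop X.unop
    refine (congrArg (fun t => _ ≫ t) h1).trans (Eq.trans ?_ h2.symm)
    refine (SymmetricCategory.symmetry_assoc _ _ _).trans ?_
    rw [← h3])

/-- The covariant action `V(a, b) ⟶ [[X z, a], [X z, b]]`. -/
noncomputable def ncov (X : EnrichedFunctor V K V) (z : Kᵒᵖ) (a b : V) :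
    (Hom⟪a, b⟫ : V) ⟶ Hom⟪((nerve X).obj a).obj z, ((nerve X).obj b).obj z⟫ :=
  (nerve X).map a b ≫ natπ _ _ z

/-- The contravariant action `[K, V](X, Y) ⟶ [[Y z, a], [X z, a]]`. -/
noncomputable def ncon (X Y : EnrichedFunctor V K V) (a : V) :
    GNat (Hom⟪X, Y⟫ : V) ((nerve Y).obj a) ((nerve X).obj a) :=
  (natFam X Y).op.post (homFunctor V (op a))

lemma comp_ncon (X Y : EnrichedFunctor V K V) (a : V) (z : Kᵒᵖ) {A : V}
    (f : A ⟶ (Hom⟪X, Y⟫ : V)) : f ≫ (ncon X Y a).ap z =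
    (f ≫ natπ X Y z.unop) ≫
      (homFunctor V (op a)).map (op (Y.obj z.unop)) (op (X.obj z.unop)) :=
  (Category.assoc f (natπ X Y z.unop) _).symm

lemma ncov_id (X : EnrichedFunctor V K V) (z : Kᵒᵖ) (a : V) :
    eId V a ≫ ncov X z a a = eId V (((nerve X).obj a).obj z) := by
  rw [ncov, ← Category.assoc, (nerve X).map_id, eId_π]

lemma ecmp_ncov (X : EnrichedFunctor V K V) (z : Kᵒᵖ) {a b c : V} {A B : V}
    (f : A ⟶ (Hom⟪a, b⟫ : V)) (g : B ⟶ (Hom⟪b, c⟫ : V)) :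
    ecmp f g ≫ ncov X z a c = ecmp (f ≫ ncov X z a b) (g ≫ ncov X z b c) := by
  rw [ncov, ← Category.assoc, ecmp_map, ecmp_π, ncov, ncov, Category.assoc, Category.assoc]

lemma ncon_id (X : EnrichedFunctor V K V) (z : Kᵒᵖ) (a : V) :
    eId V X ≫ (ncon X X a).ap z = eId V (((nerve X).obj a).obj z) := by
  refine (comp_ncon X X a z _).trans ?_
  refine (congrArg (fun t => t ≫ _) (eId_π X z.unop)).trans ?_
  exact (homFunctor V (op a)).map_id (op (X.obj z.unop))

lemma ecmp_ncon {X Y Z : EnrichedFunctor V K V} (z : Kᵒᵖ) (a : V) {A B : V}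
    (f : A ⟶ (Hom⟪X, Y⟫ : V)) (g : B ⟶ (Hom⟪Y, Z⟫ : V)) :
    (β_ B A).hom ≫ ecmp f g ≫ (ncon X Z a).ap z =
      ecmp (g ≫ (ncon Y Z a).ap z) (f ≫ (ncon X Y a).ap z) := by
  refine (congrArg (fun t => (β_ B A).hom ≫ t) (comp_ncon X Z a z _)).trans ?_
  refine (congrArg (fun t => _ ≫ t ≫ _) (ecmp_π f g z.unop)).trans ?_
  have h := ecmp_op (f ≫ natπ X Y z.unop) (g ≫ natπ Y Z z.unop)
  have h2 := ecmp_map (homFunctor V (op a)) (X := op (Z.obj z.unop)) (Y := op (Y.obj z.unop))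
    (Z := op (X.obj z.unop)) (g ≫ natπ Y Z z.unop) (f ≫ natπ X Y z.unop)
  rw [h, Category.assoc] at h2
  refine h2.trans ?_
  rw [Category.assoc, Category.assoc]
  rfl

lemma ncon_ncov {X Y : EnrichedFunctor V K V} (z : Kᵒᵖ) {a b : V} {A B : V}
    (f : A ⟶ (Hom⟪X, Y⟫ : V)) (g : B ⟶ (Hom⟪a, b⟫ : V)) :
    ecmp (f ≫ (ncon X Y a).ap z) (g ≫ ncov X z a b) =
      (β_ A B).hom ≫ ecmp (g ≫ ncov Y z a b) (f ≫ (ncon X Y b).ap z) := by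
  have h := ((coyFam (Y.obj z.unop) (X.obj z.unop)).reindex (f ≫ natπ X Y z.unop)).nat_elt g
  have e : ∀ W : EnrichedFunctor V K V, ncov W z a b = (homFunctor V (W.obj z.unop)).map a b :=
    fun W => natLift_π _ _
  rw [e, e]
  refine Eq.trans ?_ (h.symm.trans ?_)
  · rw [GNat.reindex_ap, Category.assoc]
    rfl
  · rw [GNat.reindex_ap, Category.assoc]
    rfl

section

variable [HasColimits V]

/-- The weighted colimit `φ * X` of `X : K ⟶ V`. -/
noncomputable def wcolim (φ : EnrichedFunctor V Kᵒᵖ V) (X : EnrichedFunctor V K V) : V :=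
  (exists_weightedColimit φ X).choose

/-- The unit `φ ⟶ [X -, φ * X]` of the weighted colimit. -/
noncomputable def wcolimUnit (φ : EnrichedFunctor V Kᵒᵖ V) (X : EnrichedFunctor V K V) :
    VNat φ ((nerve X).obj (wcolim φ X)) :=
  (exists_weightedColimit φ X).choose_spec.choose

theorem wcolim_isWeightedColimit (φ : EnrichedFunctor V Kᵒᵖ V) (X : EnrichedFunctor V K V) :
    IsWeightedColimit φ X (wcolimUnit φ X) :=
  (exists_weightedColimit φ X).choose_spec.choose_spec

/-- The morphism `A ⟶ [φ * X, a]` corresponding to a family `φ c ⊗ A ⟶ [X c, a]`. -/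
noncomputable def wcolimLift {φ : EnrichedFunctor V Kᵒᵖ V} {X : EnrichedFunctor V K V} {A a : V}
    (p : GNat A φ ((nerve X).obj a)) : A ⟶ (Hom⟪wcolim φ X, a⟫ : V) :=
  have := wcolim_isWeightedColimit φ X a
  natLift p ≫ inv (colimitComparison φ X (wcolimUnit φ X) a)

lemma comparison_π {φ : EnrichedFunctor V Kᵒᵖ V} {X : EnrichedFunctor V K V} {H a A : V}
    (μ : VNat φ ((nerve X).obj H)) (f : A ⟶ (Hom⟪H, a⟫ : V)) (z : Kᵒᵖ) :
    (f ≫ colimitComparison φ X μ a) ≫ natπ _ _ z =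
      preC (μ.ap z) (f ≫ ncov X z H a) := by
  rw [colimitComparison, comp_preC]
  refine (preC_π _ _ _).trans ?_
  rw [natLift_π, Category.assoc]
  rfl

lemma wcolimLift_spec {φ : EnrichedFunctor V Kᵒᵖ V} {X : EnrichedFunctor V K V} {A a : V}
    (p : GNat A φ ((nerve X).obj a)) (z : Kᵒᵖ) :
    preC ((wcolimUnit φ X).ap z) (wcolimLift p ≫ ncov X z _ a) =
      p.ap z := by
  have := wcolim_isWeightedColimit φ X a
  rw [← comparison_π, wcolimLift, Category.assoc _ _ (colimitComparison _ _ _ _),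
    IsIso.inv_hom_id, Category.comp_id, natLift_π]

lemma wcolim_ext {φ : EnrichedFunctor V Kᵒᵖ V} {X : EnrichedFunctor V K V} {A a : V}
    {f g : A ⟶ (Hom⟪wcolim φ X, a⟫ : V)}
    (h : ∀ z : Kᵒᵖ, preC ((wcolimUnit φ X).ap z) (f ≫ ncov X z _ a) =
      preC ((wcolimUnit φ X).ap z) (g ≫ ncov X z _ a)) : f = g := by
  have := wcolim_isWeightedColimit φ X a
  rw [← cancel_mono (colimitComparison φ X (wcolimUnit φ X) a)]
  apply functorHom_ext
  intro z
  rw [comparison_π, comparison_π, h]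

/-- The action of the weighted colimit `φ * -` on hom-objects. -/
noncomputable def wcolimMap (φ : EnrichedFunctor V Kᵒᵖ V) (X Y : EnrichedFunctor V K V) :
    (Hom⟪X, Y⟫ : V) ⟶ Hom⟪wcolim φ X, wcolim φ Y⟫ :=
  wcolimLift (((wcolimUnit φ Y).compFam
    (ncon X Y (wcolim φ Y))).reindex (λ_ _).inv)

lemma wcolimMap_spec (φ : EnrichedFunctor V Kᵒᵖ V) (X Y : EnrichedFunctor V K V) (z : Kᵒᵖ) :
    preC ((wcolimUnit φ X).ap z) (wcolimMap φ X Y ≫ ncov X z _ _) =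
      preC ((wcolimUnit φ Y).ap z) ((ncon X Y (wcolim φ Y)).ap z) :=
  wcolimLift_spec _ z

/-- The `V`-functor `φ * - : [K, V] ⟶ V`, sending `X` to the weighted colimit `φ * X`. -/
noncomputable def wcolimFunctor (φ : EnrichedFunctor V Kᵒᵖ V) :
    EnrichedFunctor V (EnrichedFunctor V K V) V where
  obj X := wcolim φ X
  map X Y := wcolimMap φ X Y
  map_id X := by
    apply wcolim_ext
    intro z
    rw [Category.assoc, ← comp_preC, wcolimMap_spec, comp_preC, ncon_id, ncov_id]
  map_comp X Y Z := by
    apply wcolim_ext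
    intro z
    have h : ∀ {A : V} (f : A ⟶ (Hom⟪X, Z⟫ : V)),
        preC ((wcolimUnit φ X).ap z) ((f ≫ wcolimMap φ X Z) ≫ ncov X z _ _) =
          preC ((wcolimUnit φ Z).ap z) (f ≫ (ncon X Z (wcolim φ Z)).ap z) := by
      intro A f
      rw [Category.assoc, ← comp_preC, wcolimMap_spec, comp_preC]
    have h1 : eComp V X Y Z = ecmp (𝟙 (Hom⟪X, Y⟫ : V)) (𝟙 (Hom⟪Y, Z⟫ : V)) := by simp [ecmp]
    have h2 := ecmp_ncon z (wcolim φ Z) (𝟙 (Hom⟪X, Y⟫ : V)) (𝟙 (Hom⟪Y, Z⟫ : V))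
    have h3 := ncon_ncov z (𝟙 (Hom⟪X, Y⟫ : V)) (wcolimMap φ Y Z)
    rw [Category.id_comp] at h3
    have h4 : (wcolimMap φ X Y ⊗ₘ wcolimMap φ Y Z) ≫ eComp V _ _ _ =
      ecmp (wcolimMap φ X Y) (wcolimMap φ Y Z) := rfl
    rw [h, h4, ecmp_ncov, preC_ecmp, wcolimMap_spec, ← preC_ecmp, h3,
      ← comp_preC (β_ _ _).hom, preC_ecmp, wcolimMap_spec, ← preC_ecmp, comp_preC, h1]
    rw [Category.id_comp, Category.id_comp] at h2
    rw [Category.id_comp, ← h2, SymmetricCategory.symmetry_assoc]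
end

end Coend

section Equivalences

variable {V : Type u} [Category.{v} V] [MonoidalCategory V] [SymmetricCategory V]
variable {C : Type w} [EnrichedCategory V C] {D : Type w₁} [EnrichedCategory V D]

/-- A `V`-natural isomorphism. -/
structure VNatIso (F G : EnrichedFunctor V C D) where
  hom : VNat F G
  inv : VNat G F
  hom_inv_id : ∀ X, preC (hom.ap X) (inv.ap X) = eId V (F.obj X)
  inv_hom_id : ∀ X, preC (inv.ap X) (hom.ap X) = eId V (G.obj X)

/-- A `V`-adjunction `F ⊣ G`: isomorphisms `D(F X, Y) ≅ C(X, G Y)`, `V`-natural in `X` and `Y`. -/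
structure VAdjunction (F : EnrichedFunctor V C D) (G : EnrichedFunctor V D C) where
  homIso : ∀ (X : C) (Y : D), (Hom⟪F.obj X, Y⟫ : V) ≅ Hom⟪X, G.obj Y⟫
  naturality_left : ∀ (X' X : C) (Y : D),
    ecmp (F.map X' X) (𝟙 Hom⟪F.obj X, Y⟫) ≫ (homIso X' Y).hom =
      ecmp (𝟙 Hom⟪X', X⟫) (homIso X Y).hom
  naturality_right : ∀ (X : C) (Y Y' : D),
    eComp V (F.obj X) Y Y' ≫ (homIso X Y').hom = ecmp (homIso X Y).hom (G.map Y Y')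

/-- The component `X ⟶ G F X` of the unit. -/
def VAdjunction.unit {F : EnrichedFunctor V C D} {G : EnrichedFunctor V D C}
    (adj : VAdjunction F G) (X : C) : 𝟙_ V ⟶ Hom⟪X, G.obj (F.obj X)⟫ :=
  eId V (F.obj X) ≫ (adj.homIso X (F.obj X)).hom

/-- The component `F G Y ⟶ Y` of the counit. -/
def VAdjunction.counit {F : EnrichedFunctor V C D} {G : EnrichedFunctor V D C}
    (adj : VAdjunction F G) (Y : D) : 𝟙_ V ⟶ Hom⟪F.obj (G.obj Y), Y⟫ :=
  eId V (G.obj Y) ≫ (adj.homIso (G.obj Y) Y).inv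

/-- The data making `F` and `G` mutually inverse equivalences of `V`-categories. -/
structure VEquivalence (F : EnrichedFunctor V C D) (G : EnrichedFunctor V D C) where
  unitIso : VNatIso (EnrichedFunctor.id V C) (F.comp V G)
  counitIso : VNatIso (G.comp V F) (EnrichedFunctor.id V D)

/-- The objects of `C` with property `P`. -/
structure FullSub (P : C → Prop) where
  obj : C
  property : P obj

/-- The full sub-`V`-category on the objects with property `P`. -/
instance fullSub (P : C → Prop) : EnrichedCategory V (FullSub P) where
  Hom X Y := Hom⟪X.obj, Y.obj⟫
  id X := eId V X.obj
  comp X Y Z := eComp V X.obj Y.obj Z.obj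
  id_comp X Y := e_id_comp V X.obj Y.obj
  comp_id X Y := e_comp_id V X.obj Y.obj
  assoc W X Y Z := e_assoc V W.obj X.obj Y.obj Z.obj

/-- The restriction `P ⟶ Qᵒᵖ` of a `V`-functor `C ⟶ Dᵒᵖ` to full subcategories. -/
def restrictRight {P : C → Prop} {Q : D → Prop} (F : EnrichedFunctor V C Dᵒᵖ)
    (h : ∀ X, P X → Q (F.obj X).unop) : EnrichedFunctor V (FullSub P) (FullSub Q)ᵒᵖ where
  obj X := op ⟨(F.obj X.obj).unop, h _ X.property⟩
  map X Y := F.map X.obj Y.obj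
  map_id X := F.map_id X.obj
  map_comp X Y Z := F.map_comp X.obj Y.obj Z.obj

/-- The restriction `Qᵒᵖ ⟶ P` of a `V`-functor `Dᵒᵖ ⟶ C` to full subcategories. -/
def restrictLeft {P : C → Prop} {Q : D → Prop} (F : EnrichedFunctor V Dᵒᵖ C)
    (h : ∀ Y, Q Y → P (F.obj (op Y))) : EnrichedFunctor V (FullSub Q)ᵒᵖ (FullSub P) where
  obj Y := ⟨F.obj (op Y.unop.obj), h _ Y.unop.property⟩
  map X Y := F.map (op X.unop.obj) (op Y.unop.obj)
  map_id X := F.map_id (op X.unop.obj)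
  map_comp X Y Z := F.map_comp (op X.unop.obj) (op Y.unop.obj) (op Z.unop.obj)

end Equivalences

section IsbellAdjunction

variable (V : Type u) [Category.{v} V] [MonoidalCategory V] [SymmetricCategory V]
  [MonoidalClosed V] [HasLimits V]
variable (B : Type w) [EnrichedCategory V B] [VSmall V B]

/-- The functor `L : [Bᵒᵖ, V] ⟶ [B, V]ᵒᵖ`, `L φ = [Bᵒᵖ, V](φ, Y -)`. -/
noncomputable def isbellL :
    EnrichedFunctor V (EnrichedFunctor V Bᵒᵖ V) (EnrichedFunctor V B V)ᵒᵖ :=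
  rightOp (conerve (yonedaEmb V B))

/-- The functor `R : [B, V]ᵒᵖ ⟶ [Bᵒᵖ, V]`, `R ψ = [B, V](ψ, Y' -)`. -/
noncomputable def isbellR :
    EnrichedFunctor V (EnrichedFunctor V B V)ᵒᵖ (EnrichedFunctor V Bᵒᵖ V) :=
  conerve (coyonedaEmb V B)

variable {V B}

/-- An adjunction `φ ⊣ ψ` between the module `φ : I ⇸ B` given by `φ : Bᵒᵖ ⟶ V` and the module
`ψ : B ⇸ I` given by `ψ : B ⟶ V`, in the bicategory of `V`-modules.  The composite `ψ ∘ φ` is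
`∫^b ψ b ⊗ φ b`, that is, the weighted colimit `φ * ψ`, with coprojections
`coproj (wcolimUnit φ ψ) b`; the composite `φ ∘ ψ` is `(b, c) ↦ φ b ⊗ ψ c`; the identity module of
`B` is `(b, c) ↦ B(b, c)`.  In the triangle identities, `t` is the morphism, determined by its
composites with the coprojections, given by the counit followed by the action. -/
structure ModuleAdjunction [HasColimits V] (φ : EnrichedFunctor V Bᵒᵖ V)
    (ψ : EnrichedFunctor V B V) where
  unit : 𝟙_ V ⟶ wcolim φ ψ
  counit : ∀ b c : B, φ.obj (op b) ⊗ ψ.obj c ⟶ Hom⟪b, c⟫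
  counit_naturality_right : ∀ b c c' : B,
    φ.obj (op b) ◁ act ψ c c' ≫ counit b c' =
      (α_ _ _ _).inv ≫ counit b c ▷ Hom⟪c, c'⟫ ≫ eComp V b c c'
  counit_naturality_left : ∀ b b' c : B,
    act φ (op b) (op b') ▷ ψ.obj c ≫ counit b' c =
      (β_ (φ.obj (op b)) (Hom⟪b', b⟫ : V)).hom ▷ ψ.obj c ≫ (α_ _ _ _).hom ≫
        (Hom⟪b', b⟫ : V) ◁ counit b c ≫ eComp V b' b c
  triangle_left : ∀ b : B, ∃ t : φ.obj (op b) ⊗ wcolim φ ψ ⟶ φ.obj (op b),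
    (∀ c : B, φ.obj (op b) ◁ coproj (wcolimUnit φ ψ) c ≫ t =
      (α_ _ _ _).inv ≫ counit b c ▷ φ.obj (op c) ≫ (β_ (Hom⟪b, c⟫ : V) _).hom ≫
        act φ (op c) (op b)) ∧
    (ρ_ _).inv ≫ φ.obj (op b) ◁ unit ≫ t = 𝟙 (φ.obj (op b))
  triangle_right : ∀ c : B, ∃ t : wcolim φ ψ ⊗ ψ.obj c ⟶ ψ.obj c,
    (∀ b : B, coproj (wcolimUnit φ ψ) b ▷ ψ.obj c ≫ t =
      (α_ _ _ _).hom ≫ ψ.obj b ◁ counit b c ≫ act ψ b c) ∧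
    (λ_ _).inv ≫ unit ▷ ψ.obj c ≫ t = 𝟙 (ψ.obj c)

end IsbellAdjunction

end Isbell

open Isbell

/-! Everything about small projectives passes through one condition on a natural pairing `φ b ⊗ ψ c
⟶ C(b, c)`. The pairing transposes to `θ b : φ b ⟶ [C, V](ψ, C(b, -))`, and letting `C` act on `X :
C ⟶ V` it gives a cowedge `X c ⊗ φ c ⟶ [C, V](ψ, X)`. The condition `Pairing.HomIsCoend` says that
this cowedge is a coend for every `X`, that is, `[C, V](ψ, -)` is `φ * -` through the pairing.

This condition is equivalent to the pairing being the counit of an adjunction of modules. Given a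
unit `η`, a cowedge on `X` factors through `[ψ, X]` by inserting `η` and evaluating; one triangle
identity gives existence and the other uniqueness (`HomIsCoend.of_isCounit`). Conversely the
identity of `ψ`, read in `[ψ, ψ] ≅ ∫^c ψ c ⊗ φ c`, is the unit (`HomIsCoend.exists_isCounit`).

It also characterises small projectivity. If it holds, `[ψ, -]` has right adjoint `v ↦ [φ -, v]`, so
it is cocontinuous and `ψ` is a small projective (`HomIsCoend.isSmallProjective`). Conversely every
`X` is the colimit of representables weighted by `[C(-, -), X]`; a small projective `ψ` preserves
it, and if every `θ b` is invertible the preserved colimit is the required coend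
(`Pairing.homIsCoend_of_isSmallProjective`). For the evaluation pairing of `ψ` with `R ψ`, `θ` is
the identity.

The condition treats `φ` and `ψ` asymmetrically, whereas the triangle identities over `C` for `φ`
and `ψ` are those over `Cᵒᵖ` for the exchanged pair. Passing through the adjunction, the condition
is stable under this exchange (`HomIsCoend.swap`), which transfers every statement about `ψ` to `φ`.

The Isbell adjunction itself needs no projectivity: `[C, V](ψ, L φ)` and `[Cᵒᵖ, V](φ, R ψ)` both
represent families `A ⊗ φ b ⊗ ψ c ⟶ C(b, c)` natural in `b` and `c`. Its unit at `φ` is `θ` of the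
evaluation pairing of `φ` with `L φ`, and its counit at `ψ` is `θ` of the exchanged evaluation
pairing of `ψ` with `R ψ`; both are invertible on small projectives.

Contravariant functors are made to act on the left (`lact`) and hom-objects to evaluate from the
left (`hev`), so that the diagrams of the central arguments are planar and close by monoidal
coherence. The symmetry is confined to the translation from curried data, to the passage between `C`
and `Cᵒᵖ`, and to the reordering of bilinear families. -/

set_option linter.unusedSectionVars false

namespace Isbell

/-! ### Left actions, cowedges, and weighted colimits in `V` as coends. -/

section Planar

variable {V : Type u} [Category.{v} V] [MonoidalCategory V] [SymmetricCategory V]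
  [MonoidalClosed V]
variable {C : Type w} [EnrichedCategory V C]

/-- The left action `C(i, j) ⊗ φ j ⟶ φ i` of a contravariant `V`-valued `V`-functor. -/
def lact (φ : EnrichedFunctor V Cᵒᵖ V) (i j : C) :
    (Hom⟪i, j⟫ : V) ⊗ φ.obj (op j) ⟶ φ.obj (op i) :=
  (β_ (Hom⟪i, j⟫ : V) (φ.obj (op j))).hom ≫ act φ (op j) (op i)

lemma act_id (F : EnrichedFunctor V C V) (X : C) :
    F.obj X ◁ eId V X ≫ act F X X = (ρ_ _).hom := by
  rw [act, ← MonoidalClosed.uncurry_natural_left, F.map_id]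
  exact MonoidalClosed.uncurry_curry _

lemma act_comp (F : EnrichedFunctor V C V) (X Y Z : C) :
    F.obj X ◁ eComp V X Y Z ≫ act F X Z =
      (α_ _ _ _).inv ≫ act F X Y ▷ _ ≫ act F Y Z := by
  rw [act, ← MonoidalClosed.uncurry_natural_left, F.map_comp]
  exact uncurry_ecmp _ _

lemma lact_id (φ : EnrichedFunctor V Cᵒᵖ V) (i : C) :
    eId V i ▷ φ.obj (op i) ≫ lact φ i i = (λ_ _).hom := by
  rw [lact, braiding_naturality_left_assoc]
  refine (congrArg (fun t => _ ≫ t) (act_id φ (op i))).trans ?_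
  simp

/-- The braiding in the composition of `Cᵒᵖ` cancels against those in the definition of `lact`, so
no symmetry is left. -/
lemma lact_comp (φ : EnrichedFunctor V Cᵒᵖ V) (i j k : C) :
    eComp V i j k ▷ φ.obj (op k) ≫ lact φ i k =
      (α_ _ _ _).hom ≫ _ ◁ lact φ j k ≫ lact φ i j := by
  have h := act_comp φ (op k) (op j) (op i)
  rw [eComp_op] at h
  have h' : φ.obj (op k) ◁ eComp V i j k ≫ act φ (op k) (op i) =
      φ.obj (op k) ◁ (β_ (Hom⟪i, j⟫ : V) (Hom⟪j, k⟫ : V)).hom ≫ (α_ _ _ _).inv ≫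
        act φ (op k) (op j) ▷ (Hom⟪i, j⟫ : V) ≫ act φ (op j) (op i) := by
    rw [← cancel_epi (φ.obj (op k) ◁ (β_ (Hom⟪j, k⟫ : V) (Hom⟪i, j⟫ : V)).hom)]
    rw [← MonoidalCategory.whiskerLeft_comp_assoc, ← MonoidalCategory.whiskerLeft_comp_assoc,
      SymmetricCategory.symmetry, MonoidalCategory.whiskerLeft_id, Category.id_comp]
    exact h
  rw [lact, braiding_naturality_left_assoc]
  refine (congrArg (fun t => _ ≫ t) h').trans ?_
  rw [lact, lact, MonoidalCategory.whiskerLeft_comp]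
  simp only [Category.assoc, braiding_naturality_right_assoc, braiding_tensor_left_hom,
    braiding_tensor_right_hom]

/-- A dinatural family `X c ⊗ φ c ⟶ a`. -/
def IsCowedge (φ : EnrichedFunctor V Cᵒᵖ V) (X : EnrichedFunctor V C V) {a : V}
    (p : ∀ c, X.obj c ⊗ φ.obj (op c) ⟶ a) : Prop :=
  ∀ i j, act X i j ▷ φ.obj (op j) ≫ p j = (α_ _ _ _).hom ≫ X.obj i ◁ lact φ i j ≫ p i

lemma IsCowedge.comp {φ : EnrichedFunctor V Cᵒᵖ V} {X : EnrichedFunctor V C V} {a b : V}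
    {p : ∀ c, X.obj c ⊗ φ.obj (op c) ⟶ a} (h : IsCowedge φ X p) (f : a ⟶ b) :
    IsCowedge φ X (fun c => p c ≫ f) := by
  intro i j
  have := h i j =≫ f
  simpa using this

/-- The family `X c ⊗ φ c ⟶ H` exhibits `H` as the coend `∫^c X c ⊗ φ c`. -/
structure IsCoend (φ : EnrichedFunctor V Cᵒᵖ V) (X : EnrichedFunctor V C V) {H : V}
    (ι : ∀ c, X.obj c ⊗ φ.obj (op c) ⟶ H) : Prop where
  cowedge : IsCowedge φ X ι
  existsUnique_desc : ∀ {a : V} (p : ∀ c, X.obj c ⊗ φ.obj (op c) ⟶ a), IsCowedge φ X p →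
    ∃! f : H ⟶ a, ∀ c, ι c ≫ f = p c

namespace IsCoend

variable {φ : EnrichedFunctor V Cᵒᵖ V} {X : EnrichedFunctor V C V} {H : V}
  {ι : ∀ c, X.obj c ⊗ φ.obj (op c) ⟶ H}

lemma hom_ext (h : IsCoend φ X ι) {a : V} {f g : H ⟶ a} (w : ∀ c, ι c ≫ f = ι c ≫ g) : f = g :=
  (h.existsUnique_desc _ (h.cowedge.comp g)).unique w (fun _ => rfl)

/-- `W ⊗ -` is a left adjoint, so it preserves the coend: currying reduces to `hom_ext`. The lemmas
below do the same for other positions of the extra factors. -/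
lemma hom_ext_left (h : IsCoend φ X ι) {W a : V} {f g : W ⊗ H ⟶ a}
    (w : ∀ c, W ◁ ι c ≫ f = W ◁ ι c ≫ g) : f = g := by
  apply MonoidalClosed.curry_injective
  apply h.hom_ext
  intro c
  rw [← MonoidalClosed.curry_natural_left, w, MonoidalClosed.curry_natural_left]

lemma hom_ext_right (h : IsCoend φ X ι) {W a : V} {f g : H ⊗ W ⟶ a}
    (w : ∀ c, ι c ▷ W ≫ f = ι c ▷ W ≫ g) : f = g := by
  rw [← cancel_epi (β_ W H).hom]
  apply h.hom_ext_left
  intro c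
  rw [braiding_naturality_right_assoc, w, braiding_naturality_right_assoc]

lemma hom_ext_middle (h : IsCoend φ X ι) {U W a : V} {f g : (U ⊗ H) ⊗ W ⟶ a}
    (w : ∀ c, (U ◁ ι c) ▷ W ≫ f = (U ◁ ι c) ▷ W ≫ g) : f = g := by
  rw [← cancel_epi (α_ U H W).inv]
  apply MonoidalClosed.curry_injective
  apply h.hom_ext_right
  intro c
  rw [← MonoidalClosed.curry_natural_left, ← MonoidalClosed.curry_natural_left]
  have := (α_ _ _ _).inv ≫= w c
  simpa using congrArg MonoidalClosed.curry this

lemma exists_desc_left (h : IsCoend φ X ι) {W a : V}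
    (p : ∀ c, W ⊗ (X.obj c ⊗ φ.obj (op c)) ⟶ a)
    (hp : ∀ i j, W ◁ act X i j ▷ φ.obj (op j) ≫ p j =
      W ◁ (α_ _ _ _).hom ≫ W ◁ X.obj i ◁ lact φ i j ≫ p i) :
    ∃ f : W ⊗ H ⟶ a, ∀ c, W ◁ ι c ≫ f = p c := by
  obtain ⟨f, hf, -⟩ := h.existsUnique_desc (fun c => MonoidalClosed.curry (p c)) (by
    intro i j
    rw [← MonoidalClosed.curry_natural_left, hp, MonoidalClosed.curry_natural_left,
      MonoidalClosed.curry_natural_left])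
  refine ⟨MonoidalClosed.uncurry f, fun c => ?_⟩
  rw [← MonoidalClosed.uncurry_natural_left, hf, MonoidalClosed.uncurry_curry]

lemma exists_desc_right (h : IsCoend φ X ι) {W a : V}
    (p : ∀ c, (X.obj c ⊗ φ.obj (op c)) ⊗ W ⟶ a)
    (hp : ∀ i j, act X i j ▷ φ.obj (op j) ▷ W ≫ p j =
      (α_ _ _ _).hom ▷ W ≫ (X.obj i ◁ lact φ i j) ▷ W ≫ p i) :
    ∃ f : H ⊗ W ⟶ a, ∀ c, ι c ▷ W ≫ f = p c := by
  obtain ⟨f, hf⟩ := h.exists_desc_left (W := W) (fun c => (β_ _ _).hom ≫ p c) (by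
    intro i j
    rw [braiding_naturality_right_assoc, hp, braiding_naturality_right_assoc,
      braiding_naturality_right_assoc])
  refine ⟨(β_ _ _).hom ≫ f, fun c => ?_⟩
  rw [braiding_naturality_left_assoc, hf, SymmetricCategory.symmetry_assoc]

end IsCoend

section

variable [HasLimits V] [VSmall V C]

/-- Cancels the morphism `a ⟶ [I, a]` which `tq_curry` leaves behind on ungraded families. -/
lemma comp_curry_leftUnitor_injective {X a : V} {f g : X ⟶ a}
    (h : f ≫ MonoidalClosed.curry (λ_ a).hom = g ≫ MonoidalClosed.curry (λ_ a).hom) : f = g := by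
  rw [← MonoidalClosed.curry_natural_left, ← MonoidalClosed.curry_natural_left] at h
  have := MonoidalClosed.curry_injective h
  simpa using this

/-- The right-hand condition is the one produced by `nat_iff'`; the two differ by precomposition
with the isomorphism that moves `C(i, j)` past `φ j`. -/
lemma isCowedge_iff (φ : EnrichedFunctor V Cᵒᵖ V) (X : EnrichedFunctor V C V) {a : V}
    (p : ∀ c, X.obj c ⊗ φ.obj (op c) ⟶ a) :
    IsCowedge φ X p ↔ ∀ i j, X.obj i ◁ act φ (op j) (op i) ≫ p i =
      (X.obj i ◁ (β_ (φ.obj (op j)) (Hom⟪i, j⟫ : V)).hom ≫ (α_ _ _ _).inv ≫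
        act X i j ▷ φ.obj (op j)) ≫ p j := by
  refine forall_congr' fun i => forall_congr' fun j => ?_
  rw [Category.assoc, Category.assoc, ← cancel_epi (X.obj i ◁ (β_ (φ.obj (op j))
    (Hom⟪i, j⟫ : V)).hom ≫ (α_ _ _ _).inv), Category.assoc, Category.assoc, Iso.inv_hom_id_assoc,
    lact, MonoidalCategory.whiskerLeft_comp_assoc, ← MonoidalCategory.whiskerLeft_comp_assoc,
    SymmetricCategory.symmetry, MonoidalCategory.whiskerLeft_id, Category.id_comp]
  exact eq_comm

/-- The family `φ ⟶ [X -, a]` corresponding to a cowedge. -/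
noncomputable def IsCowedge.vnat {φ : EnrichedFunctor V Cᵒᵖ V} {X : EnrichedFunctor V C V} {a : V}
    {p : ∀ c, X.obj c ⊗ φ.obj (op c) ⟶ a} (h : IsCowedge φ X p) : VNat φ ((nerve X).obj a) :=
  GNat.mk' (fun c => MonoidalClosed.curry' (MonoidalClosed.curry (p c.unop))) (by
    intro j i
    refine (nat_iff' φ X a i.unop j.unop _ _).2 ?_
    refine (congrArg (fun t => _ ≫ t) (tq_curry (p i.unop))).trans
      (Eq.trans ?_ (congrArg (fun t => _ ≫ t) (tq_curry (p j.unop))).symm)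
    have := (isCowedge_iff φ X p).1 h i.unop j.unop =≫ MonoidalClosed.curry (λ_ a).hom
    rw [← Category.assoc, ← Category.assoc]
    exact this)

lemma tq_vnat {φ : EnrichedFunctor V Cᵒᵖ V} {X : EnrichedFunctor V C V} {a : V}
    {p : ∀ c, X.obj c ⊗ φ.obj (op c) ⟶ a} (h : IsCowedge φ X p) (c : C) :
    tq (X := X.obj c) (Y := φ.obj (op c)) (a := a) (h.vnat.ap (op c)) =
      p c ≫ MonoidalClosed.curry (λ_ a).hom := tq_curry (p c)

lemma curry_braiding_uncurry' {H a : V} (f : H ⟶ a) :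
    MonoidalClosed.curry ((β_ (𝟙_ V) H).hom ≫ MonoidalClosed.uncurry (MonoidalClosed.curry' f)) =
      f ≫ MonoidalClosed.curry (λ_ a).hom := by
  rw [uncurry_curry', ← MonoidalClosed.curry_natural_left]
  simp

lemma curry'_curry_uncurry_uncurry' {X Y a : V}
    (m : 𝟙_ V ⟶ (ihom Y).obj ((ihom X).obj a)) :
    MonoidalClosed.curry' (MonoidalClosed.curry
      (MonoidalClosed.uncurry (MonoidalClosed.uncurry' m))) = m := by
  rw [MonoidalClosed.curry_uncurry, MonoidalClosed.curry'_uncurry']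

lemma isCowedge_coproj {φ : EnrichedFunctor V Cᵒᵖ V} {X : EnrichedFunctor V C V} {H : V}
    (μ : VNat φ ((nerve X).obj H)) : IsCowedge φ X (coproj μ) := by
  rw [isCowedge_iff]
  intro i j
  apply comp_curry_leftUnitor_injective
  have h : ∀ c, coproj μ c ≫ MonoidalClosed.curry (λ_ H).hom =
      tq (X := X.obj c) (Y := φ.obj (op c)) (a := H) (μ.ap (op c)) := by
    intro c
    rw [← tq_curry]
    congr 1
    exact curry'_curry_uncurry_uncurry' (Y := φ.obj (op c)) (X := X.obj c) (a := H) _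
  rw [Category.assoc, Category.assoc, h, h]
  exact (nat_iff' φ X H i j (μ.ap (op i)) (μ.ap (op j))).1 (μ.nat (op j) (op i))

/-- A weighted colimit in `V` is a coend. -/
theorem IsWeightedColimit.isCoend {φ : EnrichedFunctor V Cᵒᵖ V} {X : EnrichedFunctor V C V} {H : V}
    {μ : VNat φ ((nerve X).obj H)} (hμ : IsWeightedColimit φ X μ) : IsCoend φ X (coproj μ) where
  cowedge := isCowedge_coproj μ
  existsUnique_desc {a} p hp := by
    have := hμ a
    -- The comparison morphism sends the global element of `[H, a]` named by `f` to the family with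
    -- components `coproj μ c ≫ f`. Its invertibility, tested on global elements, is therefore
    -- existence and uniqueness of the factorization.
    have key : ∀ f : H ⟶ a, (∀ c, coproj μ c ≫ f = p c) ↔
        MonoidalClosed.curry' f ≫ colimitComparison φ X μ a = natLift hp.vnat := by
      intro f
      have e : ∀ c : C, (coproj μ c ≫ f = p c ↔
          (MonoidalClosed.curry' f ≫ colimitComparison φ X μ a) ≫ natπ _ _ (op c) =
            natLift hp.vnat ≫ natπ _ _ (op c)) := by
        intro c
        have e1 := tq_comparison μ (MonoidalClosed.curry' f) c
        rw [curry_braiding_uncurry'] at e1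
        rw [natLift_π]
        constructor
        · intro h
          apply tq_injective (X := X.obj c) (Y := φ.obj (op c)) (a := a)
          refine e1.trans ?_
          rw [tq_vnat, ← h, Category.assoc]
        · intro h
          apply comp_curry_leftUnitor_injective
          rw [Category.assoc, ← e1, ← tq_vnat hp]
          exact congrArg (fun t => tq (X := X.obj c) (Y := φ.obj (op c)) (a := a) t) h
      constructor
      · intro h
        apply functorHom_ext
        intro c
        exact (e c.unop).1 (h c.unop)
      · intro h c
        exact (e c).2 (congrArg (fun t => t ≫ natπ _ _ (op c)) h)
    refine ⟨MonoidalClosed.uncurry' (natLift hp.vnat ≫ inv (colimitComparison φ X μ a)), ?_, ?_⟩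
    · refine (key _).2 ?_
      rw [MonoidalClosed.curry'_uncurry', Category.assoc, IsIso.inv_hom_id, Category.comp_id]
    · intro f hf
      have := (key f).1 hf
      rw [← this, Category.assoc, IsIso.hom_inv_id, Category.comp_id,
        MonoidalClosed.uncurry'_curry']

end

end Planar
end Isbell

namespace Isbell

/-! ### Evaluation from the left, and pairings of `φ` with `ψ`. -/

section Planar

variable {V : Type u} [Category.{v} V] [MonoidalCategory V] [SymmetricCategory V]
  [MonoidalClosed V]
variable {C : Type w} [EnrichedCategory V C]

/-- Uncurrying both sides of the hexagon and moving `A` to the far left alters them by the same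
isomorphism. In the resulting form the grading object never crosses a hom-object. -/
lemma nat_iff_braided {A : V} {F G : EnrichedFunctor V C V} (x y : C)
    (q : ∀ x, A ⟶ (ihom (F.obj x)).obj (G.obj x)) :
    (β_ A Hom⟪x, y⟫).hom ≫ ecmp (Z := G.obj y) (F.map x y) (q y) =
        ecmp (X := F.obj x) (q x) (G.map x y) ↔
      A ◁ act F x y ≫ (β_ _ _).hom ≫ MonoidalClosed.uncurry (q y) =
        (α_ _ _ _).inv ≫ ((β_ _ _).hom ≫ MonoidalClosed.uncurry (q x)) ▷ Hom⟪x, y⟫ ≫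
          act G x y := by
  have h1 : MonoidalClosed.uncurry ((β_ A Hom⟪x, y⟫).hom ≫
      ecmp (Z := G.obj y) (F.map x y) (q y)) =
      F.obj x ◁ (β_ A Hom⟪x, y⟫).hom ≫ (α_ _ _ _).inv ≫ act F x y ▷ A ≫
        MonoidalClosed.uncurry (q y) := by
    refine (MonoidalClosed.uncurry_natural_left _ _).trans ?_
    exact congrArg (fun t => _ ≫ t) (uncurry_ecmp _ _)
  have h2 : MonoidalClosed.uncurry (ecmp (X := F.obj x) (q x) (G.map x y)) =
      (α_ _ _ _).inv ≫ MonoidalClosed.uncurry (q x) ▷ Hom⟪x, y⟫ ≫ act G x y := uncurry_ecmp _ _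
  have h3 : A ◁ act F x y ≫ (β_ _ _).hom ≫ MonoidalClosed.uncurry (q y) =
      ((α_ _ _ _).inv ≫ (β_ A (F.obj x)).hom ▷ Hom⟪x, y⟫ ≫ (α_ _ _ _).hom) ≫
      F.obj x ◁ (β_ A Hom⟪x, y⟫).hom ≫ (α_ _ _ _).inv ≫ act F x y ▷ A ≫
        MonoidalClosed.uncurry (q y) := by
    rw [braiding_naturality_right_assoc, braiding_tensor_right_hom]
    simp only [Category.assoc]
  have h4 : (α_ _ _ _).inv ≫ ((β_ _ _).hom ≫ MonoidalClosed.uncurry (q x)) ▷ Hom⟪x, y⟫ ≫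
          act G x y = ((α_ _ _ _).inv ≫ (β_ A (F.obj x)).hom ▷ Hom⟪x, y⟫ ≫ (α_ _ _ _).hom) ≫
      (α_ _ _ _).inv ≫ MonoidalClosed.uncurry (q x) ▷ Hom⟪x, y⟫ ≫ act G x y := by
    simp
  rw [h3, h4, cancel_epi, ← h1, ← h2]
  exact ⟨fun h => congrArg _ h, fun h => MonoidalClosed.uncurry_injective h⟩

/-- Turns an associativity law for right actions into one for left actions; the remaining
permutation identity is Yang–Baxter. -/
lemma braided_comp_aux {X Y Z P Q R : V} {p : X ⊗ P ⟶ Y} {q : Y ⊗ Q ⟶ Z} {e : P ⊗ Q ⟶ R}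
    {r : X ⊗ R ⟶ Z} (h : X ◁ e ≫ r = (α_ _ _ _).inv ≫ p ▷ Q ≫ q) :
    ((β_ Q P).hom ≫ e) ▷ X ≫ (β_ _ _).hom ≫ r =
      (α_ _ _ _).hom ≫ Q ◁ ((β_ _ _).hom ≫ p) ≫ (β_ _ _).hom ≫ q := by
  rw [comp_whiskerRight, Category.assoc, braiding_naturality_left_assoc, h,
    MonoidalCategory.whiskerLeft_comp, Category.assoc, braiding_naturality_right_assoc,
    braiding_tensor_right_hom, braiding_tensor_left_hom]
  have := (α_ _ _ _).hom ≫= yang_baxter Q P X =≫ ((α_ _ _ _).inv ≫ p ▷ Q ≫ q)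
  simpa using this

variable [HasLimits V] [VSmall V C]

/-- Evaluation `[C, V](F, G) ⊗ F x ⟶ G x`. -/
noncomputable def hev (F G : EnrichedFunctor V C V) (x : C) :
    (Hom⟪F, G⟫ : V) ⊗ F.obj x ⟶ G.obj x :=
  (β_ (Hom⟪F, G⟫ : V) (F.obj x)).hom ≫ MonoidalClosed.uncurry (natπ F G x)

lemma comp_hev {F G : EnrichedFunctor V C V} {A : V} (f : A ⟶ (Hom⟪F, G⟫ : V)) (x : C) :
    f ▷ F.obj x ≫ hev F G x =
      (β_ A (F.obj x)).hom ≫ MonoidalClosed.uncurry (A := F.obj x) (X := G.obj x)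
        (f ≫ natπ F G x) := by
  rw [hev, braiding_naturality_left_assoc]
  exact congrArg (fun t => _ ≫ t) (MonoidalClosed.uncurry_natural_left _ _).symm

lemma hev_act (F G : EnrichedFunctor V C V) (x y : C) :
    (Hom⟪F, G⟫ : V) ◁ act F x y ≫ hev F G y =
      (α_ _ _ _).inv ≫ hev F G x ▷ Hom⟪x, y⟫ ≫ act G x y :=
  (nat_iff_braided (F := F) (G := G) x y (fun x => natπ F G x)).1 ((natFam F G).nat x y)

/-- The morphism `A ⟶ [C, V](F, G)` corresponding to a family `A ⊗ F x ⟶ G x`. -/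
noncomputable def hlift {F G : EnrichedFunctor V C V} {A : V} (t : ∀ x, A ⊗ F.obj x ⟶ G.obj x)
    (ht : ∀ x y, A ◁ act F x y ≫ t y = (α_ _ _ _).inv ≫ t x ▷ Hom⟪x, y⟫ ≫ act G x y) :
    A ⟶ (Hom⟪F, G⟫ : V) :=
  natLift (GNat.mk' (fun x => MonoidalClosed.curry ((β_ _ _).hom ≫ t x)) (fun x y => by
    refine (nat_iff_braided (F := F) (G := G) x y
      (fun x => MonoidalClosed.curry ((β_ _ _).hom ≫ t x))).2 ?_
    simpa only [MonoidalClosed.uncurry_curry, SymmetricCategory.symmetry_assoc] using ht x y))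

lemma hlift_hev {F G : EnrichedFunctor V C V} {A : V} (t : ∀ x, A ⊗ F.obj x ⟶ G.obj x)
    (ht : ∀ x y, A ◁ act F x y ≫ t y = (α_ _ _ _).inv ≫ t x ▷ Hom⟪x, y⟫ ≫ act G x y) (x : C) :
    hlift t ht ▷ F.obj x ≫ hev F G x = t x := by
  rw [comp_hev]
  refine (congrArg (fun t => _ ≫ MonoidalClosed.uncurry t) (natLift_π _ x)).trans ?_
  refine (congrArg (fun t => _ ≫ t) (MonoidalClosed.uncurry_curry _)).trans ?_
  rw [SymmetricCategory.symmetry_assoc]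

lemma hev_ext {F G : EnrichedFunctor V C V} {A : V} {f g : A ⟶ (Hom⟪F, G⟫ : V)}
    (h : ∀ x, f ▷ F.obj x ≫ hev F G x = g ▷ F.obj x ≫ hev F G x) : f = g := by
  apply functorHom_ext
  intro x
  have := h x
  rw [comp_hev, comp_hev, cancel_epi] at this
  exact MonoidalClosed.uncurry_injective this

/-- Composition `[C, V](G, H) ⊗ [C, V](F, G) ⟶ [C, V](F, H)`, in applicative order. -/
noncomputable def pcomp (F G H : EnrichedFunctor V C V) :
    (Hom⟪G, H⟫ : V) ⊗ (Hom⟪F, G⟫ : V) ⟶ (Hom⟪F, H⟫ : V) :=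
  (β_ (Hom⟪G, H⟫ : V) (Hom⟪F, G⟫ : V)).hom ≫ eComp V F G H

lemma pcomp_hev (F G H : EnrichedFunctor V C V) (x : C) :
    pcomp F G H ▷ F.obj x ≫ hev F H x =
      (α_ _ _ _).hom ≫ (Hom⟪G, H⟫ : V) ◁ hev F G x ≫ hev G H x := by
  have h : F.obj x ◁ eComp V F G H ≫ MonoidalClosed.uncurry (A := F.obj x) (X := H.obj x)
      (natπ F H x) = (α_ _ _ _).inv ≫
      MonoidalClosed.uncurry (A := F.obj x) (X := G.obj x) (natπ F G x) ▷ (Hom⟪G, H⟫ : V) ≫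
      MonoidalClosed.uncurry (A := G.obj x) (X := H.obj x) (natπ G H x) := by
    refine (MonoidalClosed.uncurry_natural_left _ _).symm.trans ?_
    refine (congrArg MonoidalClosed.uncurry (natLift_π _ x)).trans ?_
    exact uncurry_ecmp _ _
  exact braided_comp_aux h

lemma eId_hev (F : EnrichedFunctor V C V) (x : C) :
    eId V F ▷ F.obj x ≫ hev F F x = (λ_ _).hom := by
  rw [comp_hev]
  refine (congrArg (fun t => _ ≫ MonoidalClosed.uncurry t) (eId_π F x)).trans ?_
  refine (congrArg (fun t => _ ≫ t) (MonoidalClosed.uncurry_curry _)).trans ?_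
  simp

lemma act_homFunctor {𝒜 : Type w₁} [EnrichedCategory V 𝒜] (a x y : 𝒜) :
    act (homFunctor V a) x y = eComp V a x y := MonoidalClosed.uncurry_curry _

/-- Evaluation `[C, V](F, C(b, -)) ⊗ F x ⟶ C(b, x)`. -/
noncomputable def hevHom (F : EnrichedFunctor V C V) (b x : C) :
    (Hom⟪F, homFunctor V b⟫ : V) ⊗ F.obj x ⟶ Hom⟪b, x⟫ := hev F (homFunctor V b) x

lemma hevHom_ext {F : EnrichedFunctor V C V} {b : C} {A : V}
    {f g : A ⟶ (Hom⟪F, homFunctor V b⟫ : V)}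
    (h : ∀ x, f ▷ F.obj x ≫ hevHom F b x = g ▷ F.obj x ≫ hevHom F b x) : f = g :=
  hev_ext h

/-- The action of `C` on a representable is composition; stating it with `eComp` lets later rewrites
match syntactically. -/
lemma hevHom_act (F : EnrichedFunctor V C V) (b x y : C) :
    (Hom⟪F, homFunctor V b⟫ : V) ◁ act F x y ≫ hevHom F b y =
      (α_ _ _ _).inv ≫ hevHom F b x ▷ Hom⟪x, y⟫ ≫ eComp V b x y := by
  rw [← act_homFunctor]
  exact hev_act F (homFunctor V b) x y

lemma pcomp_hevHom (F G : EnrichedFunctor V C V) (b x : C) :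
    pcomp F G (homFunctor V b) ▷ F.obj x ≫ hevHom F b x =
      (α_ _ _ _).hom ≫ (Hom⟪G, homFunctor V b⟫ : V) ◁ hev F G x ≫ hevHom G b x :=
  pcomp_hev F G (homFunctor V b) x

/-- A natural family `φ b ⊗ ψ c ⟶ C(b, c)`. -/
structure Pairing (φ : EnrichedFunctor V Cᵒᵖ V) (ψ : EnrichedFunctor V C V) where
  pair : ∀ b c : C, φ.obj (op b) ⊗ ψ.obj c ⟶ Hom⟪b, c⟫
  naturality_right : ∀ b c c' : C, φ.obj (op b) ◁ act ψ c c' ≫ pair b c' =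
    (α_ _ _ _).inv ≫ pair b c ▷ Hom⟪c, c'⟫ ≫ eComp V b c c'
  naturality_left : ∀ b' b c : C, lact φ b' b ▷ ψ.obj c ≫ pair b' c =
    (α_ _ _ _).hom ≫ (Hom⟪b', b⟫ : V) ◁ pair b c ≫ eComp V b' b c

namespace Pairing

variable {φ : EnrichedFunctor V Cᵒᵖ V} {ψ : EnrichedFunctor V C V} (P : Pairing φ ψ)

/-- The transpose `φ b ⟶ [C, V](ψ, C(b, -))`. -/
noncomputable def θ (b : C) : φ.obj (op b) ⟶ (Hom⟪ψ, homFunctor V b⟫ : V) :=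
  hlift (G := homFunctor V b) (P.pair b)
    (fun x y => by rw [act_homFunctor]; exact P.naturality_right b x y)

lemma θ_hevHom (b x : C) : P.θ b ▷ ψ.obj x ≫ hevHom ψ b x = P.pair b x := hlift_hev _ _ x

/-- The morphism `X c ⊗ φ c ⟶ [C, V](ψ, X)` with transpose
`X c ⊗ φ c ⊗ ψ x ⟶ X c ⊗ C(c, x) ⟶ X x`. -/
noncomputable def k (X : EnrichedFunctor V C V) (c : C) :
    X.obj c ⊗ φ.obj (op c) ⟶ (Hom⟪ψ, X⟫ : V) :=
  hlift (fun x => (α_ _ _ _).hom ≫ X.obj c ◁ P.pair c x ≫ act X c x) (fun x y => by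
    simp only [comp_whiskerRight, Category.assoc]
    rw [tensor_whiskerLeft, Category.assoc, Category.assoc, Iso.inv_hom_id_assoc,
      ← MonoidalCategory.whiskerLeft_comp_assoc, P.naturality_right]
    simp only [MonoidalCategory.whiskerLeft_comp, Category.assoc, act_comp]
    monoidal)

lemma k_hev (X : EnrichedFunctor V C V) (c x : C) : P.k X c ▷ ψ.obj x ≫ hev ψ X x =
    (α_ _ _ _).hom ≫ X.obj c ◁ P.pair c x ≫ act X c x := hlift_hev _ _ x

/-- The morphism `C(b, c) ⊗ φ c ⟶ [C, V](ψ, C(b, -))`. -/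
noncomputable def kHom (b c : C) :
    (Hom⟪b, c⟫ : V) ⊗ φ.obj (op c) ⟶ (Hom⟪ψ, homFunctor V b⟫ : V) := P.k (homFunctor V b) c

lemma kHom_hevHom (b c x : C) : P.kHom b c ▷ ψ.obj x ≫ hevHom ψ b x =
    (α_ _ _ _).hom ≫ (Hom⟪b, c⟫ : V) ◁ P.pair c x ≫ eComp V b c x := by
  rw [← act_homFunctor]
  exact P.k_hev (homFunctor V b) c x

/-- Evaluated at `x`, this is naturality of the pairing in its contravariant variable. -/
lemma kHom_eq (b c : C) : P.kHom b c = lact φ b c ≫ P.θ b := by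
  apply hevHom_ext
  intro x
  rw [kHom_hevHom, comp_whiskerRight, Category.assoc, θ_hevHom, P.naturality_left]

/-- Naturality of the pairing in its first variable moves the action on `φ` onto `C(i, x)`, where
associativity of the action on `X` absorbs it. -/
lemma isCowedge_k (X : EnrichedFunctor V C V) : IsCowedge φ X (P.k X) := by
  intro i j
  apply hev_ext
  intro x
  simp only [comp_whiskerRight, Category.assoc, k_hev]
  rw [associator_naturality_middle_assoc, ← MonoidalCategory.whiskerLeft_comp_assoc,
    P.naturality_left]
  simp only [MonoidalCategory.whiskerLeft_comp, Category.assoc, act_comp]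
  rw [associator_naturality_left_assoc, ← whisker_exchange_assoc]
  monoidal

/-- Naturality of `k` in the covariant functor. The right adjoint of `[ψ, -]` and the isomorphism
`[ψ, -] ≅ φ * -` both rest on it. -/
lemma k_pcomp (X Z : EnrichedFunctor V C V) (c : C) :
    (Hom⟪X, Z⟫ : V) ◁ P.k X c ≫ pcomp ψ X Z =
      (α_ _ _ _).inv ≫ hev X Z c ▷ φ.obj (op c) ≫ P.k Z c := by
  apply hev_ext
  intro x
  simp only [comp_whiskerRight, Category.assoc, k_hev, pcomp_hev]
  rw [associator_naturality_middle_assoc, ← MonoidalCategory.whiskerLeft_comp_assoc, k_hev]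
  simp only [MonoidalCategory.whiskerLeft_comp, Category.assoc, hev_act]
  rw [associator_naturality_left_assoc, ← whisker_exchange_assoc]
  monoidal

lemma kHom_pcomp (X : EnrichedFunctor V C V) (b c : C) :
    (Hom⟪X, homFunctor V b⟫ : V) ◁ P.k X c ≫ pcomp ψ X (homFunctor V b) =
      (α_ _ _ _).inv ≫ hevHom X b c ▷ φ.obj (op c) ≫ P.kHom b c :=
  P.k_pcomp X (homFunctor V b) c

/-- Each `[C, V](ψ, X)` is the coend of `X c ⊗ φ c`. -/
def HomIsCoend : Prop := ∀ X : EnrichedFunctor V C V, IsCoend φ X (P.k X)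

end Pairing

end Planar

end Isbell

namespace Isbell

/-! ### `HomIsCoend` is equivalent to being the counit of an adjunction of modules. -/

section PlanarAdjunction

variable {V : Type u} [Category.{v} V] [MonoidalCategory V] [SymmetricCategory V]
  [MonoidalClosed V]
variable {C : Type w} [EnrichedCategory V C]
  {φ : EnrichedFunctor V Cᵒᵖ V} {ψ : EnrichedFunctor V C V}

namespace Pairing

section

variable [HasLimits V] [VSmall V C] (P : Pairing φ ψ)

/-- The pairing is the counit of an adjunction of modules with unit `η : I ⟶ ∫^c ψ c ⊗ φ c`. -/
structure IsCounit {H : V} (ι : ∀ c, ψ.obj c ⊗ φ.obj (op c) ⟶ H) (η : 𝟙_ V ⟶ H) : Prop where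
  left : ∀ b, ∃ t : φ.obj (op b) ⊗ H ⟶ φ.obj (op b),
    (∀ c, φ.obj (op b) ◁ ι c ≫ t = (α_ _ _ _).inv ≫ P.pair b c ▷ φ.obj (op c) ≫ lact φ b c) ∧
    (ρ_ _).inv ≫ φ.obj (op b) ◁ η ≫ t = 𝟙 _
  right : ∀ c, ∃ t : H ⊗ ψ.obj c ⟶ ψ.obj c,
    (∀ b, ι b ▷ ψ.obj c ≫ t = (α_ _ _ _).hom ≫ ψ.obj b ◁ P.pair b c ≫ act ψ b c) ∧
    (λ_ _).inv ≫ η ▷ ψ.obj c ≫ t = 𝟙 _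

variable {P} {H : V} {ι : ∀ c, ψ.obj c ⊗ φ.obj (op c) ⟶ H} {η : 𝟙_ V ⟶ H}

/-- Evaluation commutes with the actions, so a cowedge on `Z` pulls back along `[X, Z] ⊗ X c ⟶ Z c`.
-/
lemma cowedge_aux {X Z : EnrichedFunctor V C V} {a : V}
    {p : ∀ c, Z.obj c ⊗ φ.obj (op c) ⟶ a} (hp : IsCowedge φ Z p) (i j : C) :
    (Hom⟪X, Z⟫ : V) ◁ act X i j ▷ φ.obj (op j) ≫ (α_ _ _ _).inv ≫
        hev X Z j ▷ φ.obj (op j) ≫ p j =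
      (Hom⟪X, Z⟫ : V) ◁ (α_ _ _ _).hom ≫ (Hom⟪X, Z⟫ : V) ◁ X.obj i ◁ lact φ i j ≫
        (α_ _ _ _).inv ≫ hev X Z i ▷ φ.obj (op i) ≫ p i := by
  rw [associator_inv_naturality_middle_assoc, ← comp_whiskerRight_assoc, hev_act,
    associator_inv_naturality_right_assoc, whisker_exchange_assoc]
  simp only [comp_whiskerRight, Category.assoc, hp i j]
  monoidal

/-- The factorization of a cowedge `p` inserts `η`, evaluates `[ψ, X] ⊗ ψ c ⟶ X c` inside the coend,
and applies `p`. The left triangle shows that it restricts to `p`; the right triangle shows that it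
is the only one. -/
lemma HomIsCoend.of_isCounit (hι : IsCoend φ ψ ι) (h : P.IsCounit ι η) : P.HomIsCoend := by
  intro X
  refine ⟨P.isCowedge_k X, fun {a} p hp => ?_⟩
  obtain ⟨d, hd⟩ := hι.exists_desc_left (W := (Hom⟪ψ, X⟫ : V))
    (fun c => (α_ _ _ _).inv ≫ hev ψ X c ▷ φ.obj (op c) ≫ p c) (cowedge_aux hp)
  refine ⟨(ρ_ _).inv ≫ (Hom⟪ψ, X⟫ : V) ◁ η ≫ d, fun c => ?_, fun f hf => ?_⟩
  · obtain ⟨t, ht, htη⟩ := h.left c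
    -- On the coprojection at `c'`, the cowedge law of `p` trades the action of `C(c, c')` on `X`
    -- for the one on `φ`, which is what `t` encodes.
    have key : P.k X c ▷ H ≫ d = (α_ _ _ _).hom ≫ X.obj c ◁ t ≫ p c := by
      apply hι.hom_ext_left
      intro c'
      rw [whisker_exchange_assoc, hd, associator_inv_naturality_left_assoc,
        ← comp_whiskerRight_assoc, k_hev, tensor_whiskerLeft]
      simp only [Category.assoc, Iso.inv_hom_id_assoc]
      rw [← MonoidalCategory.whiskerLeft_comp_assoc, ht]
      simp only [comp_whiskerRight, MonoidalCategory.whiskerLeft_comp, Category.assoc, hp c c']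
      monoidal
    rw [rightUnitor_inv_naturality_assoc, ← whisker_exchange_assoc, key, tensor_whiskerLeft]
    simp only [Category.assoc, Iso.inv_hom_id_assoc]
    have h3 := congrArg (fun t => X.obj c ◁ t ≫ p c) htη
    simp only [MonoidalCategory.whiskerLeft_comp, MonoidalCategory.whiskerLeft_id,
      Category.assoc, Category.id_comp] at h3
    refine Eq.trans ?_ h3
    monoidal
  -- The universal instance of `d`, for the cowedge `k` itself. For any factorization `f` one has `d
  -- = r ≫ f`, and `η` followed by `r` is the identity, so `f` is recovered from `d`.
  · obtain ⟨r, hr⟩ := hι.exists_desc_left (W := (Hom⟪ψ, X⟫ : V))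
      (fun c => (α_ _ _ _).inv ≫ hev ψ X c ▷ φ.obj (op c) ≫ P.k X c)
      (cowedge_aux (P.isCowedge_k X))
    have hd' : d = r ≫ f := by
      apply hι.hom_ext_left
      intro c
      rw [hd, ← Category.assoc ((Hom⟪ψ, X⟫ : V) ◁ ι c), hr]
      simp only [Category.assoc]
      rw [hf c]
    have hid : (ρ_ _).inv ≫ (Hom⟪ψ, X⟫ : V) ◁ η ≫ r = 𝟙 _ := by
      apply hev_ext
      intro x
      obtain ⟨t, ht, htη⟩ := h.right x
      have key : r ▷ ψ.obj x ≫ hev ψ X x =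
          (α_ _ _ _).hom ≫ (Hom⟪ψ, X⟫ : V) ◁ t ≫ hev ψ X x := by
        apply hι.hom_ext_middle
        intro c
        rw [← comp_whiskerRight_assoc, hr, associator_naturality_middle_assoc,
          ← MonoidalCategory.whiskerLeft_comp_assoc, ht]
        simp only [comp_whiskerRight, MonoidalCategory.whiskerLeft_comp, Category.assoc, k_hev,
          hev_act]
        rw [associator_naturality_left_assoc, ← whisker_exchange_assoc]
        monoidal
      rw [comp_whiskerRight, comp_whiskerRight, Category.assoc, Category.assoc, key,
        associator_naturality_middle_assoc, ← MonoidalCategory.whiskerLeft_comp_assoc]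
      have h3 := congrArg (fun t => (Hom⟪ψ, X⟫ : V) ◁ t ≫ hev ψ X x) htη
      simp only [MonoidalCategory.whiskerLeft_comp, MonoidalCategory.whiskerLeft_id,
        Category.assoc, Category.id_comp] at h3 ⊢
      rw [id_whiskerRight, Category.id_comp]
      refine Eq.trans ?_ h3
      monoidal
    rw [hd', ← Category.assoc, ← Category.assoc]
    simp only [Category.assoc] at hid ⊢
    rw [← Category.assoc ((Hom⟪ψ, X⟫ : V) ◁ η) r f, ← Category.assoc, hid, Category.id_comp]

lemma isCowedge_lact (b : C) :
    IsCowedge φ (homFunctor V b) (fun c => lact φ b c) := by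
  intro i j
  beta_reduce
  rw [act_homFunctor]
  exact lact_comp φ b i j

/-- The co-Yoneda argument at `X = C(b, -)`: the left action on `φ` descends to an inverse, because
`θ b` is the restriction of `kHom b b` along the identity of `b`. -/
lemma HomIsCoend.isIso_θ (h : P.HomIsCoend) (b : C) : IsIso (P.θ b) := by
  obtain ⟨f, hf, -⟩ := (h (homFunctor V b)).existsUnique_desc _ (isCowedge_lact b)
  have hf' : ∀ c, P.kHom b c ≫ f = lact φ b c := hf
  refine ⟨f, ?_, ?_⟩
  · have h1 : (λ_ _).inv ≫ eId V b ▷ φ.obj (op b) ≫ P.kHom b b = P.θ b := by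
      rw [kHom_eq, ← Category.assoc (eId V b ▷ _), lact_id, Iso.inv_hom_id_assoc]
    rw [← h1, Category.assoc, Category.assoc, hf', lact_id, Iso.inv_hom_id]
  · apply (h (homFunctor V b)).hom_ext
    intro c
    show P.kHom b c ≫ f ≫ P.θ b = P.kHom b c ≫ 𝟙 _
    rw [← Category.assoc, hf', ← kHom_eq, Category.comp_id]

/-- The unit is the identity of `ψ` transported along the comparison `f` from `[ψ, ψ]` to the coend
of `ψ c ⊗ φ c`. Under `f` the contractions `t` become composition and evaluation in the functor
category, so the triangles are unit laws. -/
lemma HomIsCoend.exists_isCounit (h : P.HomIsCoend) (hι : IsCoend φ ψ ι) :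
    ∃ η : 𝟙_ V ⟶ H, P.IsCounit ι η := by
  obtain ⟨f, hf, -⟩ := (h ψ).existsUnique_desc ι hι.cowedge
  refine ⟨eId V ψ ≫ f, fun b => ?_, fun c => ?_⟩
  · obtain ⟨t, ht⟩ := hι.exists_desc_left (W := φ.obj (op b))
      (fun c => (α_ _ _ _).inv ≫ P.pair b c ▷ φ.obj (op c) ≫ lact φ b c) (by
        intro i j
        rw [associator_inv_naturality_middle_assoc, ← comp_whiskerRight_assoc,
          P.naturality_right, associator_inv_naturality_right_assoc, whisker_exchange_assoc]
        simp only [comp_whiskerRight, Category.assoc, lact_comp]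
        monoidal)
    refine ⟨t, ht, ?_⟩
    have := h.isIso_θ b
    -- `θ b` is invertible, so the triangle may be tested in `[ψ, C(b, -)]`, where `t` turns into
    -- precomposition with endomorphisms of `ψ`.
    rw [← cancel_mono (P.θ b)]
    have key : φ.obj (op b) ◁ f ≫ t ≫ P.θ b =
        P.θ b ▷ (Hom⟪ψ, ψ⟫ : V) ≫ pcomp ψ ψ (homFunctor V b) := by
      apply (h ψ).hom_ext_left
      intro c
      rw [← MonoidalCategory.whiskerLeft_comp_assoc, hf, ← Category.assoc, ht,
        whisker_exchange_assoc, kHom_pcomp, associator_inv_naturality_left_assoc,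
        ← comp_whiskerRight_assoc, θ_hevHom, Category.assoc, Category.assoc, kHom_eq]
    have h1 : P.θ b ▷ 𝟙_ V ≫ (Hom⟪ψ, homFunctor V b⟫ : V) ◁ eId V ψ ≫
        pcomp ψ ψ (homFunctor V b) = (ρ_ _).hom ≫ P.θ b := by
      apply hevHom_ext
      intro x
      simp only [comp_whiskerRight, Category.assoc, pcomp_hevHom]
      rw [associator_naturality_middle_assoc, ← MonoidalCategory.whiskerLeft_comp_assoc, eId_hev,
        associator_naturality_left_assoc, ← whisker_exchange_assoc, θ_hevHom]
      monoidal
    simp only [MonoidalCategory.whiskerLeft_comp, Category.assoc, Category.id_comp]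
    rw [key, whisker_exchange_assoc, h1, Iso.inv_hom_id_assoc]
  · obtain ⟨t, ht⟩ := hι.exists_desc_right (W := ψ.obj c)
      (fun b => (α_ _ _ _).hom ≫ ψ.obj b ◁ P.pair b c ≫ act ψ b c) (by
        intro i j
        rw [associator_naturality_left_assoc, ← whisker_exchange_assoc,
          associator_naturality_middle_assoc, ← MonoidalCategory.whiskerLeft_comp_assoc,
          P.naturality_left]
        simp only [MonoidalCategory.whiskerLeft_comp, Category.assoc, act_comp]
        monoidal)
    refine ⟨t, ht, ?_⟩
    have key : f ▷ ψ.obj c ≫ t = hev ψ ψ c := by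
      apply (h ψ).hom_ext_right
      intro b
      rw [← comp_whiskerRight_assoc, hf, ht, k_hev]
    rw [comp_whiskerRight, Category.assoc, key, eId_hev, Iso.inv_hom_id]

end

end Pairing

end PlanarAdjunction

end Isbell

namespace Isbell

/-! ### Exchanging `φ` and `ψ` over the opposite category. -/

section Duality

variable {V : Type u} [Category.{v} V] [MonoidalCategory V] [SymmetricCategory V]

section Coherence

/-- The five `swap_aux` lemmas translate axioms over `C` into axioms over `Cᵒᵖ`: the first two the
two naturalities of a pairing, the third the cowedge law, the last two the triangle identities. -/
lemma swap_aux₁ {S F B F' H H' : V} {a : F ⊗ B ⟶ F'} {p : F ⊗ S ⟶ H} {p' : F' ⊗ S ⟶ H'}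
    {m : B ⊗ H ⟶ H'} (h : ((β_ B F).hom ≫ a) ▷ S ≫ p' = (α_ _ _ _).hom ≫ B ◁ p ≫ m) :
    S ◁ a ≫ (β_ _ _).hom ≫ p' = (α_ _ _ _).inv ≫ ((β_ _ _).hom ≫ p) ▷ B ≫ (β_ _ _).hom ≫ m := by
  have h' : a ▷ S ≫ p' = (β_ F B).hom ▷ S ≫ (α_ _ _ _).hom ≫ B ◁ p ≫ m := by
    rw [← h, ← comp_whiskerRight_assoc, SymmetricCategory.symmetry_assoc]
  rw [braiding_naturality_right_assoc, h', comp_whiskerRight, Category.assoc,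
    braiding_naturality_left_assoc, braiding_tensor_right_hom, braiding_tensor_left_hom]
  simp

lemma braiding_tensor_swap (B S F : V) :
    (β_ B S).hom ▷ F ≫ (β_ (S ⊗ B) F).hom ≫ (α_ _ _ _).inv =
      (α_ _ _ _).hom ≫ B ◁ (β_ S F).hom ≫ (β_ B (F ⊗ S)).hom := by
  have := (α_ _ _ _).hom ≫= yang_baxter B S F =≫ (α_ _ _ _).inv
  rw [braiding_tensor_left_hom, braiding_tensor_right_hom]
  simpa using this

lemma swap_aux₂ {S F B S' H H' : V} {a : S ⊗ B ⟶ S'} {p : F ⊗ S ⟶ H} {p' : F ⊗ S' ⟶ H'}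
    {m : H ⊗ B ⟶ H'} (h : F ◁ a ≫ p' = (α_ _ _ _).inv ≫ p ▷ B ≫ m) :
    ((β_ B S).hom ≫ a) ▷ F ≫ (β_ _ _).hom ≫ p' =
      (α_ _ _ _).hom ≫ B ◁ ((β_ _ _).hom ≫ p) ≫ (β_ _ _).hom ≫ m := by
  have e := braiding_tensor_swap B S F =≫ (p ▷ B ≫ m)
  rw [comp_whiskerRight, Category.assoc, braiding_naturality_left_assoc, h,
    MonoidalCategory.whiskerLeft_comp, Category.assoc, braiding_naturality_right_assoc]
  simpa using e

lemma swap_aux₃ {F B F' S S' H : V} {a : F ⊗ B ⟶ F'} {s : S ⊗ B ⟶ S'} {p : S ⊗ F' ⟶ H}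
    {p' : S' ⊗ F ⟶ H} :
    a ▷ S ≫ (β_ _ _).hom ≫ p = (α_ _ _ _).hom ≫ F ◁ ((β_ B S).hom ≫ s) ≫ (β_ _ _).hom ≫ p' ↔
      s ▷ F ≫ p' = (α_ _ _ _).hom ≫ S ◁ ((β_ B F).hom ≫ a) ≫ p := by
  have e : (β_ (F ⊗ B) S).hom = ((α_ _ _ _).hom ≫ F ◁ (β_ B S).hom ≫ (β_ F (S ⊗ B)).hom) ≫
      (α_ _ _ _).hom ≫ S ◁ (β_ B F).hom := by
    rw [braiding_tensor_left_hom, braiding_tensor_right_hom]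
    simp only [Category.assoc, Iso.inv_hom_id_assoc]
    rw [← MonoidalCategory.whiskerLeft_comp, SymmetricCategory.symmetry]
    simp
  rw [braiding_naturality_left_assoc, e, MonoidalCategory.whiskerLeft_comp_assoc,
    braiding_naturality_right_assoc,
    ← cancel_epi ((α_ _ _ _).hom ≫ F ◁ (β_ B S).hom ≫ (β_ F (S ⊗ B)).hom)]
  simp only [Category.assoc, MonoidalCategory.whiskerLeft_comp]
  exact eq_comm

lemma swap_aux₄ {S S' F B H : V} {p : F ⊗ S ⟶ B} {a : S' ⊗ B ⟶ S} {j : S' ⊗ F ⟶ H}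
    {t : H ⊗ S ⟶ S} : S ◁ ((β_ F S').hom ≫ j) ≫ (β_ S H).hom ≫ t =
      (α_ _ _ _).inv ≫ ((β_ S F).hom ≫ p) ▷ S' ≫ (β_ B S').hom ≫ a ↔
    j ▷ S ≫ t = (α_ _ _ _).hom ≫ S' ◁ p ≫ a := by
  have e : (α_ _ _ _).inv ≫ (β_ S F).hom ▷ S' ≫ (β_ (F ⊗ S) S').hom =
      (S ◁ (β_ F S').hom ≫ (β_ S (S' ⊗ F)).hom) ≫ (α_ _ _ _).hom := by
    have := yang_baxter S F S'
    rw [braiding_tensor_left_hom, braiding_tensor_right_hom]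
    simpa using this
  have e' := e =≫ (S' ◁ p ≫ a)
  simp only [Category.assoc] at e'
  rw [comp_whiskerRight, Category.assoc, braiding_naturality_left_assoc, e',
    MonoidalCategory.whiskerLeft_comp, Category.assoc, braiding_naturality_right_assoc,
    ← cancel_epi (S ◁ (β_ F S').hom ≫ (β_ S (S' ⊗ F)).hom)]
  simp only [Category.assoc]

lemma swap_aux₅ {F F' S B H : V} {p : F ⊗ S ⟶ B} {a : F' ⊗ B ⟶ F} {j : S ⊗ F' ⟶ H}
    {t : F ⊗ H ⟶ F} : ((β_ F' S).hom ≫ j) ▷ F ≫ (β_ H F).hom ≫ t =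
      (α_ _ _ _).hom ≫ F' ◁ ((β_ S F).hom ≫ p) ≫ a ↔
    F ◁ j ≫ t = (α_ _ _ _).inv ≫ p ▷ F' ≫ (β_ _ _).hom ≫ a := by
  have e := braiding_tensor_swap F' S F =≫ (p ▷ F' ≫ (β_ _ _).hom ≫ a)
  simp only [Category.assoc] at e
  rw [comp_whiskerRight, Category.assoc, braiding_naturality_left_assoc,
    ← cancel_epi ((β_ F' S).hom ▷ F ≫ (β_ (S ⊗ F') F).hom)]
  have e' : (β_ F' (F ⊗ S)).hom ≫ p ▷ F' ≫ (β_ _ _).hom ≫ a = F' ◁ p ≫ a := by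
    rw [← braiding_naturality_right_assoc, SymmetricCategory.symmetry_assoc]
  simp only [Category.assoc, e, e', MonoidalCategory.whiskerLeft_comp]

lemma braiding_comp_eq_iff {X Y H a : V} {ι : X ⊗ Y ⟶ H} {f : H ⟶ a} {p : Y ⊗ X ⟶ a} :
    ((β_ Y X).hom ≫ ι) ≫ f = p ↔ ι ≫ f = (β_ X Y).hom ≫ p := by
  rw [← cancel_epi (β_ X Y).hom, Category.assoc, SymmetricCategory.symmetry_assoc]

end Coherence
variable [MonoidalClosed V]
variable {C : Type w} [EnrichedCategory V C]

variable (V C) in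
/-- The identification `Cᵒᵖᵒᵖ ⟶ C`. -/
def unopUnop : EnrichedFunctor V Cᵒᵖᵒᵖ C where
  obj X := X.unop.unop
  map X Y := 𝟙 (Hom⟪X.unop.unop, Y.unop.unop⟫ : V)
  map_id X := Category.comp_id _
  map_comp X Y Z := by
    refine (Category.comp_id _).trans ?_
    refine Eq.trans ?_ (congrArg (fun t => t ≫ eComp V X.unop.unop Y.unop.unop Z.unop.unop)
      (id_tensorHom_id _ _)).symm
    refine Eq.trans ?_ (Category.id_comp _).symm
    exact SymmetricCategory.symmetry_assoc _ _ _

/-- A covariant `V`-functor on `C` as a contravariant one on `Cᵒᵖ`. -/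
def onOp (X : EnrichedFunctor V C V) : EnrichedFunctor V Cᵒᵖᵒᵖ V := (unopUnop V C).comp V X

lemma act_onOp (X : EnrichedFunctor V C V) (i j : Cᵒᵖᵒᵖ) :
    act (onOp X) i j = act X i.unop.unop j.unop.unop :=
  congrArg MonoidalClosed.uncurry (Category.id_comp (X.map i.unop.unop j.unop.unop))

lemma lact_onOp (X : EnrichedFunctor V C V) (i j : Cᵒᵖ) :
    lact (onOp X) i j = (β_ (Hom⟪j.unop, i.unop⟫ : V) (X.obj j.unop)).hom ≫
      act X j.unop i.unop :=
  congrArg (fun t => (β_ (Hom⟪j.unop, i.unop⟫ : V) (X.obj j.unop)).hom ≫ t)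
    (act_onOp X (op j) (op i))

/-- The cowedge law equates an action on one factor with an action on the other, so reversing the
tensor product only exchanges its two sides. -/
lemma IsCowedge.onOp_iff {φ : EnrichedFunctor V Cᵒᵖ V} {X : EnrichedFunctor V C V} {a : V}
    {p : ∀ c, X.obj c ⊗ φ.obj (op c) ⟶ a} :
    IsCowedge (onOp X) φ (fun c => (β_ (φ.obj c) (X.obj c.unop)).hom ≫ p c.unop) ↔
      IsCowedge φ X p := by
  have key : ∀ i j : Cᵒᵖ, (act φ i j ▷ X.obj j.unop ≫ (β_ _ _).hom ≫ p j.unop =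
      (α_ _ _ _).hom ≫ φ.obj i ◁ lact (onOp X) i j ≫ (β_ _ _).hom ≫ p i.unop ↔
      act X j.unop i.unop ▷ φ.obj i ≫ p i.unop =
        (α_ _ _ _).hom ≫ X.obj j.unop ◁ lact φ j.unop i.unop ≫ p j.unop) := by
    intro i j
    rw [lact_onOp]
    exact swap_aux₃
  exact ⟨fun h i j => (key (op j) (op i)).1 (h _ _), fun h i j => (key i j).2 (h _ _)⟩

lemma IsCoend.onOp {φ : EnrichedFunctor V Cᵒᵖ V} {X : EnrichedFunctor V C V} {H : V}
    {ι : ∀ c, X.obj c ⊗ φ.obj (op c) ⟶ H} (h : IsCoend φ X ι) :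
    IsCoend (onOp X) φ (fun c => (β_ (φ.obj c) (X.obj c.unop)).hom ≫ ι c.unop) where
  cowedge := IsCowedge.onOp_iff.2 h.cowedge
  existsUnique_desc {a} p hp := by
    have e : p = fun c => (β_ (φ.obj c) (X.obj c.unop)).hom ≫ (β_ _ _).hom ≫ p c := by
      funext c
      exact (SymmetricCategory.symmetry_assoc _ _ _).symm
    rw [e] at hp
    have hp' := IsCowedge.onOp_iff (p := fun c => (β_ _ _).hom ≫ p (op c)).1 hp
    obtain ⟨f, hf, hf'⟩ := h.existsUnique_desc _ hp'
    exact ⟨f, fun c => braiding_comp_eq_iff.2 (hf c.unop),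
      fun g hg => hf' g fun c => braiding_comp_eq_iff.1 (hg (op c))⟩

namespace Pairing

variable {φ : EnrichedFunctor V Cᵒᵖ V} {ψ : EnrichedFunctor V C V} (P : Pairing φ ψ)

/-- The pairing over `Cᵒᵖ` with exchanged variances. -/
def swap : Pairing (onOp ψ) φ where
  pair b c := (β_ (ψ.obj b.unop) (φ.obj c)).hom ≫ P.pair c.unop b.unop
  naturality_right b c c' := swap_aux₁ (P.naturality_left c'.unop c.unop b.unop)
  naturality_left b' b c := by
    rw [lact_onOp]
    exact swap_aux₂ (P.naturality_right c.unop b.unop b'.unop)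

/-- The two triangle identities trade places. Each contraction `t` is precomposed with the symmetry
that moves `H` to the other side. -/
lemma isCounit_swap_iff {H : V} {ι : ∀ c, ψ.obj c ⊗ φ.obj (op c) ⟶ H} {η : 𝟙_ V ⟶ H} :
    P.swap.IsCounit (fun c => (β_ (φ.obj c) (ψ.obj c.unop)).hom ≫ ι c.unop) η ↔
      P.IsCounit ι η := by
  have key₁ : ∀ b : Cᵒᵖ,
      (∃ t : ψ.obj b.unop ⊗ H ⟶ ψ.obj b.unop, (∀ c : Cᵒᵖ,
        ψ.obj b.unop ◁ ((β_ (φ.obj c) (ψ.obj c.unop)).hom ≫ ι c.unop) ≫ t = (α_ _ _ _).inv ≫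
          ((β_ (ψ.obj b.unop) (φ.obj c)).hom ≫ P.pair c.unop b.unop) ▷ ψ.obj c.unop ≫
            lact (onOp ψ) b c) ∧ (ρ_ _).inv ≫ ψ.obj b.unop ◁ η ≫ t = 𝟙 _) ↔
      (∃ t : H ⊗ ψ.obj b.unop ⟶ ψ.obj b.unop, (∀ c : C, ι c ▷ ψ.obj b.unop ≫ t =
        (α_ _ _ _).hom ≫ ψ.obj c ◁ P.pair c b.unop ≫ act ψ c b.unop) ∧
          (λ_ _).inv ≫ η ▷ ψ.obj b.unop ≫ t = 𝟙 _) := by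
    intro b
    constructor
    · rintro ⟨t, ht, ht'⟩
      refine ⟨(β_ _ _).hom ≫ t, fun c => ?_, ?_⟩
      · have := ht (op c)
        rw [lact_onOp] at this
        refine swap_aux₄.1 ?_
        rw [SymmetricCategory.symmetry_assoc]
        exact this
      · rw [braiding_naturality_left_assoc]
        simpa using ht'
    · rintro ⟨t, ht, ht'⟩
      refine ⟨(β_ _ _).hom ≫ t, fun c => ?_, ?_⟩
      · rw [lact_onOp]
        exact swap_aux₄.2 (ht c.unop)
      · rw [braiding_naturality_right_assoc]
        simpa using ht'
  have key₂ : ∀ c : Cᵒᵖ,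
      (∃ t : H ⊗ φ.obj c ⟶ φ.obj c, (∀ b : Cᵒᵖ,
        ((β_ (φ.obj b) (ψ.obj b.unop)).hom ≫ ι b.unop) ▷ φ.obj c ≫ t = (α_ _ _ _).hom ≫
          φ.obj b ◁ ((β_ (ψ.obj b.unop) (φ.obj c)).hom ≫ P.pair c.unop b.unop) ≫
            act φ b c) ∧ (λ_ _).inv ≫ η ▷ φ.obj c ≫ t = 𝟙 _) ↔
      (∃ t : φ.obj c ⊗ H ⟶ φ.obj c, (∀ b : C, φ.obj c ◁ ι b ≫ t =
        (α_ _ _ _).inv ≫ P.pair c.unop b ▷ φ.obj (op b) ≫ lact φ c.unop b) ∧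
          (ρ_ _).inv ≫ φ.obj c ◁ η ≫ t = 𝟙 _) := by
    intro c
    constructor
    · rintro ⟨t, ht, ht'⟩
      refine ⟨(β_ _ _).hom ≫ t, fun b => ?_, ?_⟩
      · refine swap_aux₅.1 ?_
        rw [SymmetricCategory.symmetry_assoc]
        exact ht (op b)
      · rw [braiding_naturality_right_assoc]
        simpa using ht'
    · rintro ⟨t, ht, ht'⟩
      refine ⟨(β_ _ _).hom ≫ t, fun b => ?_, ?_⟩
      · exact swap_aux₅.2 (ht b.unop)
      · rw [braiding_naturality_left_assoc]
        simpa using ht'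
  constructor
  · intro h
    exact ⟨fun b => (key₂ (op b)).1 (h.right (op b)), fun c => (key₁ (op c)).1 (h.left (op c))⟩
  · intro h
    exact ⟨fun b => (key₁ b).2 (h.right b.unop), fun c => (key₂ c).2 (h.left c.unop)⟩

end Pairing

section

variable [HasLimits V] [VSmall V C] [HasColimits V] {φ : EnrichedFunctor V Cᵒᵖ V}
  {ψ : EnrichedFunctor V C V}

lemma isCoend_wcolim (φ : EnrichedFunctor V Cᵒᵖ V) (X : EnrichedFunctor V C V) :
    IsCoend φ X (coproj (wcolimUnit φ X)) :=
  (wcolim_isWeightedColimit φ X).isCoend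

/-- The counit of an adjunction of modules. -/
def ModuleAdjunction.pairing (M : ModuleAdjunction φ ψ) : Pairing φ ψ where
  pair := M.counit
  naturality_right := M.counit_naturality_right
  naturality_left b' b c := by
    rw [lact, comp_whiskerRight, Category.assoc]
    refine (congrArg (fun t => _ ≫ t) (M.counit_naturality_left b b' c)).trans ?_
    rw [← comp_whiskerRight_assoc, SymmetricCategory.symmetry, id_whiskerRight, Category.id_comp]

lemma ModuleAdjunction.isCounit (M : ModuleAdjunction φ ψ) :
    M.pairing.IsCounit (coproj (wcolimUnit φ ψ)) M.unit :=
  ⟨M.triangle_left, M.triangle_right⟩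

/-- The adjunction of modules with given unit and counit. -/
noncomputable def Pairing.IsCounit.moduleAdjunction {P : Pairing φ ψ} {η : 𝟙_ V ⟶ wcolim φ ψ}
    (h : P.IsCounit (coproj (wcolimUnit φ ψ)) η) : ModuleAdjunction φ ψ where
  unit := η
  counit := P.pair
  counit_naturality_right := P.naturality_right
  counit_naturality_left b b' c := by
    have := (β_ (φ.obj (op b)) (Hom⟪b', b⟫ : V)).hom ▷ ψ.obj c ≫= P.naturality_left b' b c
    rw [← this, lact, ← comp_whiskerRight_assoc, SymmetricCategory.symmetry_assoc]
  triangle_left := h.left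
  triangle_right := h.right

end

end Duality
end Isbell

namespace Isbell

/-! ### Weighted colimits indexed by essentially small categories. -/

section Restriction

variable {V : Type u} [Category.{v} V] [MonoidalCategory V] [SymmetricCategory V]
variable {K : Type w} [EnrichedCategory V K] {𝒜 : Type w₁} [EnrichedCategory V 𝒜]

/-- The index type of a family of objects, as the full sub-`V`-category on the family. -/
def Induced {σ : Type w₂} (_ : σ → K) : Type w₂ := σ

instance {σ : Type w₂} (s : σ → K) : EnrichedCategory V (Induced s) where
  Hom i j := Hom⟪s i, s j⟫
  id i := eId V (s i)
  comp i j k := eComp V (s i) (s j) (s k)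
  id_comp i j := e_id_comp V (s i) (s j)
  comp_id i j := e_comp_id V (s i) (s j)
  assoc i j k l := e_assoc V (s i) (s j) (s k) (s l)

/-- The restriction of a `V`-functor to a family of objects. -/
def restr {σ : Type w₂} (s : σ → K) (S : EnrichedFunctor V K 𝒜) :
    EnrichedFunctor V (Induced s) 𝒜 where
  obj i := S.obj (s i)
  map i j := S.map (s i) (s j)
  map_id i := S.map_id (s i)
  map_comp i j k := S.map_comp (s i) (s j) (s k)

/-- The restriction of a contravariant `V`-functor to a family of objects. -/
def restrOp {σ : Type w₂} (s : σ → K) (φ : EnrichedFunctor V Kᵒᵖ 𝒜) :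
    EnrichedFunctor V (Induced s)ᵒᵖ 𝒜 where
  obj i := φ.obj (op (s i.unop))
  map i j := φ.map (op (s i.unop)) (op (s j.unop))
  map_id i := φ.map_id (op (s i.unop))
  map_comp i j k := φ.map_comp (op (s i.unop)) (op (s j.unop)) (op (s k.unop))

variable [MonoidalClosed V] [HasLimits V]

/-- Computes the comparison componentwise: precomposition with the unit of the colimit. Equalities
of comparison morphisms are checked through it. -/
lemma colimitComparison_π [VSmall V K] (φ : EnrichedFunctor V Kᵒᵖ V) (S : EnrichedFunctor V K 𝒜)
    {c : 𝒜} (μ : VNat φ ((nerve S).obj c)) (a : 𝒜) (z : Kᵒᵖ) :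
    colimitComparison φ S μ a ≫ natπ φ ((nerve S).obj a) z =
      preC (μ.ap z) ((homFunctor V (S.obj z.unop)).map c a) := by
  rw [colimitComparison]
  refine (preC_π _ _ _).trans ?_
  rw [natLift_π]
  congr 1
  exact natLift_π _ _

/-- The restriction of a family `φ ⟶ 𝒜(S -, a)`. -/
noncomputable def restrFam [VSmall V K] {σ : Type v} (s : σ → K) {φ : EnrichedFunctor V Kᵒᵖ V}
    {S : EnrichedFunctor V K 𝒜} {a : 𝒜} {A : V} (p : GNat A φ ((nerve S).obj a)) :
    GNat A (restrOp s φ) ((nerve (restr s S)).obj a) :=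
  GNat.mk' (fun i => p.ap (op (s i.unop))) (fun i j => p.nat (op (s i.unop)) (op (s j.unop)))

lemma VSmall.exists_reps_op (V : Type u) [Category.{v} V] [MonoidalCategory V]
    [SymmetricCategory V] [MonoidalClosed V] [HasLimits V] (K : Type w)
    [EnrichedCategory V K] [VSmall V K] :
    ∃ (σ : Type v) (s : σ → K), ∀ c : Kᵒᵖ, ∃ (i : σ) (f : 𝟙_ V ⟶ Hom⟪c, op (s i)⟫)
      (g : 𝟙_ V ⟶ Hom⟪op (s i), c⟫), preC f g = eId V c ∧ preC g f = eId V (op (s i)) := by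
  obtain ⟨σ, s, hs⟩ := VSmall.exists_reps V K
  refine ⟨σ, s, fun c => ?_⟩
  obtain ⟨i, f, g, h1, h2⟩ := hs c.unop
  exact ⟨i, g, f, (preC_op f g).trans ((preC_eq_postC f g).symm.trans h1),
    (preC_op g f).trans ((preC_eq_postC g f).symm.trans h2)⟩

/-- Graded families are determined by, and extend uniquely from, their values on representatives.
Hence restriction `ρ` is an isomorphism of ends, and the two comparison morphisms differ by it. This
matters because `Cocontinuous` only tests index categories in `Type v`. -/
lemma isWeightedColimit_restr_iff [VSmall V K] {σ : Type v} {s : σ → K}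
    (hs : ∀ c : Kᵒᵖ, ∃ (i : σ) (f : 𝟙_ V ⟶ Hom⟪c, op (s i)⟫)
      (g : 𝟙_ V ⟶ Hom⟪op (s i), c⟫), preC f g = eId V c ∧ preC g f = eId V (op (s i)))
    {φ : EnrichedFunctor V Kᵒᵖ V} {S : EnrichedFunctor V K 𝒜} {c : 𝒜}
    (μ : VNat φ ((nerve S).obj c)) :
    IsWeightedColimit (restrOp s φ) (restr s S) (restrFam s μ) ↔ IsWeightedColimit φ S μ := by
  refine forall_congr' fun a => ?_
  let ρ : natObj φ ((nerve S).obj a) ⟶ natObj (restrOp s φ) ((nerve (restr s S)).obj a) :=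
    natLift (restrFam s (natFam φ ((nerve S).obj a)))
  have hρ : ∀ {A : V} (f : A ⟶ natObj φ ((nerve S).obj a)) (i : (Induced s)ᵒᵖ),
      (f ≫ ρ) ≫ natπ _ _ i = f ≫ natπ _ _ (op (s i.unop)) := by
    intro A f i
    rw [Category.assoc, natLift_π]
    rfl
  have : IsIso ρ := by
    apply isIso_of_yoneda_map_bijective
    intro A
    constructor
    · intro f f' h
      have key : (natFam φ ((nerve S).obj a)).reindex f =
          (natFam φ ((nerve S).obj a)).reindex f' := by
        apply GNat.ext_of_reps _ hs
        intro i
        have h1 := hρ f (op (α := Induced s) i)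
        have h2 := hρ f' (op (α := Induced s) i)
        exact h1.symm.trans ((congrArg (fun t => t ≫ natπ _ _ (op (α := Induced s) i)) h).trans h2)
      apply natObj_ext
      intro z
      exact congrArg (fun t => GNat.ap t z) key
    · intro g
      obtain ⟨q, hq⟩ := GNat.exists_of_reps (F := φ) (G := (nerve S).obj a) (fun i => op (s i)) hs
        (fun i : Induced s => g ≫ natπ (restrOp s φ) ((nerve (restr s S)).obj a) (op i))
        (fun i j : Induced s => ((natFam _ _).reindex g).nat (op i) (op j))
      refine ⟨natLift q, ?_⟩
      apply natObj_ext
      intro i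
      refine (hρ (natLift q) i).trans ?_
      rw [natLift_π]
      exact hq i.unop
  have e : colimitComparison (restrOp s φ) (restr s S) (restrFam s μ) a =
      colimitComparison φ S μ a ≫ ρ := by
    apply natObj_ext
    intro i
    refine (colimitComparison_π _ _ _ _ _).trans ?_
    exact ((hρ _ i).trans (colimitComparison_π _ _ _ _ _)).symm
  rw [e]
  exact isIso_comp_right_iff _ _

/-- Cocontinuous `V`-functors preserve weighted colimits indexed by essentially small
`V`-categories. -/
lemma Cocontinuous.isWeightedColimit {ℬ : Type w₂} [EnrichedCategory V ℬ]
    {F : EnrichedFunctor V 𝒜 ℬ} (hF : Cocontinuous F) [VSmall V K] {φ : EnrichedFunctor V Kᵒᵖ V}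
    {S : EnrichedFunctor V K 𝒜} {c : 𝒜} {μ : VNat φ ((nerve S).obj c)}
    (h : IsWeightedColimit φ S μ) :
    IsWeightedColimit φ (S.comp V F) (c := F.obj c) (VNat.comp μ (nerveMap F S c)) := by
  obtain ⟨σ, s, hs⟩ := VSmall.exists_reps_op V K
  exact (isWeightedColimit_restr_iff hs _).1
    (hF (Induced s) (restrOp s φ) (restr s S) c (restrFam s μ)
      ((isWeightedColimit_restr_iff hs μ).2 h))

end Restriction

/-! ### `V`-natural isomorphisms described by their components. -/

section RightAdjoint

variable {V : Type u} [Category.{v} V] [MonoidalCategory V] [SymmetricCategory V]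
  [MonoidalClosed V]
variable {C : Type w} [EnrichedCategory V C]

lemma uncurry_postC {X Y Z A : V} (f : A ⟶ Hom⟪X, Y⟫) (m : Y ⟶ Z) :
    MonoidalClosed.uncurry (postC (Z := Z) f (MonoidalClosed.curry' m)) =
      MonoidalClosed.uncurry (A := X) (X := Y) f ≫ m := by
  rw [postC]
  refine (MonoidalClosed.uncurry_natural_left _ _).trans ?_
  refine (congrArg (fun t => _ ≫ t) (uncurry_ecmp _ _)).trans ?_
  rw [uncurry_curry']
  simp

lemma curry'_id (X : V) : MonoidalClosed.curry' (𝟙 X) = eId V X := by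
  rw [MonoidalClosed.curry', Category.comp_id]
  rfl

lemma preC_curry' {X Y Z : V} (f : X ⟶ Y) (g : Y ⟶ Z) :
    preC (X := X) (Y := Y) (Z := Z) (MonoidalClosed.curry' f) (MonoidalClosed.curry' g) =
      MonoidalClosed.curry' (f ≫ g) := by
  rw [preC_eq_postC]
  apply MonoidalClosed.uncurry_injective
  refine (uncurry_postC _ _).trans ?_
  rw [uncurry_curry', uncurry_curry', Category.assoc]

/-- A `V`-natural isomorphism between `V`-valued `V`-functors, from its components. -/
noncomputable def VNatIso.ofHom {F G : EnrichedFunctor V C V} (f : ∀ X, F.obj X ⟶ G.obj X)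
    [∀ X, IsIso (f X)] (hf : ∀ X Y, act F X Y ≫ f Y = f X ▷ _ ≫ act G X Y) : VNatIso F G where
  hom := VNat.ofHom f hf
  inv := VNat.ofHom (fun X => CategoryTheory.inv (f X)) (fun X Y => by
    rw [IsIso.comp_inv_eq, Category.assoc, hf, ← comp_whiskerRight_assoc, IsIso.inv_hom_id,
      id_whiskerRight, Category.id_comp])
  hom_inv_id X := by
    refine (preC_curry' (f X) (CategoryTheory.inv (f X))).trans ?_
    rw [IsIso.hom_inv_id]
    exact curry'_id _
  inv_hom_id X := by
    refine (preC_curry' (CategoryTheory.inv (f X)) (f X)).trans ?_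
    rw [IsIso.inv_hom_id]
    exact curry'_id _

end RightAdjoint

end Isbell

namespace Isbell

/-! ### Functors with an objectwise right adjoint are cocontinuous. -/

section RightAdjoint

variable {V : Type u} [Category.{v} V] [MonoidalCategory V] [SymmetricCategory V]
  [MonoidalClosed V] [HasLimits V]

lemma VNatIso.preC_natLift {C : Type w} [EnrichedCategory V C] [VSmall V C] {D : Type w₁}
    [EnrichedCategory V D] {F G : EnrichedFunctor V C D} (α : VNatIso F G) :
    preC (X := F) (Y := G) (Z := F) (natLift α.hom) (natLift α.inv) = eId V F := by
  apply functorHom_ext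
  intro X
  refine (preC_π _ _ _).trans ?_
  rw [natLift_π, natLift_π, α.hom_inv_id, eId_π]

/-- The inverse of a `V`-natural isomorphism. -/
def VNatIso.symm {C : Type w} [EnrichedCategory V C] {D : Type w₁}
    [EnrichedCategory V D] {F G : EnrichedFunctor V C D} (α : VNatIso F G) : VNatIso G F :=
  ⟨α.inv, α.hom, α.inv_hom_id, α.hom_inv_id⟩

lemma postC_isIso {𝒜 : Type w} [EnrichedCategory V 𝒜] {X Y Z : 𝒜} {f : 𝟙_ V ⟶ Hom⟪Y, Z⟫}
    {g : 𝟙_ V ⟶ Hom⟪Z, Y⟫} (h₁ : preC f g = eId V Y) (h₂ : preC g f = eId V Z) :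
    IsIso (postC (𝟙 (Hom⟪X, Y⟫ : V)) f) := by
  refine ⟨postC (𝟙 (Hom⟪X, Z⟫ : V)) g, ?_, ?_⟩
  · rw [comp_postC, Category.comp_id, postC_postC, h₁, postC_eId]
  · rw [comp_postC, Category.comp_id, postC_postC, h₂, postC_eId]

variable {𝒜 : Type w₁} [EnrichedCategory V 𝒜] {ℬ : Type w₂} [EnrichedCategory V ℬ]

/-- The morphism `𝒜(X, g) ⟶ ℬ(F X, v)` induced by `e : F g ⟶ v`. -/
def transposeHom (F : EnrichedFunctor V 𝒜 ℬ) {g : 𝒜} {v : ℬ} (e : 𝟙_ V ⟶ Hom⟪F.obj g, v⟫) (X : 𝒜) :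
    (Hom⟪X, g⟫ : V) ⟶ Hom⟪F.obj X, v⟫ :=
  postC (F.map X g) e

/-- Naturality of the transposition in its left argument; it follows from functoriality of `F`
alone. -/
lemma eComp_transposeHom (F : EnrichedFunctor V 𝒜 ℬ) {g : 𝒜} {v : ℬ}
    (e : 𝟙_ V ⟶ Hom⟪F.obj g, v⟫) (X Y : 𝒜) :
    eComp V X Y g ≫ transposeHom F e X = ecmp (F.map X Y) (transposeHom F e Y) := by
  rw [transposeHom, comp_postC, F.map_comp, transposeHom, ecmp_postC]

lemma transposeHom_nat (F : EnrichedFunctor V 𝒜 ℬ) {g : 𝒜} {v : ℬ}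
    (e : 𝟙_ V ⟶ Hom⟪F.obj g, v⟫) (X Y : 𝒜) {A : V} (f : A ⟶ Hom⟪X, Y⟫) :
    ((Hom⟪Y, g⟫ : V) ◁ f ≫ (β_ _ _).hom ≫ eComp V X Y g) ≫ transposeHom F e X =
      transposeHom F e Y ▷ A ≫ (Hom⟪F.obj Y, v⟫ : V) ◁ (f ≫ F.map X Y) ≫ (β_ _ _).hom ≫
        eComp V (F.obj X) (F.obj Y) v := by
  rw [Category.assoc, Category.assoc, eComp_transposeHom, ecmp, MonoidalCategory.tensorHom_def]
  simp [whisker_exchange_assoc]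

/-- A `V`-functor with an objectwise right adjoint is cocontinuous. -/
theorem cocontinuous_of_transposeHom_isIso (F : EnrichedFunctor V 𝒜 ℬ)
    (h : ∀ v : ℬ, ∃ (g : 𝒜) (e : 𝟙_ V ⟶ Hom⟪F.obj g, v⟫), ∀ X, IsIso (transposeHom F e X)) :
    Cocontinuous F := by
  intro K _ φ S c μ hμ v
  obtain ⟨g, e, he⟩ := h v
  have he' : ∀ X : Kᵒᵖ, IsIso (transposeHom F e (S.obj X.unop)) := fun X => he _
  -- Transposition along `S`: `𝒜(S -, g) ≅ ℬ(F S -, v)`.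
  let α : VNatIso ((nerve S).obj g) ((nerve (S.comp V F)).obj v) :=
    @VNatIso.ofHom V _ _ _ _ _ _ ((nerve S).obj g) ((nerve (S.comp V F)).obj v)
      (fun X => transposeHom F e (S.obj X.unop)) he' (fun X Y => by
        rw [act_nerve, act_nerve]
        exact transposeHom_nat F e (S.obj Y.unop) (S.obj X.unop) (S.map Y.unop X.unop))
  have := hμ g
  have hα := postC_isIso (X := φ) α.preC_natLift α.symm.preC_natLift
  -- The comparison for `F S` at `v` is the comparison for `S` at `g`, up to transposition on both
  -- ends; the other three sides of this square are invertible.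
  have key : colimitComparison φ S μ g ≫ postC (𝟙 _) (natLift α.hom) = transposeHom F e c ≫
      colimitComparison φ (S.comp V F) (VNat.comp μ (nerveMap F S c)) v := by
    apply functorHom_ext
    intro z
    rw [comp_postC, Category.comp_id]
    refine (postC_π _ _ _).trans ?_
    rw [natLift_π, Category.assoc]
    refine Eq.trans ?_ (congrArg (fun t => _ ≫ t) (colimitComparison_π φ (S.comp V F) _ v z)).symm
    refine (congrArg (fun t => postC t _) (colimitComparison_π φ S μ g z)).trans ?_
    refine Eq.trans ?_ (comp_preC _ _ _).symm
    have h1 : (VNat.comp μ (nerveMap F S c)).ap z = preC (μ.ap z) ((nerveMap F S c).ap z) := rfl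
    rw [h1]
    refine (preC_postC _ _ _).symm.trans (Eq.trans ?_ (preC_preC _ _ _))
    refine congrArg (preC (μ.ap z)) ?_
    apply MonoidalClosed.uncurry_injective
    refine (uncurry_postC _ _).trans ?_
    refine Eq.trans ?_ (uncurry_preC _ _).symm
    refine (congrArg (fun t => t ≫ transposeHom F e (S.obj z.unop))
      (MonoidalClosed.uncurry_curry (eComp V (S.obj z.unop) c g))).trans ?_
    rw [eComp_transposeHom]
    refine Eq.trans ?_ (congrArg (fun t => _ ≫ t) (MonoidalClosed.uncurry_natural_left _ _)).symm
    refine Eq.trans ?_ (congrArg (fun t => _ ≫ _ ≫ t) (MonoidalClosed.uncurry_curry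
      (eComp V (F.obj (S.obj z.unop)) (F.obj c) v))).symm
    refine Eq.trans ?_ (congrArg (fun t => t ▷ _ ≫ _)
      (MonoidalClosed.uncurry'_curry' (F.map (S.obj z.unop) c))).symm
    rw [ecmp, MonoidalCategory.tensorHom_def, Category.assoc]
    rfl
  have h2 : IsIso (transposeHom F e c ≫
      colimitComparison φ (S.comp V F) (VNat.comp μ (nerveMap F S c)) v) := by
    rw [← key]
    infer_instance
  exact IsIso.of_isIso_comp_left (transposeHom F e c) _

end RightAdjoint

end Isbell

namespace Isbell

/-! ### `HomIsCoend` makes `ψ` a small projective. -/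

section SmallProjective

variable {V : Type u} [Category.{v} V] [MonoidalCategory V] [SymmetricCategory V]
  [MonoidalClosed V] [HasLimits V]
variable {C : Type w} [EnrichedCategory V C]

variable (V C) in
/-- The identification `C ⟶ Cᵒᵖᵒᵖ`. -/
def opOp : EnrichedFunctor V C Cᵒᵖᵒᵖ where
  obj X := op (op X)
  map X Y := 𝟙 (Hom⟪X, Y⟫ : V)
  map_id X := Category.comp_id _
  map_comp X Y Z := by
    refine (Category.comp_id _).trans ?_
    refine Eq.trans ?_ (congrArg (fun t => t ≫ eComp V (op (op X)) (op (op Y)) (op (op Z)))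
      (id_tensorHom_id _ _)).symm
    refine Eq.trans ?_ (Category.id_comp _).symm
    exact (SymmetricCategory.symmetry_assoc _ _ _).symm

variable [VSmall V C]

/-- The `V`-functor `[φ -, v]`. -/
noncomputable def homInto (φ : EnrichedFunctor V Cᵒᵖ V) (v : V) : EnrichedFunctor V C V :=
  (opOp V C).comp V ((nerve φ).obj v)

/-- Evaluation `[φ c, v] ⊗ φ c ⟶ v`. -/
noncomputable def homIntoEv (φ : EnrichedFunctor V Cᵒᵖ V) (v : V) (c : C) :
    (homInto φ v).obj c ⊗ φ.obj (op c) ⟶ v :=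
  (β_ ((ihom (φ.obj (op c))).obj v) (φ.obj (op c))).hom ≫ MonoidalClosed.uncurry (𝟙 _)

lemma curry_braiding_ev {X A v : V} (q : A ⊗ X ⟶ v) :
    MonoidalClosed.curry ((β_ X A).hom ≫ q) ▷ X ≫ (β_ _ _).hom ≫ MonoidalClosed.uncurry (𝟙 _) =
      q := by
  rw [braiding_naturality_left_assoc, ← MonoidalClosed.uncurry_natural_left, Category.comp_id,
    MonoidalClosed.uncurry_curry, SymmetricCategory.symmetry_assoc]

lemma homIntoEv_ext {φ : EnrichedFunctor V Cᵒᵖ V} {v : V} {c : C} {A : V}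
    {f g : A ⟶ (homInto φ v).obj c}
    (h : f ▷ φ.obj (op c) ≫ homIntoEv φ v c = g ▷ φ.obj (op c) ≫ homIntoEv φ v c) : f = g := by
  have key : ∀ f : A ⟶ (ihom (φ.obj (op c))).obj v,
      f ▷ φ.obj (op c) ≫ (β_ ((ihom (φ.obj (op c))).obj v) (φ.obj (op c))).hom ≫
        MonoidalClosed.uncurry (𝟙 _) = (β_ _ _).hom ≫ MonoidalClosed.uncurry f := by
    intro f
    rw [braiding_naturality_left_assoc, ← MonoidalClosed.uncurry_natural_left, Category.comp_id]
  have h' := (key f).symm.trans (h.trans (key g))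
  rw [cancel_epi] at h'
  exact MonoidalClosed.uncurry_injective h'

lemma exists_homIntoEv {φ : EnrichedFunctor V Cᵒᵖ V} {v : V} {c : C} {A : V}
    (q : A ⊗ φ.obj (op c) ⟶ v) :
    ∃ f : A ⟶ (homInto φ v).obj c, f ▷ φ.obj (op c) ≫ homIntoEv φ v c = q := by
  exact ⟨(MonoidalClosed.curry ((β_ (φ.obj (op c)) A).hom ≫ q) :
    A ⟶ (ihom (φ.obj (op c))).obj v), curry_braiding_ev q⟩

/-- The action of `C` on `[φ -, v]` is precomposition with its action on `φ`, and evaluation is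
dinatural. -/
lemma isCowedge_homIntoEv (φ : EnrichedFunctor V Cᵒᵖ V) (v : V) :
    IsCowedge φ (homInto φ v) (homIntoEv φ v) := by
  intro i j
  have h1 : act (homInto φ v) i j = (β_ ((ihom (φ.obj (op i))).obj v) (Hom⟪i, j⟫ : V)).hom ≫
      (φ.map (op j) (op i) ⊗ₘ 𝟙 ((ihom (φ.obj (op i))).obj v)) ≫
        MonoidalClosed.comp (φ.obj (op j)) (φ.obj (op i)) v := by
    refine (congrArg MonoidalClosed.uncurry (Category.id_comp _)).trans ?_
    refine (act_nerve φ v (op (op i)) (op (op j))).trans ?_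
    refine (braiding_naturality_right_assoc _ _ _).trans ?_
    rw [← tensorHom_id]
    rfl
  have h2 := uncurry_comp (X := φ.obj (op j)) (Y := φ.obj (op i)) (Z := v)
    (φ.map (op j) (op i)) (𝟙 ((ihom (φ.obj (op i))).obj v))
  have h3 := MonoidalClosed.uncurry_natural_left ((φ.map (op j) (op i) ⊗ₘ
    𝟙 ((ihom (φ.obj (op i))).obj v)) ≫ MonoidalClosed.comp (φ.obj (op j)) (φ.obj (op i)) v) (𝟙 _)
  rw [Category.comp_id] at h3
  rw [h1]
  exact braided_comp_aux (h3.symm.trans h2)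

variable {φ : EnrichedFunctor V Cᵒᵖ V} {ψ : EnrichedFunctor V C V} {P : Pairing φ ψ}

/-- `[ψ, -]` has a right adjoint, sending `v` to `[φ -, v]`: morphisms `A ⊗ [ψ, X] ⟶ v` are cowedges
`A ⊗ X c ⊗ φ c ⟶ v` by the coend property, hence natural families `A ⊗ X c ⟶ [φ c, v]`. -/
lemma Pairing.HomIsCoend.isSmallProjective (h : P.HomIsCoend) : IsSmallProjective V ψ := by
  refine cocontinuous_of_transposeHom_isIso _ fun v => ?_
  -- The counit of this adjunction, induced by the evaluations `[φ c, v] ⊗ φ c ⟶ v`.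
  obtain ⟨e, he, -⟩ := (h (homInto φ v)).existsUnique_desc _ (isCowedge_homIntoEv φ v)
  refine ⟨homInto φ v, MonoidalClosed.curry' e, fun X => ?_⟩
  have key : ∀ {A : V} (f : A ⟶ (Hom⟪X, homInto φ v⟫ : V)),
      MonoidalClosed.uncurry (A := (Hom⟪ψ, X⟫ : V)) (X := v)
        (f ≫ transposeHom (homFunctor V ψ) (MonoidalClosed.curry' e) X) =
      (β_ _ _).hom ≫ f ▷ (Hom⟪ψ, X⟫ : V) ≫ pcomp ψ X (homInto φ v) ≫ e := by
    intro A f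
    refine (MonoidalClosed.uncurry_natural_left _ _).trans ?_
    refine (congrArg (fun t => _ ≫ t) (uncurry_postC _ _)).trans ?_
    refine (congrArg (fun t => _ ≫ t ≫ e) (MonoidalClosed.uncurry_curry _)).trans ?_
    rw [pcomp, Category.assoc, ← braiding_naturality_right_assoc,
      SymmetricCategory.symmetry_assoc]
  -- On the coprojections, the transpose of `f` is the cowedge given by the components of `f`; this
  -- is `k_pcomp`.
  have key₂ : ∀ {A : V} (f : A ⟶ (Hom⟪X, homInto φ v⟫ : V)) (c : C),
      A ◁ P.k X c ≫ f ▷ (Hom⟪ψ, X⟫ : V) ≫ pcomp ψ X (homInto φ v) ≫ e =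
        (α_ _ _ _).inv ≫ (f ▷ X.obj c ≫ hev X (homInto φ v) c) ▷ φ.obj (op c) ≫
          homIntoEv φ v c := by
    intro A f c
    rw [whisker_exchange_assoc, ← Category.assoc ((Hom⟪X, homInto φ v⟫ : V) ◁ P.k X c),
      P.k_pcomp, ← he c]
    simp
  apply isIso_of_yoneda_map_bijective
  intro A
  constructor
  · intro f g hfg
    have h1 : f ▷ (Hom⟪ψ, X⟫ : V) ≫ pcomp ψ X (homInto φ v) ≫ e =
        g ▷ (Hom⟪ψ, X⟫ : V) ≫ pcomp ψ X (homInto φ v) ≫ e := by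
      rw [← cancel_epi (β_ (Hom⟪ψ, X⟫ : V) A).hom, ← key, ← key]
      exact congrArg MonoidalClosed.uncurry hfg
    apply hev_ext
    intro c
    apply homIntoEv_ext
    rw [← cancel_epi (α_ _ _ _).inv, ← key₂, ← key₂, h1]
  · intro q
    let q' : A ⊗ (Hom⟪ψ, X⟫ : V) ⟶ v :=
      (β_ _ _).hom ≫ MonoidalClosed.uncurry (A := (Hom⟪ψ, X⟫ : V)) (X := v) q
    choose t ht using fun c => exists_homIntoEv (φ := φ) (v := v) (c := c) (A := A ⊗ X.obj c)
      ((α_ _ _ _).hom ≫ A ◁ P.k X c ≫ q')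
    -- Naturality of the transposed family `t` is the cowedge law of `k`, seen after evaluation.
    have hnat : ∀ i j, A ◁ act X i j ≫ t j =
        (α_ _ _ _).inv ≫ t i ▷ Hom⟪i, j⟫ ≫ act (homInto φ v) i j := by
      intro i j
      apply homIntoEv_ext
      simp only [comp_whiskerRight, Category.assoc, ht]
      rw [isCowedge_homIntoEv φ v i j, associator_naturality_middle_assoc,
        ← MonoidalCategory.whiskerLeft_comp_assoc, P.isCowedge_k X i j,
        associator_naturality_left_assoc, ← whisker_exchange_assoc, ht]
      simp only [MonoidalCategory.whiskerLeft_comp, Category.assoc]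
      monoidal
    have hq : hlift t hnat ▷ (Hom⟪ψ, X⟫ : V) ≫ pcomp ψ X (homInto φ v) ≫ e = q' := by
      apply (h X).hom_ext_left
      intro c
      rw [key₂, hlift_hev, ht, Iso.inv_hom_id_assoc]
    refine ⟨hlift t hnat, ?_⟩
    apply MonoidalClosed.uncurry_injective
    refine (key _).trans ((congrArg (fun t => _ ≫ t) hq).trans ?_)
    exact SymmetricCategory.symmetry_assoc _ _ _

end SmallProjective

end Isbell

namespace Isbell

/-! ### The Yoneda isomorphism and the duals of `ψ` in planar form. -/

section Yoneda

variable {V : Type u} [Category.{v} V] [MonoidalCategory V] [SymmetricCategory V]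
  [MonoidalClosed V] [HasLimits V]
variable {C : Type w} [EnrichedCategory V C] [VSmall V C]

/-- Evaluation `[C, V](C(c, -), G) ⊗ C(c, x) ⟶ G x`. -/
noncomputable def hevRep (G : EnrichedFunctor V C V) (c x : C) :
    (Hom⟪homFunctor V c, G⟫ : V) ⊗ (Hom⟪c, x⟫ : V) ⟶ G.obj x := hev (homFunctor V c) G x

lemma hevRep_ext {G : EnrichedFunctor V C V} {c : C} {A : V}
    {f g : A ⟶ (Hom⟪homFunctor V c, G⟫ : V)}
    (h : ∀ x, f ▷ (Hom⟪c, x⟫ : V) ≫ hevRep G c x = g ▷ (Hom⟪c, x⟫ : V) ≫ hevRep G c x) : f = g :=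
  hev_ext h

lemma hevRep_act (G : EnrichedFunctor V C V) (c x y : C) :
    (Hom⟪homFunctor V c, G⟫ : V) ◁ eComp V c x y ≫ hevRep G c y =
      (α_ _ _ _).inv ≫ hevRep G c x ▷ Hom⟪x, y⟫ ≫ act G x y := by
  rw [← act_homFunctor]
  exact hev_act (homFunctor V c) G x y

lemma pcomp_hevRep (G H : EnrichedFunctor V C V) (c x : C) :
    pcomp (homFunctor V c) G H ▷ (Hom⟪c, x⟫ : V) ≫ hevRep H c x =
      (α_ _ _ _).hom ≫ (Hom⟪G, H⟫ : V) ◁ hevRep G c x ≫ hev G H x :=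
  pcomp_hev (homFunctor V c) G H x

/-- Evaluation `[C, V](C(c', -), C(c, -)) ⊗ C(c', x) ⟶ C(c, x)`. -/
noncomputable def hevRepHom (c c' x : C) :
    (Hom⟪homFunctor V c', homFunctor V c⟫ : V) ⊗ (Hom⟪c', x⟫ : V) ⟶ (Hom⟪c, x⟫ : V) :=
  hev (homFunctor V c') (homFunctor V c) x

lemma pcomp_hevRepHom (G : EnrichedFunctor V C V) (c c' x : C) :
    pcomp (homFunctor V c') (homFunctor V c) G ▷ (Hom⟪c', x⟫ : V) ≫ hevRep G c' x =
      (α_ _ _ _).hom ≫ (Hom⟪homFunctor V c, G⟫ : V) ◁ hevRepHom c c' x ≫ hevRep G c x :=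
  pcomp_hev (homFunctor V c') (homFunctor V c) G x

lemma pcomp_hevHom_hevRepHom (F : EnrichedFunctor V C V) (c c' x : C) :
    pcomp F (homFunctor V c') (homFunctor V c) ▷ F.obj x ≫ hevHom F c x =
      (α_ _ _ _).hom ≫ (Hom⟪homFunctor V c', homFunctor V c⟫ : V) ◁ hevHom F c' x ≫
        hevRepHom c c' x :=
  pcomp_hev F (homFunctor V c') (homFunctor V c) x

/-- The action `C(c, c') ⟶ [C, V](C(c', -), C(c, -))` of the Yoneda embedding. -/
noncomputable def yonMap (c c' : C) :
    (Hom⟪c, c'⟫ : V) ⟶ (Hom⟪homFunctor V c', homFunctor V c⟫ : V) :=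
  (coyonedaEmb V C).map (op c') (op c)

lemma yonMap_hevRepHom (c c' x : C) :
    yonMap c c' ▷ (Hom⟪c', x⟫ : V) ≫ hevRepHom c c' x = eComp V c c' x := by
  refine (comp_hev (F := homFunctor V c') (G := homFunctor V c) (yonMap c c') x).trans ?_
  refine (congrArg (fun t => _ ≫ MonoidalClosed.uncurry t) (natLift_π (coyFam c' c) x)).trans ?_
  refine (congrArg (fun t => _ ≫ t) (MonoidalClosed.uncurry_curry _)).trans ?_
  exact SymmetricCategory.symmetry_assoc _ _ _

/-- The Yoneda morphism `G c ⟶ [C, V](C(c, -), G)`. -/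
noncomputable def yo (G : EnrichedFunctor V C V) (c : C) :
    G.obj c ⟶ (Hom⟪homFunctor V c, G⟫ : V) :=
  hlift (F := homFunctor V c) (fun x => act G c x) (fun x y => by
    rw [act_homFunctor]
    exact act_comp G c x y)

lemma yo_hevRep (G : EnrichedFunctor V C V) (c x : C) :
    yo G c ▷ (Hom⟪c, x⟫ : V) ≫ hevRep G c x = act G c x := hlift_hev (F := homFunctor V c) _ _ _

/-- Evaluation at the identity. -/
noncomputable def yoInv (G : EnrichedFunctor V C V) (c : C) :
    (Hom⟪homFunctor V c, G⟫ : V) ⟶ G.obj c :=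
  (ρ_ _).inv ≫ (Hom⟪homFunctor V c, G⟫ : V) ◁ eId V c ≫ hevRep G c c

lemma yo_yoInv (G : EnrichedFunctor V C V) (c : C) : yo G c ≫ yoInv G c = 𝟙 _ := by
  rw [yoInv, rightUnitor_inv_naturality_assoc, ← whisker_exchange_assoc, yo_hevRep, act_id,
    Iso.inv_hom_id]

/-- A family out of `C(c, -)` is determined by its value at the identity of `c`: naturality,
followed by the left unit law in `C`. -/
lemma yoInv_yo (G : EnrichedFunctor V C V) (c : C) : yoInv G c ≫ yo G c = 𝟙 _ := by
  apply hevRep_ext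
  intro x
  have h1 := e_id_comp V c x
  have h2 := congrArg (fun t => (Hom⟪homFunctor V c, G⟫ : V) ◁ t ≫ hevRep G c x) h1
  simp only [MonoidalCategory.whiskerLeft_comp, Category.assoc, hevRep_act,
    MonoidalCategory.whiskerLeft_id, Category.id_comp] at h2
  rw [comp_whiskerRight, Category.assoc, yo_hevRep, yoInv, id_whiskerRight, Category.id_comp]
  refine Eq.trans ?_ h2
  simp only [comp_whiskerRight, Category.assoc]
  monoidal

instance (G : EnrichedFunctor V C V) (c : C) : IsIso (yo G c) :=
  ⟨yoInv G c, yo_yoInv G c, yoInv_yo G c⟩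

/-- The Yoneda isomorphism is natural in the object, with `C` acting on `[C(i, -), G]` through the
Yoneda embedding. -/
lemma act_yo (G : EnrichedFunctor V C V) (i j : C) :
    act G i j ≫ yo G j = yo G i ▷ (Hom⟪i, j⟫ : V) ≫ (Hom⟪homFunctor V i, G⟫ : V) ◁ yonMap i j ≫
      pcomp (homFunctor V j) (homFunctor V i) G := by
  apply hevRep_ext
  intro x
  simp only [comp_whiskerRight, Category.assoc, pcomp_hevRepHom, yo_hevRep]
  rw [associator_naturality_middle_assoc, ← MonoidalCategory.whiskerLeft_comp_assoc,
    yonMap_hevRepHom, associator_naturality_left_assoc, ← whisker_exchange_assoc, yo_hevRep,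
    act_comp, Iso.hom_inv_id_assoc]

lemma act_nerve_coyonedaEmb (X : EnrichedFunctor V C V) (i j : Cᵒᵖᵒᵖ) :
    act ((nerve (coyonedaEmb V C)).obj X) i j =
      (Hom⟪homFunctor V i.unop.unop, X⟫ : V) ◁ yonMap i.unop.unop j.unop.unop ≫
        pcomp (homFunctor V j.unop.unop) (homFunctor V i.unop.unop) X :=
  act_nerve (coyonedaEmb V C) X i j

/-- Transposed naturality in the first variable: it makes `θ` a `V`-natural transformation from `φ`
to the dual of `ψ`. -/
lemma Pairing.act_θ {φ : EnrichedFunctor V Cᵒᵖ V} {ψ : EnrichedFunctor V C V} (P : Pairing φ ψ)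
    (i j : C) : lact φ i j ≫ P.θ i = (Hom⟪i, j⟫ : V) ◁ P.θ j ≫ yonMap i j ▷ _ ≫
      pcomp ψ (homFunctor V j) (homFunctor V i) := by
  apply hevHom_ext
  intro x
  simp only [comp_whiskerRight, Category.assoc, pcomp_hevHom_hevRepHom, θ_hevHom]
  rw [associator_naturality_left_assoc, ← whisker_exchange_assoc,
    associator_naturality_middle_assoc, ← MonoidalCategory.whiskerLeft_comp_assoc, θ_hevHom,
    yonMap_hevRepHom, P.naturality_left]

lemma act_comp_homFunctor (ψ : EnrichedFunctor V C V) (i j : Cᵒᵖ) :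
    act ((coyonedaEmb V C).comp V (homFunctor V ψ)) i j =
      (Hom⟪ψ, homFunctor V i.unop⟫ : V) ◁ yonMap j.unop i.unop ≫
        eComp V ψ (homFunctor V i.unop) (homFunctor V j.unop) := by
  refine (MonoidalClosed.uncurry_natural_left _ _).trans ?_
  exact congrArg (fun t => _ ≫ t) (MonoidalClosed.uncurry_curry _)

lemma lact_comp_homFunctor (ψ : EnrichedFunctor V C V) (i j : C) :
    lact ((coyonedaEmb V C).comp V (homFunctor V ψ)) i j =
      yonMap i j ▷ _ ≫ pcomp ψ (homFunctor V j) (homFunctor V i) := by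
  refine (congrArg (fun t => _ ≫ t) (act_comp_homFunctor ψ (op j) (op i))).trans ?_
  rw [pcomp, braiding_naturality_left_assoc]
  rfl

end Yoneda

end Isbell

namespace Isbell

/-! ### Density of representables, and its preservation by a small projective. -/

section Density

variable {V : Type u} [Category.{v} V] [MonoidalCategory V] [SymmetricCategory V]
  [MonoidalClosed V] [HasLimits V]
variable {C : Type w} [EnrichedCategory V C] [VSmall V C]

/-- Naturality of the Yoneda isomorphism in the functor argument. -/
lemma yo_pcomp (X Z : EnrichedFunctor V C V) (c : C) :
    (Hom⟪X, Z⟫ : V) ◁ yo X c ≫ pcomp (homFunctor V c) X Z = hev X Z c ≫ yo Z c := by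
  apply hevRep_ext
  intro x
  simp only [comp_whiskerRight, Category.assoc, pcomp_hevRep, yo_hevRep]
  rw [associator_naturality_middle_assoc, ← MonoidalCategory.whiskerLeft_comp_assoc, yo_hevRep,
    hev_act, Iso.hom_inv_id_assoc]

/-- The weight `z ↦ [C, V](C(z, -), X)`. -/
noncomputable abbrev repWeight (X : EnrichedFunctor V C V) : EnrichedFunctor V Cᵒᵖᵒᵖ V :=
  (nerve (coyonedaEmb V C)).obj X

/-- Evaluation `[repWeight X, repWeight Z] ⊗ [C(c, -), X] ⟶ [C(c, -), Z]`. -/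
noncomputable def hevWeight (X Z : EnrichedFunctor V C V) (c : C) :
    (Hom⟪repWeight X, repWeight Z⟫ : V) ⊗ (Hom⟪homFunctor V c, X⟫ : V) ⟶
      (Hom⟪homFunctor V c, Z⟫ : V) :=
  hev (repWeight X) (repWeight Z) (op (op c))

lemma hevWeight_ext {X Z : EnrichedFunctor V C V} {A : V}
    {f g : A ⟶ (Hom⟪repWeight X, repWeight Z⟫ : V)}
    (h : ∀ c : C, f ▷ (Hom⟪homFunctor V c, X⟫ : V) ≫ hevWeight X Z c =
      g ▷ (Hom⟪homFunctor V c, X⟫ : V) ≫ hevWeight X Z c) : f = g :=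
  hev_ext (fun c => h c.unop.unop)

/-- The action on `[C(-, -), X]`. -/
noncomputable def repAct (X : EnrichedFunctor V C V) (i j : C) :
    (Hom⟪homFunctor V i, X⟫ : V) ⊗ (Hom⟪i, j⟫ : V) ⟶ (Hom⟪homFunctor V j, X⟫ : V) :=
  (Hom⟪homFunctor V i, X⟫ : V) ◁ yonMap i j ≫ pcomp (homFunctor V j) (homFunctor V i) X

lemma act_comp_yo (X : EnrichedFunctor V C V) (i j : C) :
    act X i j ≫ yo X j = yo X i ▷ (Hom⟪i, j⟫ : V) ≫ repAct X i j := act_yo X i j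

lemma hevWeight_act (X Z : EnrichedFunctor V C V) (i j : C) :
    (Hom⟪repWeight X, repWeight Z⟫ : V) ◁ repAct X i j ≫ hevWeight X Z j =
      (α_ _ _ _).inv ≫ hevWeight X Z i ▷ (Hom⟪i, j⟫ : V) ≫ repAct Z i j := by
  have h := hev_act (repWeight X) (repWeight Z) (op (op i)) (op (op j))
  have e : ∀ Y : EnrichedFunctor V C V, act (repWeight Y) (op (op i)) (op (op j)) =
      repAct Y i j := fun Y =>
    act_nerve_coyonedaEmb Y (op (op i)) (op (op j))
  rw [e, e] at h
  exact h

/-- The comparison morphism of the density of representables. -/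
noncomputable def densityComparison (X Z : EnrichedFunctor V C V) :
    (Hom⟪X, Z⟫ : V) ⟶ (Hom⟪repWeight X, repWeight Z⟫ : V) :=
  colimitComparison (repWeight X) (coyonedaEmb V C) (GNat.idFam (repWeight X)) Z

lemma densityComparison_hevWeight (X Z : EnrichedFunctor V C V) (c : C) :
    densityComparison X Z ▷ (Hom⟪homFunctor V c, X⟫ : V) ≫ hevWeight X Z c =
      pcomp (homFunctor V c) X Z := by
  refine (comp_hev (F := repWeight X) (G := repWeight Z) (densityComparison X Z)
    (op (op c))).trans ?_
  refine (congrArg (fun t => _ ≫ MonoidalClosed.uncurry t) (colimitComparison_π (repWeight X)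
    (coyonedaEmb V C) (GNat.idFam (repWeight X)) Z (op (op c)))).trans ?_
  refine (congrArg (fun t => _ ≫ MonoidalClosed.uncurry t) (eId_preC _)).trans ?_
  exact congrArg (fun t => _ ≫ t) (MonoidalClosed.uncurry_curry _)

/-- The Yoneda isomorphisms `X c ≅ [C(c, -), X]` are compatible with the actions, so graded families
between the weights of `X` and `Z` are exactly graded families from `X` to `Z`. -/
instance (X Z : EnrichedFunctor V C V) : IsIso (densityComparison X Z) := by
  apply isIso_of_yoneda_map_bijective
  intro A
  have key : ∀ (f : A ⟶ (Hom⟪X, Z⟫ : V)) (c : C),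
      A ◁ yo X c ≫ (f ≫ densityComparison X Z) ▷ (Hom⟪homFunctor V c, X⟫ : V) ≫ hevWeight X Z c =
        (f ▷ X.obj c ≫ hev X Z c) ≫ yo Z c := by
    intro f c
    rw [comp_whiskerRight, Category.assoc, densityComparison_hevWeight, whisker_exchange_assoc,
      yo_pcomp, Category.assoc]
  constructor
  · intro f f' h
    have h' : f ≫ densityComparison X Z = f' ≫ densityComparison X Z := h
    apply hev_ext
    intro c
    rw [← cancel_mono (yo Z c), ← key, ← key, h']
  · intro g
    -- Kept opaque, with its type written through hom-objects rather than values of `repWeight`.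
    obtain ⟨q, hg⟩ : ∃ q : ∀ c : C, A ⊗ (Hom⟪homFunctor V c, X⟫ : V) ⟶
        (Hom⟪homFunctor V c, Z⟫ : V), ∀ c, q c = g ▷ _ ≫ hevWeight X Z c := ⟨_, fun _ => rfl⟩
    have hq : ∀ i j : C, A ◁ repAct X i j ≫ q j =
        (α_ _ _ _).inv ≫ q i ▷ (Hom⟪i, j⟫ : V) ≫ repAct Z i j := by
      intro i j
      simp only [hg, comp_whiskerRight, Category.assoc]
      rw [whisker_exchange_assoc, hevWeight_act, associator_inv_naturality_left_assoc]
    let t : ∀ c : C, A ⊗ X.obj c ⟶ Z.obj c := fun c => A ◁ yo X c ≫ q c ≫ yoInv Z c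
    have ht' : ∀ c, t c ≫ yo Z c = A ◁ yo X c ≫ q c := by
      intro c
      simp only [t, Category.assoc, yoInv_yo, Category.comp_id]
    have ht : ∀ i j, A ◁ act X i j ≫ t j = (α_ _ _ _).inv ≫ t i ▷ Hom⟪i, j⟫ ≫ act Z i j := by
      intro i j
      rw [← cancel_mono (yo Z j)]
      simp only [Category.assoc, ht', act_comp_yo]
      rw [← MonoidalCategory.whiskerLeft_comp_assoc, act_comp_yo,
        MonoidalCategory.whiskerLeft_comp_assoc, hq, ← comp_whiskerRight_assoc, ht',
        associator_inv_naturality_middle_assoc, comp_whiskerRight_assoc]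
    refine ⟨hlift t ht, ?_⟩
    apply hevWeight_ext
    intro c
    rw [← cancel_epi (A ◁ yo X c)]
    refine (key _ c).trans ?_
    rw [hlift_hev, ht', hg]

/-- Representables are dense: `X` is the colimit of the representables, weighted by
`[C(-, -), X]`. -/
theorem isWeightedColimit_repWeight (X : EnrichedFunctor V C V) :
    IsWeightedColimit (repWeight X) (coyonedaEmb V C) (GNat.idFam (repWeight X)) :=
  fun Z => inferInstanceAs (IsIso (densityComparison X Z))

/-- The invertible morphism `u i ▷ C(i, j) ⊗ w j` carries one cowedge equation to the other. -/
lemma IsCowedge.congr_iff {φ φ' : EnrichedFunctor V Cᵒᵖ V} {X X' : EnrichedFunctor V C V} {a : V}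
    {p : ∀ c, X.obj c ⊗ φ.obj (op c) ⟶ a} (u : ∀ c, X'.obj c ⟶ X.obj c) [∀ c, IsIso (u c)]
    (w : ∀ c : C, φ'.obj (op c) ⟶ φ.obj (op c)) [∀ c, IsIso (w c)]
    (hu : ∀ i j, act X' i j ≫ u j = u i ▷ _ ≫ act X i j)
    (hw : ∀ i j, lact φ' i j ≫ w i = (Hom⟪i, j⟫ : V) ◁ w j ≫ lact φ i j) :
    IsCowedge φ' X' (fun c => (u c ⊗ₘ w c) ≫ p c) ↔ IsCowedge φ X p := by
  refine forall_congr' fun i => forall_congr' fun j => ?_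
  have h1 : act X' i j ▷ φ'.obj (op j) ≫ (u j ⊗ₘ w j) ≫ p j =
      ((u i ▷ (Hom⟪i, j⟫ : V)) ⊗ₘ w j) ≫ act X i j ▷ φ.obj (op j) ≫ p j := by
    rw [← tensorHom_id (act X' i j), ← tensorHom_id (act X i j), tensorHom_comp_tensorHom_assoc,
      tensorHom_comp_tensorHom_assoc, hu, Category.id_comp, Category.comp_id]
  have h2 : (α_ _ _ _).hom ≫ X'.obj i ◁ lact φ' i j ≫ (u i ⊗ₘ w i) ≫ p i =
      ((u i ▷ (Hom⟪i, j⟫ : V)) ⊗ₘ w j) ≫ (α_ _ _ _).hom ≫ X.obj i ◁ lact φ i j ≫ p i := by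
    rw [← tensorHom_id (u i), associator_naturality_assoc, ← id_tensorHom, ← id_tensorHom,
      tensorHom_comp_tensorHom_assoc, tensorHom_comp_tensorHom_assoc, hw, Category.id_comp,
      Category.comp_id, id_tensorHom]
  rw [h1, h2, cancel_epi]

lemma IsCoend.congr {φ φ' : EnrichedFunctor V Cᵒᵖ V} {X X' : EnrichedFunctor V C V} {H : V}
    {ι : ∀ c, X.obj c ⊗ φ.obj (op c) ⟶ H} (h : IsCoend φ X ι)
    (u : ∀ c, X'.obj c ⟶ X.obj c) [∀ c, IsIso (u c)]
    (w : ∀ c : C, φ'.obj (op c) ⟶ φ.obj (op c)) [∀ c, IsIso (w c)]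
    (hu : ∀ i j, act X' i j ≫ u j = u i ▷ _ ≫ act X i j)
    (hw : ∀ i j, lact φ' i j ≫ w i = (Hom⟪i, j⟫ : V) ◁ w j ≫ lact φ i j) :
    IsCoend φ' X' (fun c => (u c ⊗ₘ w c) ≫ ι c) where
  cowedge := (IsCowedge.congr_iff u w hu hw).2 h.cowedge
  existsUnique_desc {a} p hp := by
    have e : p = fun c => (u c ⊗ₘ w c) ≫ inv (u c ⊗ₘ w c) ≫ p c := by
      funext c
      rw [IsIso.hom_inv_id_assoc]
    rw [e] at hp
    obtain ⟨f, hf, hf'⟩ := h.existsUnique_desc _ ((IsCowedge.congr_iff u w hu hw).1 hp)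
    refine ⟨f, fun c => ?_, fun g hg => hf' g fun c => ?_⟩
    · rw [Category.assoc, hf, IsIso.hom_inv_id_assoc]
    · rw [IsIso.eq_inv_comp, ← hg, Category.assoc]

lemma IsCoend.of_eq {φ : EnrichedFunctor V Cᵒᵖ V} {X : EnrichedFunctor V C V} {H : V}
    {ι ι' : ∀ c, X.obj c ⊗ φ.obj (op c) ⟶ H} (h : IsCoend φ X ι) (e : ∀ c, ι' c = ι c) :
    IsCoend φ X ι' := by
  rwa [funext e]

lemma IsCoend.of_onOp {φ : EnrichedFunctor V Cᵒᵖ V} {X : EnrichedFunctor V C V} {H : V}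
    {ι : ∀ c, X.obj c ⊗ φ.obj (op c) ⟶ H}
    (h : IsCoend (Isbell.onOp X) φ (fun c => (β_ (φ.obj c) (X.obj c.unop)).hom ≫ ι c.unop)) :
    IsCoend φ X ι where
  cowedge := IsCowedge.onOp_iff.1 h.cowedge
  existsUnique_desc {a} p hp := by
    obtain ⟨f, hf, hf'⟩ := h.existsUnique_desc _ (IsCowedge.onOp_iff.2 hp)
    have e : ∀ g : H ⟶ a, (∀ c : Cᵒᵖ, ((β_ (φ.obj c) (X.obj c.unop)).hom ≫ ι c.unop) ≫ g =
        (β_ _ _).hom ≫ p c.unop) ↔ ∀ c, ι c ≫ g = p c := by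
      intro g
      simp only [Category.assoc, cancel_epi]
      exact ⟨fun h c => h (op c), fun h c => h c.unop⟩
    exact ⟨f, (e f).1 hf, fun g hg => hf' g ((e g).2 hg)⟩

lemma braided_nat_iff {F F' H H' B : V} {a : F ⊗ B ⟶ F'} {t : F ⟶ H} {t' : F' ⟶ H'}
    {m : H ⊗ B ⟶ H'} : ((β_ B F).hom ≫ a) ≫ t' = B ◁ t ≫ (β_ B H).hom ≫ m ↔
      a ≫ t' = t ▷ B ≫ m := by
  rw [braiding_naturality_right_assoc, Category.assoc, cancel_epi]

lemma braiding_tensorHom_braiding {X Y X' Y' H : V} (f : X ⟶ X') (g : Y ⟶ Y') (h : Y' ⊗ X' ⟶ H) :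
    (β_ Y X).hom ≫ (f ⊗ₘ g) ≫ (β_ X' Y').hom ≫ h = (g ⊗ₘ f) ≫ h := by
  rw [braiding_naturality_assoc, SymmetricCategory.symmetry_assoc]

lemma coproj_ofHom {φ : EnrichedFunctor V Cᵒᵖ V} {X : EnrichedFunctor V C V} {H : V}
    (μ : VNat φ ((nerve X).obj H)) (c : C) (m : φ.obj (op c) ⟶ (ihom (X.obj c)).obj H)
    (h : μ.ap (op c) = MonoidalClosed.curry' m) : coproj μ c = MonoidalClosed.uncurry m := by
  rw [coproj, h]
  exact congrArg MonoidalClosed.uncurry (MonoidalClosed.uncurry'_curry' m)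

namespace Pairing

variable {φ : EnrichedFunctor V Cᵒᵖ V} {ψ : EnrichedFunctor V C V} (P : Pairing φ ψ)

/-- Composition `[C(c, -), X] ⊗ [ψ, C(c, -)] ⟶ [ψ, X]` gives the coprojections of the preserved
density colimit; this identifies them with `k`. -/
lemma k_eq (X : EnrichedFunctor V C V) (c : C) :
    P.k X c = (yo X c ⊗ₘ P.θ c) ≫ pcomp ψ (homFunctor V c) X := by
  apply hev_ext
  intro x
  rw [k_hev, comp_whiskerRight, Category.assoc, pcomp_hev]
  have h := P.θ_hevHom c x
  have h1 : (yo X c ⊗ₘ P.θ c) ▷ ψ.obj x ≫ (α_ _ _ _).hom ≫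
      (Hom⟪homFunctor V c, X⟫ : V) ◁ hevHom ψ c x ≫ hevRep X c x =
      (α_ _ _ _).hom ≫ X.obj c ◁ P.pair c x ≫ act X c x := by
    rw [← tensorHom_id, associator_naturality_assoc, ← id_tensorHom,
      tensorHom_comp_tensorHom_assoc, tensorHom_id, h, Category.comp_id,
      MonoidalCategory.tensorHom_def', Category.assoc, yo_hevRep]
  exact h1.symm

lemma act_comp_θ (i j : Cᵒᵖ) : act φ i j ≫ P.θ j.unop =
    P.θ i.unop ▷ _ ≫ act ((coyonedaEmb V C).comp V (homFunctor V ψ)) i j := by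
  refine braided_nat_iff.1 ((P.act_θ j.unop i.unop).trans ?_)
  exact congrArg (fun t => _ ≫ t) (lact_comp_homFunctor ψ j.unop i.unop).symm

/-- A small projective `ψ` paired with its dual satisfies `[C, V](ψ, X) ≅ ∫^c X c ⊗ φ c`. -/
theorem homIsCoend_of_isSmallProjective (hψ : IsSmallProjective V ψ) [∀ b, IsIso (P.θ b)] :
    P.HomIsCoend := by
  intro X
  -- Preservation of the density colimit of `X` by `[ψ, -]`, as a coend over `Cᵒᵖ` with composition
  -- as coprojections.
  have h : IsCoend (repWeight X) ((coyonedaEmb V C).comp V (homFunctor V ψ)) (H := (Hom⟪ψ, X⟫ : V))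
      (fun c => eComp V ψ (homFunctor V c.unop) X) := by
    refine (Cocontinuous.isWeightedColimit hψ (isWeightedColimit_repWeight X)).isCoend.of_eq
      fun c => ?_
    have e : (VNat.comp (GNat.idFam (repWeight X)) (nerveMap (homFunctor V ψ) (coyonedaEmb V C)
        X)).ap (op c) = MonoidalClosed.curry' ((homFunctor V ψ).map (homFunctor V c.unop) X) :=
      eId_preC (V := V) (C := V) (X := (Hom⟪homFunctor V c.unop, X⟫ : V))
        (Y := (Hom⟪(Hom⟪ψ, homFunctor V c.unop⟫ : V), (Hom⟪ψ, X⟫ : V)⟫ : V)) _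
    refine Eq.trans ?_ (coproj_ofHom _ c _ e).symm
    exact (act_homFunctor ψ (homFunctor V c.unop) X).symm
  have hθ : ∀ c : Cᵒᵖ, IsIso (P.θ c.unop) := fun c => inferInstance
  have hy : ∀ c : Cᵒᵖ, IsIso (yo X c.unop) := fun c => inferInstance
  -- Replace `[ψ, C(c, -)]` by `φ c` along `θ` and `[C(c, -), X]` by `X c` along Yoneda; the coend
  -- is then moved from `Cᵒᵖ` back to `C`.
  have h' := @IsCoend.congr V _ _ _ _ _ Cᵒᵖ _ _ _ (Isbell.onOp X) _ φ _ _ h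
    (fun c => P.θ c.unop) hθ (fun c => yo X c.unop) hy (fun i j => P.act_comp_θ i j)
    (fun i j => by
      refine (congrArg (fun t => t ≫ yo X i.unop) (lact_onOp X i j)).trans ?_
      refine Eq.trans ?_ (congrArg (fun t => _ ≫ _ ≫ t)
        (act_nerve_coyonedaEmb X (op j) (op i))).symm
      exact braided_nat_iff.2 (act_comp_yo X j.unop i.unop))
  refine (h'.of_eq fun c => ?_).of_onOp
  rw [k_eq]
  exact braiding_tensorHom_braiding _ _ _

end Pairing

end Density

end Isbell

namespace Isbell

/-! ### The duals `R ψ` and `L φ`, their evaluation pairings, and `[ψ, -] ≅ φ * -`. -/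

section Duals

variable {V : Type u} [Category.{v} V] [MonoidalCategory V] [SymmetricCategory V]
  [MonoidalClosed V] [HasLimits V]
variable {C : Type w} [EnrichedCategory V C] [VSmall V C]

/-- The dual `b ↦ [C, V](ψ, C(b, -))` of `ψ : C ⟶ V`. -/
noncomputable abbrev rdual (ψ : EnrichedFunctor V C V) : EnrichedFunctor V Cᵒᵖ V :=
  (coyonedaEmb V C).comp V (homFunctor V ψ)

/-- The dual `c ↦ [Cᵒᵖ, V](φ, C(-, c))` of `φ : Cᵒᵖ ⟶ V`. -/
noncomputable abbrev ldual (φ : EnrichedFunctor V Cᵒᵖ V) : EnrichedFunctor V C V :=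
  (yonedaEmb V C).comp V (homFunctor V φ)

lemma coyFam_op (c c' : C) : coyFam (V := V) (op c) (op c') = yonFam c c' := by
  apply GNat.ext'
  intro z
  apply MonoidalClosed.uncurry_injective
  refine (MonoidalClosed.uncurry_curry _).trans (Eq.trans ?_ (MonoidalClosed.uncurry_curry _).symm)
  exact SymmetricCategory.symmetry_assoc _ _ _

/-- `Y` over `C` is `Y'` over `Cᵒᵖ`, since the double braiding is trivial. So facts about `rdual`
over `Cᵒᵖ` serve for `ldual`. -/
lemma act_ldual (φ : EnrichedFunctor V Cᵒᵖ V) (c c' : C) :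
    act (ldual φ) c c' = act (rdual φ) (op (op c)) (op (op c')) :=
  congrArg (fun t => MonoidalClosed.uncurry (natLift t ≫ (homFunctor V φ).map
    (homFunctor V (op c)) (homFunctor V (op c')))) (coyFam_op c c').symm

lemma lact_rdual_hevHom (ψ : EnrichedFunctor V C V) (b' b c : C) :
    lact (rdual ψ) b' b ▷ ψ.obj c ≫ hevHom ψ b' c =
      (α_ _ _ _).hom ≫ (Hom⟪b', b⟫ : V) ◁ hevHom ψ b c ≫ eComp V b' b c := by
  refine (congrArg (fun t => t ▷ ψ.obj c ≫ hevHom ψ b' c) (lact_comp_homFunctor ψ b' b)).trans ?_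
  change (yonMap b' b ▷ (Hom⟪ψ, homFunctor V b⟫ : V) ≫ pcomp ψ (homFunctor V b)
    (homFunctor V b')) ▷ ψ.obj c ≫ hevHom ψ b' c = _
  rw [comp_whiskerRight, Category.assoc, pcomp_hevHom_hevRepHom, associator_naturality_left_assoc,
    ← whisker_exchange_assoc, yonMap_hevRepHom]

/-- The evaluation pairing of `ψ` with its dual. -/
noncomputable def evalPairing (ψ : EnrichedFunctor V C V) : Pairing (rdual ψ) ψ where
  pair b c := hevHom ψ b c
  naturality_right b c c' := hevHom_act ψ b c c'
  naturality_left b' b c := lact_rdual_hevHom ψ b' b c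

/-- Evaluation is the transpose of the identity. Hence the invertibility of `θ` needed for the
density argument is automatic here. -/
lemma evalPairing_θ (ψ : EnrichedFunctor V C V) (b : C) : (evalPairing ψ).θ b = 𝟙 _ := by
  apply hevHom_ext
  intro x
  refine ((evalPairing ψ).θ_hevHom b x).trans ?_
  exact ((congrArg (fun t => t ≫ hevHom ψ b x) (id_whiskerRight _ _)).trans
    (Category.id_comp _)).symm

/-- The evaluation pairing of `φ` with its dual. -/
noncomputable def opEvalPairing (φ : EnrichedFunctor V Cᵒᵖ V) : Pairing φ (ldual φ) where
  pair b c := (β_ (φ.obj (op b)) (Hom⟪φ, homFunctor V (op c)⟫ : V)).hom ≫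
    hevHom φ (op c) (op b)
  naturality_right b c c' := by
    rw [act_ldual]
    refine (swap_aux₁ (lact_rdual_hevHom φ (op c') (op c) (op b))).trans ?_
    exact congrArg (fun t => _ ≫ _ ≫ t) (SymmetricCategory.symmetry_assoc _ _ _)
  naturality_left b' b c := by
    refine (swap_aux₂ (hevHom_act φ (op c) (op b) (op b'))).trans ?_
    exact congrArg (fun t => _ ≫ _ ≫ t) (SymmetricCategory.symmetry_assoc _ _ _)

lemma opEvalPairing_swap_θ (φ : EnrichedFunctor V Cᵒᵖ V) (c : Cᵒᵖ) :
    (opEvalPairing φ).swap.θ c = 𝟙 _ := by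
  apply hevHom_ext
  intro x
  refine ((opEvalPairing φ).swap.θ_hevHom c x).trans ?_
  refine (SymmetricCategory.symmetry_assoc _ _ _).trans ?_
  exact ((congrArg (fun t => t ≫ hevHom φ c x) (id_whiskerRight _ _)).trans
    (Category.id_comp _)).symm

namespace Pairing

variable {φ : EnrichedFunctor V Cᵒᵖ V} {ψ : EnrichedFunctor V C V} (P : Pairing φ ψ)

/-- The isomorphism of `φ` with the dual of `ψ`. -/
noncomputable def isoRdual [∀ b, IsIso (P.θ b)] : VNatIso φ (rdual ψ) :=
  @VNatIso.ofHom V _ _ _ _ _ _ φ (rdual ψ) (fun b => P.θ b.unop)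
    (fun b => (inferInstance : IsIso (P.θ b.unop))) (fun i j => P.act_comp_θ i j)

lemma act_comp_swap_θ (i j : C) : act ψ i j ≫ P.swap.θ (op j) =
    P.swap.θ (op i) ▷ (Hom⟪i, j⟫ : V) ≫ act (ldual φ) i j := by
  rw [act_ldual]
  refine Eq.trans ?_ (P.swap.act_comp_θ (op (op i)) (op (op j)))
  exact congrArg (fun t => t ≫ P.swap.θ (op j)) (act_onOp ψ (op (op i)) (op (op j))).symm

/-- The isomorphism of `ψ` with the dual of `φ`. -/
noncomputable def isoLdual [h : ∀ c, IsIso (P.swap.θ c)] : VNatIso ψ (ldual φ) :=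
  @VNatIso.ofHom V _ _ _ _ _ _ ψ (ldual φ) (fun c => P.swap.θ (op c))
    (fun c => h (op c)) (fun i j => P.act_comp_swap_θ i j)

variable [HasColimits V]

variable {P} in
-- The coend condition is not visibly symmetric, but the triangle identities are; so pass to the
-- unit, exchange, and come back.
lemma HomIsCoend.swap (h : P.HomIsCoend) : P.swap.HomIsCoend := by
  obtain ⟨η, hη⟩ := h.exists_isCounit (isCoend_wcolim φ ψ)
  exact .of_isCounit (isCoend_wcolim φ ψ).onOp (P.isCounit_swap_iff.2 hη)

variable {P} in
lemma HomIsCoend.of_swap (h : P.swap.HomIsCoend) : P.HomIsCoend := by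
  obtain ⟨η, hη⟩ := h.exists_isCounit (isCoend_wcolim φ ψ).onOp
  exact .of_isCounit (isCoend_wcolim φ ψ) (P.isCounit_swap_iff.1 hη)

variable {P} in
lemma HomIsCoend.nonempty_moduleAdjunction (h : P.HomIsCoend) : Nonempty (ModuleAdjunction φ ψ) :=
  let ⟨_, hη⟩ := h.exists_isCounit (isCoend_wcolim φ ψ)
  ⟨hη.moduleAdjunction⟩

end Pairing

variable [HasColimits V]

lemma ModuleAdjunction.homIsCoend {φ : EnrichedFunctor V Cᵒᵖ V} {ψ : EnrichedFunctor V C V}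
    (M : ModuleAdjunction φ ψ) : M.pairing.HomIsCoend :=
  .of_isCounit (isCoend_wcolim φ ψ) M.isCounit

lemma homIsCoend_evalPairing {ψ : EnrichedFunctor V C V} (h : IsSmallProjective V ψ) :
    (evalPairing ψ).HomIsCoend := by
  have : ∀ b, IsIso ((evalPairing ψ).θ b) := fun b => by
    rw [evalPairing_θ]
    exact inferInstanceAs (IsIso (𝟙 (Hom⟪ψ, homFunctor V b⟫ : V)))
  exact Pairing.homIsCoend_of_isSmallProjective _ h

/-- The density argument applies to `φ` as a covariant functor on `Cᵒᵖ`, that is, to the exchanged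
pairing. -/
lemma homIsCoend_opEvalPairing {φ : EnrichedFunctor V Cᵒᵖ V} (h : IsSmallProjective V φ) :
    (opEvalPairing φ).HomIsCoend := by
  have : ∀ c, IsIso ((opEvalPairing φ).swap.θ c) := fun c => by
    rw [opEvalPairing_swap_θ]
    exact inferInstanceAs (IsIso (𝟙 (Hom⟪φ, homFunctor V c⟫ : V)))
  exact (Pairing.homIsCoend_of_isSmallProjective (opEvalPairing φ).swap h).of_swap

/-- The action of the `V`-functor `φ * -`. -/
noncomputable def wcolimAct (φ : EnrichedFunctor V Cᵒᵖ V) (X Y : EnrichedFunctor V C V) :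
    wcolim φ X ⊗ (Hom⟪X, Y⟫ : V) ⟶ wcolim φ Y :=
  MonoidalClosed.uncurry (wcolimMap φ X Y)

lemma uncurry_uncurry_preC {X Y a b A : V} (μ : 𝟙_ V ⟶ (ihom Y).obj ((ihom X).obj a))
    (f : A ⟶ (ihom a).obj b) :
    MonoidalClosed.uncurry (MonoidalClosed.uncurry (preC (X := Y) (Y := (ihom X).obj a)
      (Z := (ihom X).obj b) μ (f ≫ (homFunctor V X).map a b))) =
      (α_ _ _ _).inv ≫ MonoidalClosed.uncurry (MonoidalClosed.uncurry' μ) ▷ A ≫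
        MonoidalClosed.uncurry f := by
  refine (congrArg MonoidalClosed.uncurry (uncurry_preC _ _)).trans ?_
  have h3 : MonoidalClosed.uncurry (f ≫ (homFunctor V X).map a b) = _ ◁ f ≫ eComp V X a b :=
    (MonoidalClosed.uncurry_natural_left _ _).trans
      (congrArg (fun t => _ ≫ t) (MonoidalClosed.uncurry_curry _))
  refine (congrArg (fun t => MonoidalClosed.uncurry (_ ≫ t)) h3).trans ?_
  refine Eq.trans ?_ (uncurry_ecmp (MonoidalClosed.uncurry' μ) f)
  congr 1
  rw [ecmp, MonoidalCategory.tensorHom_def, Category.assoc]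
  rfl

lemma whisker_braiding_tensorHom {A A' Y Y' H : V} (m : Y ⟶ Y') (f : A ⟶ A') (k : A' ⊗ Y' ⟶ H) :
    m ▷ A ≫ Y' ◁ f ≫ (β_ _ _).hom ≫ k = (β_ _ _).hom ≫ (f ⊗ₘ m) ≫ k := by
  rw [braiding_naturality_right_assoc, braiding_naturality_left_assoc,
    MonoidalCategory.tensorHom_def', Category.assoc]

/-- Puts `k_pcomp`, where `[X, Y]` stands on the left, in the form with `[X, Y]` on the right, as in
`eComp` and `act`. -/
lemma whisker_braiding_aux {X F W H W' Y : V} {k : X ⊗ F ⟶ W} {e : W ⊗ H ⟶ W'} {q : H ⊗ X ⟶ Y}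
    {k' : Y ⊗ F ⟶ W'} (h : H ◁ k ≫ (β_ H W).hom ≫ e = (α_ _ _ _).inv ≫ q ▷ F ≫ k') :
    X ◁ (β_ F H).hom ≫ (α_ _ _ _).inv ≫ ((β_ X H).hom ≫ q) ▷ F ≫ k' =
      (α_ _ _ _).inv ≫ k ▷ H ≫ e := by
  rw [braiding_naturality_right_assoc] at h
  rw [← cancel_epi (α_ X F H).hom, Iso.hom_inv_id_assoc, ← cancel_epi (β_ H (X ⊗ F)).hom, h,
    braiding_tensor_right_hom]
  simp only [Category.assoc, Iso.inv_hom_id_assoc, comp_whiskerRight]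
  rw [← MonoidalCategory.whiskerLeft_comp_assoc, SymmetricCategory.symmetry,
    MonoidalCategory.whiskerLeft_id, Category.id_comp, Iso.hom_inv_id_assoc,
    ← comp_whiskerRight_assoc, SymmetricCategory.symmetry, id_whiskerRight, Category.id_comp]

lemma uncurry_uncurry_preC_op {X Z Y a A : V} (μ : 𝟙_ V ⟶ (ihom Y).obj ((ihom Z).obj a))
    (f : A ⟶ (ihom X).obj Z) :
    MonoidalClosed.uncurry (MonoidalClosed.uncurry (preC (X := Y) (Y := (ihom Z).obj a)
      (Z := (ihom X).obj a) μ (f ≫ (homFunctor V (op a)).map (op Z) (op X)))) =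
      X ◁ (β_ Y A).hom ≫ (α_ _ _ _).inv ≫ MonoidalClosed.uncurry f ▷ Y ≫
        MonoidalClosed.uncurry (MonoidalClosed.uncurry' μ) := by
  refine (congrArg MonoidalClosed.uncurry (uncurry_preC _ _)).trans ?_
  have h3 : MonoidalClosed.uncurry (f ≫ (homFunctor V (op a)).map (op Z) (op X)) =
      _ ◁ f ≫ (β_ _ _).hom ≫ eComp V X Z a :=
    (MonoidalClosed.uncurry_natural_left _ _).trans
      (congrArg (fun t => _ ≫ t) (MonoidalClosed.uncurry_curry _))
  refine (congrArg (fun t => MonoidalClosed.uncurry (_ ≫ t)) h3).trans ?_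
  refine Eq.trans ?_ (congrArg (fun t => _ ≫ t) (uncurry_ecmp f (MonoidalClosed.uncurry' μ)))
  refine Eq.trans ?_ (MonoidalClosed.uncurry_natural_left _ _)
  congr 1
  exact whisker_braiding_tensorHom _ _ _

/-- The double transpose of `wcolimMap_spec`: on the coprojection at `c`, the functor `φ * -` acts
by evaluation at `c`. -/
lemma coproj_wcolimAct (φ : EnrichedFunctor V Cᵒᵖ V) (X Y : EnrichedFunctor V C V)
    (c : C) : (α_ _ _ _).inv ≫ coproj (wcolimUnit φ X) c ▷ (Hom⟪X, Y⟫ : V) ≫ wcolimAct φ X Y =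
      X.obj c ◁ (β_ (φ.obj (op c)) (Hom⟪X, Y⟫ : V)).hom ≫ (α_ _ _ _).inv ≫
        ((β_ (X.obj c) (Hom⟪X, Y⟫ : V)).hom ≫ hev X Y c) ▷ φ.obj (op c) ≫
          coproj (wcolimUnit φ Y) c := by
  have h := congrArg (fun t => MonoidalClosed.uncurry (A := X.obj c) (X := wcolim φ Y)
    (MonoidalClosed.uncurry (A := φ.obj (op c)) (X := (ihom (X.obj c)).obj (wcolim φ Y)) t))
    (wcolimMap_spec φ X Y (op c))
  have h0 : ncov X (op c) (wcolim φ X) (wcolim φ Y) =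
      (homFunctor V (X.obj c)).map (wcolim φ X) (wcolim φ Y) := natLift_π _ _
  rw [h0] at h
  have e := uncurry_uncurry_preC_op (X := X.obj c) (Z := Y.obj c) ((wcolimUnit φ Y).ap (op c))
    (natπ X Y c)
  rw [hev, SymmetricCategory.symmetry_assoc]
  exact (uncurry_uncurry_preC (X := X.obj c) _ _).symm.trans (h.trans e)

/-- The weighted colimit of representables, as a `V`-natural isomorphism
`[C, V](ψ, -) ≅ φ * -`. -/
theorem Pairing.HomIsCoend.nonempty_vnatIso {φ : EnrichedFunctor V Cᵒᵖ V}
    {ψ : EnrichedFunctor V C V} {P : Pairing φ ψ} (h : P.HomIsCoend) :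
    Nonempty (VNatIso (homFunctor V ψ) (wcolimFunctor φ)) := by
  -- `φ * X` and `[ψ, X]` are coends of the same functors, so the induced `f` and `g` are mutually
  -- inverse.
  choose f hf hf' using fun X => (isCoend_wcolim φ X).existsUnique_desc _ (P.isCowedge_k X)
  choose g hg hg' using fun X => (h X).existsUnique_desc _ (isCoend_wcolim φ X).cowedge
  have hfi : ∀ X, IsIso (f X) := fun X => by
    refine ⟨g X, (isCoend_wcolim φ X).hom_ext fun c => ?_, (h X).hom_ext fun c => ?_⟩
    · rw [← Category.assoc, hf, hg, Category.comp_id]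
    · rw [← Category.assoc, hg, hf, Category.comp_id]
  -- Naturality is checked in the direction out of the colimit, where coprojections detect equality,
  -- and reduces to `k_pcomp`.
  refine ⟨(@VNatIso.ofHom V _ _ _ _ _ _ (wcolimFunctor φ) (homFunctor V ψ) f hfi
    fun X Y => ?_).symm⟩
  rw [act_homFunctor]
  change wcolimAct φ X Y ≫ f Y = f X ▷ (Hom⟪X, Y⟫ : V) ≫ eComp V ψ X Y
  apply (isCoend_wcolim φ X).hom_ext_right
  intro c
  rw [← cancel_epi (α_ _ _ _).inv]
  have e := coproj_wcolimAct φ X Y c =≫ f Y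
  simp only [Category.assoc, hf] at e
  rw [e, ← comp_whiskerRight_assoc, hf]
  exact whisker_braiding_aux (P.k_pcomp X Y c)

end Duals

end Isbell

namespace Isbell

/-! ### Exchanging the last two of three tensor factors. -/

section Bilinear

variable {V : Type u} [Category.{v} V] [MonoidalCategory V] [SymmetricCategory V]

/-- The symmetry `(A ⊗ S) ⊗ F ⟶ (A ⊗ F) ⊗ S`. -/
def swapRight (A S F : V) : (A ⊗ S) ⊗ F ⟶ (A ⊗ F) ⊗ S :=
  (α_ _ _ _).hom ≫ A ◁ (β_ S F).hom ≫ (α_ _ _ _).inv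

lemma swapRight_swapRight_assoc (A S F : V) {Z : V} (h : (A ⊗ S) ⊗ F ⟶ Z) :
    swapRight A S F ≫ swapRight A F S ≫ h = h := by
  simp only [swapRight, Category.assoc, Iso.inv_hom_id_assoc]
  rw [← MonoidalCategory.whiskerLeft_comp_assoc, SymmetricCategory.symmetry,
    MonoidalCategory.whiskerLeft_id, Category.id_comp, Iso.hom_inv_id_assoc]

lemma swapRight_naturality_assoc {A A' : V} (f : A ⟶ A') (S F : V) {Z : V}
    (h : (A' ⊗ F) ⊗ S ⟶ Z) :
    f ▷ S ▷ F ≫ swapRight A' S F ≫ h = swapRight A S F ≫ f ▷ F ▷ S ≫ h := by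
  simp only [swapRight, Category.assoc]
  rw [associator_naturality_left_assoc, ← whisker_exchange_assoc,
    associator_inv_naturality_left_assoc]

lemma swapRight_naturality_middle_assoc (A : V) {S S' : V} (f : S ⟶ S') (F : V) {Z : V}
    (h : (A ⊗ F) ⊗ S' ⟶ Z) :
    (A ◁ f) ▷ F ≫ swapRight A S' F ≫ h = swapRight A S F ≫ (A ⊗ F) ◁ f ≫ h := by
  simp only [swapRight, Category.assoc]
  rw [associator_naturality_middle_assoc, ← MonoidalCategory.whiskerLeft_comp_assoc,
    braiding_naturality_left, MonoidalCategory.whiskerLeft_comp_assoc,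
    associator_inv_naturality_right_assoc]

lemma swapRight_tensor (A S H F : V) : swapRight A (S ⊗ H) F ≫ (α_ _ _ _).inv =
    (α_ _ _ _).inv ▷ F ≫ (β_ (A ⊗ S) H).hom ▷ F ≫ (α_ _ _ _).hom ≫ H ◁ swapRight A S F ≫
      (β_ H _).hom := by
  rw [braiding_naturality_right, braiding_tensor_right_hom H (A ⊗ S) F, swapRight,
    braiding_tensor_left_hom]
  simp only [Category.assoc, Iso.hom_inv_id_assoc]
  rw [← comp_whiskerRight_assoc (β_ (A ⊗ S) H).hom, SymmetricCategory.symmetry]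
  simp only [swapRight]
  monoidal

/-- Naturality of a bilinear family in its last variable corresponds, after the exchange, to
naturality in the middle variable over `Cᵒᵖ`. The primed version is the other case. -/
lemma swapRight_iff {A F S S' H K K' : V} {q : (A ⊗ F) ⊗ S ⟶ K} {q' : (A ⊗ F) ⊗ S' ⟶ K'}
    {a : S ⊗ H ⟶ S'} {m : K ⊗ H ⟶ K'} :
    (A ◁ a) ▷ F ≫ swapRight A S' F ≫ q' = (α_ _ _ _).inv ▷ F ≫ (β_ (A ⊗ S) H).hom ▷ F ≫
      (α_ _ _ _).hom ≫ H ◁ (swapRight A S F ≫ q) ≫ (β_ _ _).hom ≫ m ↔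
    (A ⊗ F) ◁ a ≫ q' = (α_ _ _ _).inv ≫ q ▷ H ≫ m := by
  have e := swapRight_tensor A S H F =≫ (q ▷ H ≫ m)
  have : (α_ _ _ _).inv ▷ F ≫ (β_ (A ⊗ S) H).hom ▷ F ≫ (α_ _ _ _).hom ≫
      H ◁ (swapRight A S F ≫ q) ≫ (β_ _ _).hom ≫ m =
      swapRight A (S ⊗ H) F ≫ (α_ _ _ _).inv ≫ q ▷ H ≫ m := by
    rw [MonoidalCategory.whiskerLeft_comp, Category.assoc, braiding_naturality_right_assoc]
    simpa only [Category.assoc] using e.symm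
  rw [this, swapRight_naturality_middle_assoc]
  constructor
  · intro h
    have := swapRight A F (S ⊗ H) ≫= h
    rwa [swapRight_swapRight_assoc, swapRight_swapRight_assoc] at this
  · intro h
    rw [h]

lemma swapRight_iff' {A F F' S H K K' : V} {q : (A ⊗ F) ⊗ S ⟶ K} {q' : (A ⊗ F') ⊗ S ⟶ K'}
    {a : F ⊗ H ⟶ F'} {m : H ⊗ K ⟶ K'} :
    (A ⊗ S) ◁ a ≫ swapRight A S F' ≫ q' =
      (α_ _ _ _).inv ≫ (swapRight A S F ≫ q) ▷ H ≫ (β_ K H).hom ≫ m ↔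
    (A ◁ a) ▷ S ≫ q' = (α_ _ _ _).inv ▷ S ≫ (β_ (A ⊗ F) H).hom ▷ S ≫ (α_ _ _ _).hom ≫
      H ◁ q ≫ m := by
  refine swapRight_iff.symm.trans ?_
  rw [swapRight_swapRight_assoc, swapRight_swapRight_assoc, SymmetricCategory.symmetry_assoc]

end Bilinear

/-! ### `[φ, R ψ]` and `[ψ, L φ]` represent bilinear families. -/

section Families

variable {V : Type u} [Category.{v} V] [MonoidalCategory V] [SymmetricCategory V]
  [MonoidalClosed V]
variable {C : Type w} [EnrichedCategory V C]

/-- Graded families `A ⊗ φ b ⊗ ψ c ⟶ C(b, c)` which are `V`-natural in `b` and `c`. -/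
structure IsBilinear (φ : EnrichedFunctor V Cᵒᵖ V) (ψ : EnrichedFunctor V C V) {A : V}
    (q : ∀ b c : C, (A ⊗ φ.obj (op b)) ⊗ ψ.obj c ⟶ Hom⟪b, c⟫) : Prop where
  right : ∀ b c c' : C, (A ⊗ φ.obj (op b)) ◁ act ψ c c' ≫ q b c' =
    (α_ _ _ _).inv ≫ q b c ▷ Hom⟪c, c'⟫ ≫ eComp V b c c'
  left : ∀ b b' c : C, (A ◁ act φ (op b) (op b')) ▷ ψ.obj c ≫ q b' c =
    (α_ _ _ _).inv ▷ _ ≫ (β_ (A ⊗ φ.obj (op b)) (Hom⟪b', b⟫ : V)).hom ▷ _ ≫ (α_ _ _ _).hom ≫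
      (Hom⟪b', b⟫ : V) ◁ q b c ≫ eComp V b' b c

lemma isBilinear_swap_iff {φ : EnrichedFunctor V Cᵒᵖ V} {ψ : EnrichedFunctor V C V} {A : V}
    {q : ∀ b c : C, (A ⊗ φ.obj (op b)) ⊗ ψ.obj c ⟶ Hom⟪b, c⟫} :
    IsBilinear (onOp ψ) φ (fun c b => swapRight A (ψ.obj c.unop) (φ.obj b) ≫ q b.unop c.unop) ↔
      IsBilinear φ ψ q := by
  have h1 : ∀ b b' c : C,
      ((A ⊗ ψ.obj c) ◁ act φ (op b) (op b') ≫ swapRight A (ψ.obj c) (φ.obj (op b')) ≫ q b' c =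
        (α_ _ _ _).inv ≫ (swapRight A (ψ.obj c) (φ.obj (op b)) ≫ q b c) ▷ (Hom⟪b', b⟫ : V) ≫
          (β_ _ _).hom ≫ eComp V b' b c) ↔
      ((A ◁ act φ (op b) (op b')) ▷ ψ.obj c ≫ q b' c =
        (α_ _ _ _).inv ▷ _ ≫ (β_ (A ⊗ φ.obj (op b)) (Hom⟪b', b⟫ : V)).hom ▷ _ ≫ (α_ _ _ _).hom ≫
          (Hom⟪b', b⟫ : V) ◁ q b c ≫ eComp V b' b c) :=
    fun b b' c => swapRight_iff'
  have h2 : ∀ b c c' : C,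
      ((A ◁ act ψ c c') ▷ φ.obj (op b) ≫ swapRight A (ψ.obj c') (φ.obj (op b)) ≫ q b c' =
        (α_ _ _ _).inv ▷ _ ≫ (β_ (A ⊗ ψ.obj c) (Hom⟪c, c'⟫ : V)).hom ▷ _ ≫ (α_ _ _ _).hom ≫
          (Hom⟪c, c'⟫ : V) ◁ (swapRight A (ψ.obj c) (φ.obj (op b)) ≫ q b c) ≫
            (β_ _ _).hom ≫ eComp V b c c') ↔
      ((A ⊗ φ.obj (op b)) ◁ act ψ c c' ≫ q b c' =
        (α_ _ _ _).inv ≫ q b c ▷ Hom⟪c, c'⟫ ≫ eComp V b c c') :=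
    fun b c c' => swapRight_iff
  constructor
  · intro h
    refine ⟨fun b c c' => (h2 b c c').1 ?_,
      fun b b' c => (h1 b b' c).1 (h.right (op c) (op b) (op b'))⟩
    have := h.left (op c) (op c') (op b)
    rw [act_onOp] at this
    exact this
  · intro h
    refine ⟨fun c b b' => (h1 b.unop b'.unop c.unop).2 (h.left _ _ _), fun c c' b => ?_⟩
    rw [act_onOp]
    exact (h2 b.unop c.unop c'.unop).2 (h.right _ _ _)

variable [HasLimits V] [VSmall V C]

/-- Evaluation `[Cᵒᵖ, V](φ, rdual ψ) ⊗ φ b ⟶ [C, V](ψ, C(b, -))`. -/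
noncomputable def hevRdual (φ : EnrichedFunctor V Cᵒᵖ V) (ψ : EnrichedFunctor V C V) (b : C) :
    (Hom⟪φ, rdual ψ⟫ : V) ⊗ φ.obj (op b) ⟶ (Hom⟪ψ, homFunctor V b⟫ : V) :=
  hev φ (rdual ψ) (op b)

/-- The evaluation `[Cᵒᵖ, V](φ, rdual ψ) ⊗ φ b ⊗ ψ c ⟶ C(b, c)`. -/
noncomputable def evalRdual (φ : EnrichedFunctor V Cᵒᵖ V) (ψ : EnrichedFunctor V C V) (b c : C) :
    ((Hom⟪φ, rdual ψ⟫ : V) ⊗ φ.obj (op b)) ⊗ ψ.obj c ⟶ Hom⟪b, c⟫ :=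
  hevRdual φ ψ b ▷ ψ.obj c ≫ hevHom ψ b c

/-- The action of `C` on its dual. -/
noncomputable def rdualAct (ψ : EnrichedFunctor V C V) (b b' : C) :
    (Hom⟪ψ, homFunctor V b⟫ : V) ⊗ (Hom⟪b', b⟫ : V) ⟶ (Hom⟪ψ, homFunctor V b'⟫ : V) :=
  act (rdual ψ) (op b) (op b')

lemma rdualAct_hevHom (ψ : EnrichedFunctor V C V) (b b' c : C) :
    rdualAct ψ b b' ▷ ψ.obj c ≫ hevHom ψ b' c = (β_ _ _).hom ▷ ψ.obj c ≫ (α_ _ _ _).hom ≫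
      (Hom⟪b', b⟫ : V) ◁ hevHom ψ b c ≫ eComp V b' b c := by
  have h : ((β_ (Hom⟪b', b⟫ : V) (Hom⟪ψ, homFunctor V b⟫ : V)).hom ≫ rdualAct ψ b b') ▷ ψ.obj c ≫
      hevHom ψ b' c = (α_ _ _ _).hom ≫ (Hom⟪b', b⟫ : V) ◁ hevHom ψ b c ≫ eComp V b' b c :=
    lact_rdual_hevHom ψ b' b c
  rw [← h, ← comp_whiskerRight_assoc, SymmetricCategory.symmetry_assoc]

lemma hevRdual_act (φ : EnrichedFunctor V Cᵒᵖ V) (ψ : EnrichedFunctor V C V) (b b' : C) :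
    (Hom⟪φ, rdual ψ⟫ : V) ◁ act φ (op b) (op b') ≫ hevRdual φ ψ b' =
      (α_ _ _ _).inv ≫ hevRdual φ ψ b ▷ (Hom⟪b', b⟫ : V) ≫ rdualAct ψ b b' :=
  hev_act φ (rdual ψ) (op b) (op b')

variable {φ : EnrichedFunctor V Cᵒᵖ V} {ψ : EnrichedFunctor V C V} {A : V}

lemma hevRdual_ext {f g : A ⟶ (Hom⟪φ, rdual ψ⟫ : V)}
    (h : ∀ b, f ▷ φ.obj (op b) ≫ hevRdual φ ψ b = g ▷ φ.obj (op b) ≫ hevRdual φ ψ b) : f = g :=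
  hev_ext fun b => h b.unop

lemma isBilinear_evalRdual (φ : EnrichedFunctor V Cᵒᵖ V) (ψ : EnrichedFunctor V C V) :
    IsBilinear φ ψ (evalRdual φ ψ) where
  right b c c' := by
    rw [evalRdual, whisker_exchange_assoc, hevHom_act, associator_inv_naturality_left_assoc,
      evalRdual, comp_whiskerRight_assoc]
  left b b' c := by
    rw [evalRdual, ← comp_whiskerRight_assoc, hevRdual_act]
    simp only [comp_whiskerRight, Category.assoc]
    rw [rdualAct_hevHom, ← comp_whiskerRight_assoc (hevRdual φ ψ b ▷ _),
      braiding_naturality_left, comp_whiskerRight_assoc, associator_naturality_middle_assoc,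
      evalRdual, MonoidalCategory.whiskerLeft_comp_assoc]

/-- Two nested ends: evaluations at `b`, then at `c`, are jointly faithful. -/
lemma evalRdual_ext {f g : A ⟶ (Hom⟪φ, rdual ψ⟫ : V)}
    (h : ∀ b c, f ▷ φ.obj (op b) ▷ ψ.obj c ≫ evalRdual φ ψ b c =
      g ▷ φ.obj (op b) ▷ ψ.obj c ≫ evalRdual φ ψ b c) : f = g := by
  apply hevRdual_ext
  intro b
  apply hevHom_ext
  intro c
  have := h b c
  rw [evalRdual] at this
  rw [comp_whiskerRight_assoc, comp_whiskerRight_assoc, this]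

/-- For fixed `b`, naturality in `c` makes `q b` a morphism into `[ψ, C(b, -)]`. Naturality in `b`
then survives because it can be tested after evaluation at `c`. -/
lemma IsBilinear.exists_transpose {q : ∀ b c : C, (A ⊗ φ.obj (op b)) ⊗ ψ.obj c ⟶ Hom⟪b, c⟫}
    (hq : IsBilinear φ ψ q) : ∃ t : ∀ b : C, A ⊗ φ.obj (op b) ⟶ (Hom⟪ψ, homFunctor V b⟫ : V),
      (∀ b c, t b ▷ ψ.obj c ≫ hevHom ψ b c = q b c) ∧
      ∀ b b', A ◁ act φ (op b) (op b') ≫ t b' =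
        (α_ _ _ _).inv ≫ t b ▷ (Hom⟪b', b⟫ : V) ≫ rdualAct ψ b b' := by
  have h1 : ∀ b : C, ∃ t : A ⊗ φ.obj (op b) ⟶ (Hom⟪ψ, homFunctor V b⟫ : V),
      ∀ c, t ▷ ψ.obj c ≫ hevHom ψ b c = q b c := fun b =>
    ⟨hlift (G := homFunctor V b) (q b) (fun c c' => by rw [act_homFunctor]; exact hq.right b c c'),
      fun c => hlift_hev (G := homFunctor V b) _ _ c⟩
  choose t ht using h1
  refine ⟨t, ht, fun b b' => ?_⟩
  apply hevHom_ext
  intro c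
  simp only [comp_whiskerRight, Category.assoc]
  rw [ht, hq.left, rdualAct_hevHom, ← comp_whiskerRight_assoc (t b ▷ _),
    braiding_naturality_left, comp_whiskerRight_assoc, associator_naturality_middle_assoc,
    ← MonoidalCategory.whiskerLeft_comp_assoc, ht]

lemma IsBilinear.exists_rdual {q : ∀ b c : C, (A ⊗ φ.obj (op b)) ⊗ ψ.obj c ⟶ Hom⟪b, c⟫}
    (hq : IsBilinear φ ψ q) : ∃ f : A ⟶ (Hom⟪φ, rdual ψ⟫ : V),
      ∀ b c, f ▷ φ.obj (op b) ▷ ψ.obj c ≫ evalRdual φ ψ b c = q b c := by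
  obtain ⟨t, ht, h2⟩ := hq.exists_transpose
  have h3 : ∃ f : A ⟶ (Hom⟪φ, rdual ψ⟫ : V), ∀ b, f ▷ φ.obj (op b) ≫ hevRdual φ ψ b = t b :=
    ⟨hlift (G := rdual ψ) (fun b => t b.unop) (fun b b' => h2 b.unop b'.unop),
      fun b => hlift_hev (G := rdual ψ) (fun b => t b.unop) _ (op b)⟩
  obtain ⟨f, hf⟩ := h3
  refine ⟨f, fun b c => ?_⟩
  rw [evalRdual, ← comp_whiskerRight_assoc, hf, ht]

/-- Evaluation `[C, V](ψ, ldual φ) ⊗ ψ c ⟶ [Cᵒᵖ, V](φ, C(-, c))`. -/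
noncomputable def hevLdual (φ : EnrichedFunctor V Cᵒᵖ V) (ψ : EnrichedFunctor V C V) (c : C) :
    (Hom⟪ψ, ldual φ⟫ : V) ⊗ ψ.obj c ⟶ (Hom⟪φ, homFunctor V (op c)⟫ : V) :=
  hev ψ (ldual φ) c

/-- Evaluation `[Cᵒᵖ, V](φ, C(-, c)) ⊗ φ b ⟶ C(b, c)`. -/
noncomputable def hevOpHom (φ : EnrichedFunctor V Cᵒᵖ V) (b c : C) :
    (Hom⟪φ, homFunctor V (op c)⟫ : V) ⊗ φ.obj (op b) ⟶ Hom⟪b, c⟫ := hevHom φ (op c) (op b)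

/-- The evaluation `[C, V](ψ, ldual φ) ⊗ φ b ⊗ ψ c ⟶ C(b, c)`. -/
noncomputable def evalLdual (φ : EnrichedFunctor V Cᵒᵖ V) (ψ : EnrichedFunctor V C V) (b c : C) :
    ((Hom⟪ψ, ldual φ⟫ : V) ⊗ φ.obj (op b)) ⊗ ψ.obj c ⟶ Hom⟪b, c⟫ :=
  swapRight _ _ _ ≫ hevLdual φ ψ c ▷ φ.obj (op b) ≫ hevOpHom φ b c

lemma swapRight_evalLdual (φ : EnrichedFunctor V Cᵒᵖ V) (ψ : EnrichedFunctor V C V) (b c : C) :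
    swapRight _ _ _ ≫ evalLdual φ ψ b c = hevLdual φ ψ c ▷ φ.obj (op b) ≫ hevOpHom φ b c :=
  swapRight_swapRight_assoc _ _ _ _

lemma hevLdual_act (φ : EnrichedFunctor V Cᵒᵖ V) (ψ : EnrichedFunctor V C V) (c c' : C) :
    (Hom⟪ψ, ldual φ⟫ : V) ◁ act ψ c c' ≫ hevLdual φ ψ c' =
      (α_ _ _ _).inv ≫ hevLdual φ ψ c ▷ (Hom⟪c, c'⟫ : V) ≫ rdualAct φ (op c) (op c') := by
  have h := hev_act ψ (ldual φ) c c'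
  rw [act_ldual] at h
  exact h

lemma hevLdual_ext {f g : A ⟶ (Hom⟪ψ, ldual φ⟫ : V)}
    (h : ∀ c, f ▷ ψ.obj c ≫ hevLdual φ ψ c = g ▷ ψ.obj c ≫ hevLdual φ ψ c) : f = g :=
  hev_ext h

lemma hevOpHom_ext {c : C} {f g : A ⟶ (Hom⟪φ, homFunctor V (op c)⟫ : V)}
    (h : ∀ b : C, f ▷ φ.obj (op b) ≫ hevOpHom φ b c = g ▷ φ.obj (op b) ≫ hevOpHom φ b c) :
    f = g :=
  hevHom_ext fun b => h b.unop

/-- After the exchange of factors, naturality in `c` comes from the action on `L φ`, and naturality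
in `b` from that of a family into `C(-, c)`. -/
lemma isBilinear_evalLdual (φ : EnrichedFunctor V Cᵒᵖ V) (ψ : EnrichedFunctor V C V) :
    IsBilinear φ ψ (evalLdual φ ψ) where
  right b c c' := by
    refine swapRight_iff.1 ?_
    rw [swapRight_evalLdual, swapRight_evalLdual, ← comp_whiskerRight_assoc, hevLdual_act]
    have h : rdualAct φ (op c) (op c') ▷ φ.obj (op b) ≫ hevOpHom φ b c' =
      (β_ _ _).hom ▷ φ.obj (op b) ≫ (α_ _ _ _).hom ≫ (Hom⟪c, c'⟫ : V) ◁ hevOpHom φ b c ≫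
        (β_ _ _).hom ≫ eComp V b c c' := rdualAct_hevHom φ (op c) (op c') (op b)
    simp only [comp_whiskerRight, Category.assoc]
    rw [h, ← comp_whiskerRight_assoc (hevLdual φ ψ c ▷ _),
      braiding_naturality_left, comp_whiskerRight_assoc, associator_naturality_middle_assoc,
      MonoidalCategory.whiskerLeft_comp_assoc]
  left b b' c := by
    refine swapRight_iff'.1 ?_
    rw [swapRight_evalLdual, swapRight_evalLdual, whisker_exchange_assoc]
    have h : (Hom⟪φ, homFunctor V (op c)⟫ : V) ◁ act φ (op b) (op b') ≫ hevOpHom φ b' c =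
      (α_ _ _ _).inv ≫ hevOpHom φ b c ▷ (Hom⟪op b, op b'⟫ : V) ≫
        (β_ _ (Hom⟪op b, op b'⟫ : V)).hom ≫ eComp V b' b c :=
      hevHom_act φ (op c) (op b) (op b')
    rw [h, associator_inv_naturality_left_assoc, comp_whiskerRight_assoc]

lemma evalLdual_ext {f g : A ⟶ (Hom⟪ψ, ldual φ⟫ : V)}
    (h : ∀ b c, f ▷ φ.obj (op b) ▷ ψ.obj c ≫ evalLdual φ ψ b c =
      g ▷ φ.obj (op b) ▷ ψ.obj c ≫ evalLdual φ ψ b c) : f = g := by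
  apply hevLdual_ext
  intro c
  apply hevOpHom_ext
  intro b
  have := swapRight _ _ _ ≫= h b c
  rwa [← swapRight_naturality_assoc, ← swapRight_naturality_assoc, swapRight_evalLdual,
    ← comp_whiskerRight_assoc, ← comp_whiskerRight_assoc] at this

/-- The transposition `exists_transpose` over `Cᵒᵖ`, where `ψ` is the variable transposed last. -/
lemma IsBilinear.exists_ldual {q : ∀ b c : C, (A ⊗ φ.obj (op b)) ⊗ ψ.obj c ⟶ Hom⟪b, c⟫}
    (hq : IsBilinear φ ψ q) : ∃ f : A ⟶ (Hom⟪ψ, ldual φ⟫ : V),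
      ∀ b c, f ▷ φ.obj (op b) ▷ ψ.obj c ≫ evalLdual φ ψ b c = q b c := by
  have h1 : ∃ t : ∀ c : C, A ⊗ ψ.obj c ⟶ (Hom⟪φ, homFunctor V (op c)⟫ : V),
      (∀ b c, t c ▷ φ.obj (op b) ≫ hevOpHom φ b c = swapRight _ _ _ ≫ q b c) ∧
      ∀ c c', A ◁ act ψ c c' ≫ t c' = (α_ _ _ _).inv ≫ t c ▷ (Hom⟪c, c'⟫ : V) ≫
        rdualAct φ (op c) (op c') := by
    obtain ⟨t, ht, ht'⟩ := (isBilinear_swap_iff.2 hq).exists_transpose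
    refine ⟨fun c => t (op c), fun b c => ht (op c) (op b), fun c c' => ?_⟩
    have := ht' (op c) (op c')
    rw [act_onOp] at this
    exact this
  obtain ⟨t, ht, ht'⟩ := h1
  have h3 : ∃ f : A ⟶ (Hom⟪ψ, ldual φ⟫ : V), ∀ c : C, f ▷ ψ.obj c ≫ hevLdual φ ψ c = t c :=
    ⟨hlift (G := ldual φ) t (fun c c' => by rw [act_ldual]; exact ht' c c'),
      fun c => hlift_hev (G := ldual φ) _ _ c⟩
  obtain ⟨f, hf⟩ := h3
  refine ⟨f, fun b c => ?_⟩
  rw [evalLdual, swapRight_naturality_assoc, ← comp_whiskerRight_assoc, hf, ht,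
    swapRight_swapRight_assoc]

end Families

end Isbell

namespace Isbell

/-! ### Permutations of four factors for the naturality of the Isbell isomorphism. -/

section Bilinear

variable {V : Type u} [Category.{v} V] [MonoidalCategory V] [SymmetricCategory V]

/-- Both sides realise the permutation `G L F S` to `L S G F`; needed for naturality in `φ`. The
next lemma serves naturality in `ψ`. -/
lemma swapRight_aux_left (G L F S : V) :
    swapRight (G ⊗ L) F S ≫ (α_ _ _ _).hom ▷ F ≫ (β_ G (L ⊗ S)).hom ▷ F ≫ (α_ _ _ _).hom =
      (β_ G L).hom ▷ F ▷ S ≫ (α_ _ _ _).hom ▷ S ≫ swapRight L (G ⊗ F) S := by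
  rw [swapRight, swapRight, braiding_tensor_left_hom, braiding_tensor_right_hom]
  simp only [comp_whiskerRight, MonoidalCategory.whiskerLeft_comp, Category.assoc,
    hom_inv_whiskerRight_assoc]
  rw [← associator_inv_naturality_left_assoc, whisker_exchange_assoc,
    ← associator_naturality_left_assoc]
  monoidal

lemma swapRight_aux_right (L M F S : V) :
    swapRight (L ⊗ M) F S ≫ (α_ _ _ _).hom ▷ F ≫ swapRight L (M ⊗ S) F =
      (β_ L M).hom ▷ F ▷ S ≫ (α_ _ _ _).hom ▷ S ≫ (β_ M (L ⊗ F)).hom ▷ S ≫ (α_ _ _ _).hom := by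
  rw [swapRight, swapRight, braiding_tensor_left_hom, braiding_tensor_right_hom]
  have h : (L ⊗ M) ◁ (β_ F S).hom ≫ (α_ _ _ _).inv ≫ (α_ L M S).hom ▷ F ≫ (α_ _ _ _).hom ≫
      L ◁ (α_ M S F).hom ≫ L ◁ M ◁ (β_ S F).hom = (α_ L M (F ⊗ S)).hom := by
    have e : (α_ _ _ _).inv ≫ (α_ L M S).hom ▷ F ≫ (α_ _ _ _).hom ≫ L ◁ (α_ M S F).hom =
      (α_ _ _ _).hom := by monoidal
    have e' := (L ⊗ M) ◁ (β_ F S).hom ≫= e =≫ (L ◁ M ◁ (β_ S F).hom)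
    simp only [Category.assoc] at e'
    rw [e', associator_naturality_right_assoc, ← MonoidalCategory.whiskerLeft_comp,
      ← MonoidalCategory.whiskerLeft_comp, SymmetricCategory.symmetry,
      MonoidalCategory.whiskerLeft_id, MonoidalCategory.whiskerLeft_id, Category.comp_id]
  have h' := (α_ _ _ _).hom ≫= h =≫ (L ◁ (α_ M F S).inv ≫ L ◁ (β_ M F).hom ▷ S ≫
    L ◁ (α_ F M S).hom ≫ (α_ _ _ _).inv)
  simp only [comp_whiskerRight, MonoidalCategory.whiskerLeft_comp, Category.assoc,
    hom_inv_whiskerRight_assoc] at h' ⊢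
  rw [h', ← comp_whiskerRight_assoc ((β_ L M).hom ▷ F), ← comp_whiskerRight,
    SymmetricCategory.symmetry]
  monoidal

end Bilinear

/-! ### The Isbell isomorphism and its naturality. -/

section IsbellAdjunction

variable {V : Type u} [Category.{v} V] [MonoidalCategory V] [SymmetricCategory V]
  [MonoidalClosed V] [HasLimits V]
variable {C : Type w} [EnrichedCategory V C] [VSmall V C]

/-- The two universal bilinear families factor through each other, and joint faithfulness makes the
factorizations inverse. -/
lemma exists_isbellHom (φ : EnrichedFunctor V Cᵒᵖ V) (ψ : EnrichedFunctor V C V) :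
    ∃ f : (Hom⟪ψ, ldual φ⟫ : V) ≅ (Hom⟪φ, rdual ψ⟫ : V),
      ∀ b c, f.hom ▷ φ.obj (op b) ▷ ψ.obj c ≫ evalRdual φ ψ b c = evalLdual φ ψ b c := by
  obtain ⟨f, hf⟩ := (isBilinear_evalLdual φ ψ).exists_rdual
  obtain ⟨g, hg⟩ := (isBilinear_evalRdual φ ψ).exists_ldual
  refine ⟨⟨f, g, evalLdual_ext fun b c => ?_, evalRdual_ext fun b c => ?_⟩, hf⟩
  · rw [comp_whiskerRight, comp_whiskerRight, Category.assoc, hg, hf, id_whiskerRight,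
      id_whiskerRight, Category.id_comp]
  · rw [comp_whiskerRight, comp_whiskerRight, Category.assoc, hf, hg, id_whiskerRight,
      id_whiskerRight, Category.id_comp]

/-- The isomorphism `[C, V](ψ, ldual φ) ≅ [Cᵒᵖ, V](φ, rdual ψ)`. -/
noncomputable def isbellIso (φ : EnrichedFunctor V Cᵒᵖ V) (ψ : EnrichedFunctor V C V) :
    (Hom⟪ψ, ldual φ⟫ : V) ≅ (Hom⟪φ, rdual ψ⟫ : V) := (exists_isbellHom φ ψ).choose

lemma isbellIso_hom_evalRdual (φ : EnrichedFunctor V Cᵒᵖ V) (ψ : EnrichedFunctor V C V) (b c : C) :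
    (isbellIso φ ψ).hom ▷ φ.obj (op b) ▷ ψ.obj c ≫ evalRdual φ ψ b c = evalLdual φ ψ b c :=
  (exists_isbellHom φ ψ).choose_spec b c

/-- The action of the duality `φ ↦ ldual φ` on hom-objects. -/
noncomputable def ldualMap (φ' φ : EnrichedFunctor V Cᵒᵖ V) :
    (Hom⟪φ', φ⟫ : V) ⟶ (Hom⟪ldual φ, ldual φ'⟫ : V) := (isbellL V C).map φ' φ

/-- The action of the duality `ψ ↦ rdual ψ` on hom-objects. -/
noncomputable def rdualMap (ψ' ψ : EnrichedFunctor V C V) :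
    (Hom⟪ψ', ψ⟫ : V) ⟶ (Hom⟪rdual ψ, rdual ψ'⟫ : V) := (isbellR V C).map (op ψ) (op ψ')

/-- Evaluation `[ldual φ, ldual φ'] ⊗ [φ, C(-, c)] ⟶ [φ', C(-, c)]`. -/
noncomputable def hevLL (φ φ' : EnrichedFunctor V Cᵒᵖ V) (c : C) :
    (Hom⟪ldual φ, ldual φ'⟫ : V) ⊗ (Hom⟪φ, homFunctor V (op c)⟫ : V) ⟶
      (Hom⟪φ', homFunctor V (op c)⟫ : V) := hev (ldual φ) (ldual φ') c

/-- Evaluation `[rdual ψ, rdual ψ'] ⊗ [ψ, C(b, -)] ⟶ [ψ', C(b, -)]`. -/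
noncomputable def hevRR (ψ ψ' : EnrichedFunctor V C V) (b : C) :
    (Hom⟪rdual ψ, rdual ψ'⟫ : V) ⊗ (Hom⟪ψ, homFunctor V b⟫ : V) ⟶
      (Hom⟪ψ', homFunctor V b⟫ : V) := hev (rdual ψ) (rdual ψ') (op b)

lemma ldualMap_hevLL (φ' φ : EnrichedFunctor V Cᵒᵖ V) (c : C) :
    ldualMap φ' φ ▷ (Hom⟪φ, homFunctor V (op c)⟫ : V) ≫ hevLL φ φ' c =
      (β_ _ _).hom ≫ pcomp φ' φ (homFunctor V (op c)) := by
  refine (comp_hev (F := ldual φ) (G := ldual φ') (ldualMap φ' φ) c).trans ?_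
  refine (congrArg (fun t => _ ≫ MonoidalClosed.uncurry t) (natLift_π _ c)).trans ?_
  exact congrArg (fun t => _ ≫ t) (MonoidalClosed.uncurry_curry _)

lemma rdualMap_hevRR (ψ' ψ : EnrichedFunctor V C V) (b : C) :
    rdualMap ψ' ψ ▷ (Hom⟪ψ, homFunctor V b⟫ : V) ≫ hevRR ψ ψ' b =
      (β_ _ _).hom ≫ pcomp ψ' ψ (homFunctor V b) := by
  refine (comp_hev (F := rdual ψ) (G := rdual ψ') (rdualMap ψ' ψ) (op b)).trans ?_
  refine (congrArg (fun t => _ ≫ MonoidalClosed.uncurry t) (natLift_π _ (op b))).trans ?_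
  exact congrArg (fun t => _ ≫ t) (MonoidalClosed.uncurry_curry _)

lemma pcomp_hevLdual (φ φ' : EnrichedFunctor V Cᵒᵖ V) (ψ : EnrichedFunctor V C V) (c : C) :
    pcomp ψ (ldual φ) (ldual φ') ▷ ψ.obj c ≫ hevLdual φ' ψ c =
      (α_ _ _ _).hom ≫ (Hom⟪ldual φ, ldual φ'⟫ : V) ◁ hevLdual φ ψ c ≫ hevLL φ φ' c :=
  pcomp_hev ψ (ldual φ) (ldual φ') c

lemma pcomp_hevLdual' (φ : EnrichedFunctor V Cᵒᵖ V) (ψ ψ' : EnrichedFunctor V C V) (c : C) :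
    pcomp ψ' ψ (ldual φ) ▷ ψ'.obj c ≫ hevLdual φ ψ' c =
      (α_ _ _ _).hom ≫ (Hom⟪ψ, ldual φ⟫ : V) ◁ hev ψ' ψ c ≫ hevLdual φ ψ c :=
  pcomp_hev ψ' ψ (ldual φ) c

lemma pcomp_hevOpHom (φ φ' : EnrichedFunctor V Cᵒᵖ V) (b c : C) :
    pcomp φ' φ (homFunctor V (op c)) ▷ φ'.obj (op b) ≫ hevOpHom φ' b c =
      (α_ _ _ _).hom ≫ (Hom⟪φ, homFunctor V (op c)⟫ : V) ◁ hev φ' φ (op b) ≫ hevOpHom φ b c :=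
  pcomp_hev φ' φ (homFunctor V (op c)) (op b)

lemma pcomp_hevRdual (φ : EnrichedFunctor V Cᵒᵖ V) (ψ ψ' : EnrichedFunctor V C V) (b : C) :
    pcomp φ (rdual ψ) (rdual ψ') ▷ φ.obj (op b) ≫ hevRdual φ ψ' b =
      (α_ _ _ _).hom ≫ (Hom⟪rdual ψ, rdual ψ'⟫ : V) ◁ hevRdual φ ψ b ≫ hevRR ψ ψ' b :=
  pcomp_hev φ (rdual ψ) (rdual ψ') (op b)

lemma pcomp_hevRdual' (φ φ' : EnrichedFunctor V Cᵒᵖ V) (ψ : EnrichedFunctor V C V) (b : C) :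
    pcomp φ' φ (rdual ψ) ▷ φ'.obj (op b) ≫ hevRdual φ' ψ b =
      (α_ _ _ _).hom ≫ (Hom⟪φ, rdual ψ⟫ : V) ◁ hev φ' φ (op b) ≫ hevRdual φ ψ b :=
  pcomp_hev φ' φ (rdual ψ) (op b)

/-- Tested on bilinear families, where the isomorphism disappears: both sides evaluate `[φ', φ]` on
`φ' b` and `[ψ, L φ]` on `ψ c`, in orders reconciled by `swapRight_aux_left`. -/
lemma ldualMap_isbellIso (φ' φ : EnrichedFunctor V Cᵒᵖ V) (ψ : EnrichedFunctor V C V) :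
    ldualMap φ' φ ▷ (Hom⟪ψ, ldual φ⟫ : V) ≫ pcomp ψ (ldual φ) (ldual φ') ≫ (isbellIso φ' ψ).hom =
      (Hom⟪φ', φ⟫ : V) ◁ (isbellIso φ ψ).hom ≫ (β_ _ _).hom ≫ pcomp φ' φ (rdual ψ) := by
  apply evalRdual_ext
  intro b c
  have hl : (ldualMap φ' φ ▷ (Hom⟪ψ, ldual φ⟫ : V)) ▷ ψ.obj c ≫
      pcomp ψ (ldual φ) (ldual φ') ▷ ψ.obj c ≫ hevLdual φ' ψ c = (α_ _ _ _).hom ≫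
        (β_ _ _).hom ≫ hevLdual φ ψ c ▷ (Hom⟪φ', φ⟫ : V) ≫ pcomp φ' φ (homFunctor V (op c)) := by
    rw [pcomp_hevLdual, associator_naturality_left_assoc, ← whisker_exchange_assoc,
      ldualMap_hevLL, braiding_naturality_right_assoc]
  have hr : pcomp φ' φ (rdual ψ) ▷ φ'.obj (op b) ▷ ψ.obj c ≫ evalRdual φ' ψ b c =
      (α_ _ _ _).hom ▷ ψ.obj c ≫ ((Hom⟪φ, rdual ψ⟫ : V) ◁ hev φ' φ (op b)) ▷ ψ.obj c ≫
        evalRdual φ ψ b c := by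
    rw [evalRdual, ← comp_whiskerRight_assoc, pcomp_hevRdual']
    simp only [comp_whiskerRight, Category.assoc, evalRdual]
  rw [braiding_naturality_right_assoc]
  simp only [comp_whiskerRight, Category.assoc]
  rw [isbellIso_hom_evalRdual, evalLdual, swapRight_naturality_assoc, swapRight_naturality_assoc,
    ← comp_whiskerRight_assoc (pcomp _ _ _ ▷ _), ← comp_whiskerRight_assoc, hl, hr,
    ← comp_whiskerRight_assoc ((isbellIso φ ψ).hom ▷ _ ▷ _), associator_naturality_left]
  simp only [comp_whiskerRight, Category.assoc]
  rw [← comp_whiskerRight_assoc ((isbellIso φ ψ).hom ▷ _), ← whisker_exchange]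
  simp only [comp_whiskerRight, Category.assoc]
  rw [isbellIso_hom_evalRdual, evalLdual,
    swapRight_naturality_middle_assoc, whisker_exchange_assoc]
  rw [pcomp_hevOpHom, associator_naturality_left_assoc]
  have e := swapRight_aux_left (Hom⟪φ', φ⟫ : V) (Hom⟪ψ, ldual φ⟫ : V) (φ'.obj (op b)) (ψ.obj c) =≫
    (hevLdual φ ψ c ▷ _ ≫ _ ◁ hev φ' φ (op b) ≫ hevOpHom φ b c)
  simpa only [Category.assoc] using e

/-- The same test for naturality in `ψ`: both sides evaluate `[ψ', ψ]` on `ψ' c` and then apply the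
bilinear family at `ψ`. -/
lemma isbellIso_rdualMap (φ : EnrichedFunctor V Cᵒᵖ V) (ψ ψ' : EnrichedFunctor V C V) :
    pcomp ψ' ψ (ldual φ) ≫ (isbellIso φ ψ').hom =
      ((isbellIso φ ψ).hom ⊗ₘ rdualMap ψ' ψ) ≫ (β_ _ _).hom ≫ pcomp φ (rdual ψ) (rdual ψ') := by
  apply evalRdual_ext
  intro b c
  have hl : pcomp ψ' ψ (ldual φ) ▷ φ.obj (op b) ▷ ψ'.obj c ≫ evalLdual φ ψ' b c =
      swapRight _ _ _ ≫ (α_ _ _ _).hom ▷ φ.obj (op b) ≫ swapRight _ _ _ ≫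
        ((Hom⟪ψ, ldual φ⟫ : V) ⊗ φ.obj (op b)) ◁ hev ψ' ψ c ≫ evalLdual φ ψ b c := by
    rw [← swapRight_naturality_middle_assoc, swapRight_evalLdual, evalLdual,
      swapRight_naturality_assoc, ← comp_whiskerRight_assoc, pcomp_hevLdual']
    simp only [comp_whiskerRight, Category.assoc]
  -- An opaque name for the partial transpose of `evalLdual` at `b`, which is all that is used of
  -- it.
  obtain ⟨T, hT⟩ : ∃ T, T = (isbellIso φ ψ).hom ▷ φ.obj (op b) ≫ hevRdual φ ψ b := ⟨_, rfl⟩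
  have hT' : T ▷ ψ.obj c ≫ hevHom ψ b c = evalLdual φ ψ b c := by
    rw [← isbellIso_hom_evalRdual, evalRdual, hT, comp_whiskerRight_assoc]
  have hr : ((Hom⟪ψ', ψ⟫ : V) ◁ (isbellIso φ ψ).hom) ▷ φ.obj (op b) ≫
      rdualMap ψ' ψ ▷ _ ▷ φ.obj (op b) ≫ pcomp φ (rdual ψ) (rdual ψ') ▷ φ.obj (op b) ≫
        hevRdual φ ψ' b = (α_ _ _ _).hom ≫ (Hom⟪ψ', ψ⟫ : V) ◁ T ≫ (β_ _ _).hom ≫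
          pcomp ψ' ψ (homFunctor V b) := by
    rw [pcomp_hevRdual, associator_naturality_left_assoc, ← whisker_exchange_assoc,
      rdualMap_hevRR, associator_naturality_middle_assoc,
      ← MonoidalCategory.whiskerLeft_comp_assoc, hT]
  have hr' : (T ▷ (Hom⟪ψ', ψ⟫ : V)) ▷ ψ'.obj c ≫ pcomp ψ' ψ (homFunctor V b) ▷ ψ'.obj c ≫
      hevHom ψ' b c = (α_ _ _ _).hom ≫
        ((Hom⟪ψ, ldual φ⟫ : V) ⊗ φ.obj (op b)) ◁ hev ψ' ψ c ≫ evalLdual φ ψ b c := by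
    rw [pcomp_hevHom, associator_naturality_left_assoc, ← whisker_exchange_assoc, hT']
  rw [braiding_naturality_assoc, MonoidalCategory.tensorHom_def']
  simp only [comp_whiskerRight, Category.assoc]
  rw [isbellIso_hom_evalRdual, hl, evalRdual]
  have hr'' := congrArg (fun t => t ▷ ψ'.obj c ≫ hevHom ψ' b c) hr
  simp only [comp_whiskerRight, Category.assoc] at hr''
  rw [hr'', ← comp_whiskerRight_assoc (_ ◁ T), braiding_naturality_right]
  simp only [comp_whiskerRight, Category.assoc]
  rw [hr']
  have e := swapRight_aux_right (Hom⟪ψ, ldual φ⟫ : V) (Hom⟪ψ', ψ⟫ : V) (φ.obj (op b))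
    (ψ'.obj c) =≫ (_ ◁ hev ψ' ψ c ≫ evalLdual φ ψ b c)
  simpa only [Category.assoc] using e

end IsbellAdjunction

end Isbell

namespace Isbell

/-! ### `V`-naturality of the unit and counit of a `V`-adjunction. -/

section Adjunctions

variable {V : Type u} [Category.{v} V] [MonoidalCategory V] [SymmetricCategory V]
variable {C : Type w} [EnrichedCategory V C] {D : Type w₁} [EnrichedCategory V D]

lemma braiding_ecmp_eq_iff {X Y Y' Z : C} {A : V} {a : A ⟶ Hom⟪X, Y⟫} {b : 𝟙_ V ⟶ Hom⟪Y, Z⟫}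
    {c : 𝟙_ V ⟶ Hom⟪X, Y'⟫} {d : A ⟶ Hom⟪Y', Z⟫} :
    (β_ (𝟙_ V) A).hom ≫ ecmp a b = ecmp c d ↔ postC a b = preC c d := by
  rw [← cancel_epi (λ_ A).inv, postC, preC]
  simp

/-- A `V`-natural transformation with invertible components is a `V`-natural isomorphism. -/
def VNatIso.ofInverse {F G : EnrichedFunctor V C D} (α : VNat F G)
    (g : ∀ X, 𝟙_ V ⟶ Hom⟪G.obj X, F.obj X⟫) (h₁ : ∀ X, preC (α.ap X) (g X) = eId V (F.obj X))
    (h₂ : ∀ X, preC (g X) (α.ap X) = eId V (G.obj X)) : VNatIso F G where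
  hom := α
  inv := GNat.mk' g (fun X Y => braiding_ecmp_eq_iff.2 (by
    have e := braiding_ecmp_eq_iff.1 (α.nat X Y)
    rw [← eId_preC (postC (G.map X Y) (g Y)), ← h₂ X, ← preC_preC, preC_postC, ← e, postC_postC,
      h₁, postC_eId]))
  hom_inv_id := h₁
  inv_hom_id := h₂

namespace VAdjunction

variable {F : EnrichedFunctor V C D} {G : EnrichedFunctor V D C} (adj : VAdjunction F G)

/-- Naturality of the hom-isomorphism in either variable, evaluated at the identity of an `F X`,
turns each side into `F.map` followed by that isomorphism. -/
lemma unit_naturality (X Y : C) :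
    (β_ (𝟙_ V) Hom⟪X, Y⟫).hom ≫ ecmp (𝟙 _) (adj.unit Y) =
      ecmp (adj.unit X) (F.map X Y ≫ G.map (F.obj X) (F.obj Y)) := by
  have h1 : ecmp (𝟙 Hom⟪X, Y⟫) (adj.unit Y) = (ρ_ _).hom ≫ F.map X Y ≫ (adj.homIso X _).hom := by
    have e := _ ◁ eId V (F.obj Y) ≫= adj.naturality_left X Y (F.obj Y)
    rw [← id_tensorHom, comp_ecmp, ← Category.assoc, comp_ecmp, Category.id_comp, Category.comp_id,
      Category.id_comp, ecmp_id, Category.assoc] at e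
    exact e.symm
  have h2 : ecmp (adj.unit X) (F.map X Y ≫ G.map (F.obj X) (F.obj Y)) =
      (λ_ _).hom ≫ F.map X Y ≫ (adj.homIso X _).hom := by
    have e := (eId V (F.obj X) ⊗ₘ F.map X Y) ≫= adj.naturality_right X (F.obj X) (F.obj Y)
    rw [comp_ecmp, ← Category.assoc] at e
    rw [unit, ← e]
    have := id_ecmp (F.map X Y)
    rw [ecmp] at this
    rw [this, Category.assoc]
  rw [h1, h2]
  simp

lemma counit_homIso (Y : D) :
    adj.counit Y ≫ (adj.homIso (G.obj Y) Y).hom = eId V (G.obj Y) := by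
  rw [counit, Category.assoc, Iso.inv_hom_id, Category.comp_id]

/-- After the invertible hom-isomorphism is applied, both sides become `G.map Y Y'`. -/
lemma counit_naturality (Y Y' : D) :
    (β_ (𝟙_ V) Hom⟪Y, Y'⟫).hom ≫ ecmp (G.map Y Y' ≫ F.map (G.obj Y) (G.obj Y')) (adj.counit Y') =
      ecmp (adj.counit Y) (𝟙 _) := by
  rw [← cancel_mono (adj.homIso (G.obj Y) Y').hom]
  have h1 : ecmp (G.map Y Y' ≫ F.map (G.obj Y) (G.obj Y')) (adj.counit Y') ≫
      (adj.homIso (G.obj Y) Y').hom = (ρ_ _).hom ≫ G.map Y Y' := by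
    have e := (G.map Y Y' ⊗ₘ adj.counit Y') ≫= adj.naturality_left (G.obj Y) (G.obj Y') Y'
    rw [comp_ecmp, ← Category.assoc, comp_ecmp, Category.comp_id, Category.comp_id,
      counit_homIso, ecmp_id] at e
    exact e
  have h2 : ecmp (adj.counit Y) (𝟙 Hom⟪Y, Y'⟫) ≫ (adj.homIso (G.obj Y) Y').hom =
      (λ_ _).hom ≫ G.map Y Y' := by
    have e := (adj.counit Y ⊗ₘ 𝟙 _) ≫= adj.naturality_right (G.obj Y) Y Y'
    rw [comp_ecmp, counit_homIso, Category.id_comp, id_ecmp, ← Category.assoc] at e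
    exact e
  rw [Category.assoc, h1, h2]
  simp

end VAdjunction

end Adjunctions

/-! ### The Isbell adjunction: canonical form, unit and counit. -/

section IsbellAdjunction

variable {V : Type u} [Category.{v} V] [MonoidalCategory V] [SymmetricCategory V]

lemma swapRight_unit (F S : V) : swapRight (𝟙_ V) F S ≫ (λ_ S).hom ▷ F =
    (λ_ F).hom ▷ S ≫ (β_ F S).hom := by
  simp [swapRight]

lemma braiding_swapRight (S F W : V) :
    (β_ S (F ⊗ W)).hom ≫ (β_ F W).hom ▷ S ≫ swapRight W F S =
      (α_ _ _ _).inv ≫ (β_ S F).hom ▷ W ≫ (α_ _ _ _).hom ≫ (β_ F (S ⊗ W)).hom ≫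
        (β_ S W).hom ▷ F := by
  rw [← braiding_naturality_right_assoc, swapRight, braiding_tensor_right_hom S W F,
    braiding_tensor_right_hom F S W]
  simp only [Category.assoc, Iso.inv_hom_id_assoc, Iso.hom_inv_id_assoc]
  rw [← MonoidalCategory.whiskerLeft_comp_assoc W, SymmetricCategory.symmetry,
    ← comp_whiskerRight_assoc, SymmetricCategory.symmetry]
  simp

lemma swapRight_unit_eq {F S W K : V} {t : F ⟶ W} {e : W ⊗ S ⟶ K} {o : S ⊗ F ⟶ K}
    (h : t ▷ S ≫ e = (β_ _ _).hom ≫ o) :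
    swapRight (𝟙_ V) F S ≫ (λ_ S).hom ▷ F ≫ o = ((λ_ F).hom ≫ t) ▷ S ≫ e := by
  rw [← Category.assoc, swapRight_unit, Category.assoc, ← h, comp_whiskerRight_assoc]

lemma eq_swapRight_unit {F S W K : V} {t : S ⟶ W} {e : W ⊗ F ⟶ K} {o : F ⊗ S ⟶ K}
    (h : t ▷ F ≫ e = (β_ _ _).hom ≫ o) :
    (λ_ F).hom ▷ S ≫ o = swapRight (𝟙_ V) F S ≫ ((λ_ S).hom ≫ t) ▷ F ≫ e := by
  rw [comp_whiskerRight_assoc, h, ← Category.assoc (swapRight _ _ _), swapRight_unit,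
    Category.assoc, SymmetricCategory.symmetry_assoc]

variable [MonoidalClosed V]

/-- Expresses the transpose of two successive projections by left evaluations, the form in which
`isbellIso` is characterised. -/
lemma tr_comp_map {W X Y Z a : V} {p : W ⟶ (ihom Y).obj Z} {q : Z ⟶ (ihom X).obj a}
    {e : W ⊗ Y ⟶ Z} {k : Z ⊗ X ⟶ a} (he : e = (β_ _ _).hom ≫ MonoidalClosed.uncurry p)
    (hk : k = (β_ _ _).hom ≫ MonoidalClosed.uncurry q) :
    tr (p ≫ (ihom Y).map q) = (β_ _ _).hom ≫ (β_ _ _).hom ▷ X ≫ e ▷ X ≫ k := by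
  rw [tr, MonoidalClosed.uncurry_natural_right, MonoidalClosed.uncurry_natural_left, he, hk,
    ← comp_whiskerRight_assoc, SymmetricCategory.symmetry_assoc, ← braiding_naturality_right_assoc,
    SymmetricCategory.symmetry_assoc]

variable [HasLimits V]
variable {C : Type w} [EnrichedCategory V C] [VSmall V C]

section

variable {φ : EnrichedFunctor V Cᵒᵖ V} {ψ : EnrichedFunctor V C V} {A : V} {b c : C}

lemma comp_evalRdual {f : A ⟶ (Hom⟪φ, rdual ψ⟫ : V)}
    {t : A ⊗ φ.obj (op b) ⟶ (Hom⟪ψ, homFunctor V b⟫ : V)}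
    (h : f ▷ φ.obj (op b) ≫ hevRdual φ ψ b = t) :
    f ▷ φ.obj (op b) ▷ ψ.obj c ≫ evalRdual φ ψ b c = t ▷ ψ.obj c ≫ hevHom ψ b c := by
  rw [evalRdual, ← comp_whiskerRight_assoc, h]

lemma comp_evalLdual {f : A ⟶ (Hom⟪ψ, ldual φ⟫ : V)}
    {t : A ⊗ ψ.obj c ⟶ (Hom⟪φ, homFunctor V (op c)⟫ : V)}
    (h : f ▷ ψ.obj c ≫ hevLdual φ ψ c = t) :
    f ▷ φ.obj (op b) ▷ ψ.obj c ≫ evalLdual φ ψ b c =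
      swapRight _ _ _ ≫ t ▷ φ.obj (op b) ≫ hevOpHom φ b c := by
  rw [evalLdual, swapRight_naturality_assoc, ← comp_whiskerRight_assoc, h]

lemma comp_isbellIso_hom {f : A ⟶ (Hom⟪ψ, ldual φ⟫ : V)}
    {t : A ⊗ ψ.obj c ⟶ (Hom⟪φ, homFunctor V (op c)⟫ : V)}
    (h : f ▷ ψ.obj c ≫ hevLdual φ ψ c = t) :
    (f ≫ (isbellIso φ ψ).hom) ▷ φ.obj (op b) ▷ ψ.obj c ≫ evalRdual φ ψ b c =
      swapRight _ _ _ ≫ t ▷ φ.obj (op b) ≫ hevOpHom φ b c := by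
  rw [comp_whiskerRight, comp_whiskerRight, Category.assoc, isbellIso_hom_evalRdual,
    comp_evalLdual h]

lemma comp_isbellIso_inv {f : A ⟶ (Hom⟪φ, rdual ψ⟫ : V)}
    {t : A ⊗ φ.obj (op b) ⟶ (Hom⟪ψ, homFunctor V b⟫ : V)}
    (h : f ▷ φ.obj (op b) ≫ hevRdual φ ψ b = t) :
    (f ≫ (isbellIso φ ψ).inv) ▷ φ.obj (op b) ▷ ψ.obj c ≫ evalLdual φ ψ b c =
      t ▷ ψ.obj c ≫ hevHom ψ b c := by
  rw [← isbellIso_hom_evalRdual, ← comp_whiskerRight_assoc, ← comp_whiskerRight, Category.assoc,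
    Iso.inv_hom_id, Category.comp_id, comp_evalRdual h]

end

variable (V C) in
/-- The Isbell adjunction. -/
noncomputable def isbellAdjunction : VAdjunction (isbellL V C) (isbellR V C) where
  homIso φ Y := isbellIso φ Y.unop
  naturality_left φ' φ Y := by
    have h := ldualMap_isbellIso φ' φ Y.unop
    rw [pcomp, pcomp, SymmetricCategory.symmetry_assoc, Category.assoc] at h
    refine Eq.trans ?_ (h.trans ?_)
    · rw [ecmp, tensorHom_id]
      refine (Category.assoc _ _ _).trans ?_
      exact congrArg (fun t => _ ≫ t) (Category.assoc _ _ _)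
    · rw [ecmp, id_tensorHom]
      rfl
  naturality_right φ Y Y' := by
    have h := isbellIso_rdualMap φ Y.unop Y'.unop
    rw [pcomp, pcomp, SymmetricCategory.symmetry_assoc] at h
    exact h

/-- Up to symmetries the two transposes are `evalRdual` and `evalLdual`, so this is the defining
property of `isbellIso`. -/
lemma isbellAdjunction_canonical (φ : EnrichedFunctor V Cᵒᵖ V) (ψ : EnrichedFunctor V C V)
    (b c : C) :
    tr (((isbellAdjunction V C).homIso φ (op ψ)).hom ≫
        natπ φ ((isbellR V C).obj (op ψ)) (op b) ≫
          (ihom (φ.obj (op b))).map (natπ ψ ((coyonedaEmb V C).obj (op b)) c)) =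
      (α_ (ψ.obj c) (φ.obj (op b)) (natObj ψ ((isbellL V C).obj φ).unop)).inv ≫
        (β_ _ _).hom ▷ _ ≫ (α_ _ _ _).hom ≫
        tr (natπ ψ ((isbellL V C).obj φ).unop c ≫
          (ihom (ψ.obj c)).map (natπ φ ((yonedaEmb V C).obj c) (op b))) := by
  have h1 := tr_comp_map (p := (isbellIso φ ψ).hom ≫ natπ φ (rdual ψ) (op b))
    (q := natπ ψ (homFunctor V b) c) (comp_hev (G := rdual ψ) _ (op b)) rfl
  have h2 := tr_comp_map (p := natπ ψ (ldual φ) c)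
    (q := natπ φ (homFunctor V (op c)) (op b)) (e := hevLdual φ ψ c) (k := hevOpHom φ b c) rfl rfl
  have h3 := isbellIso_hom_evalRdual φ ψ b c
  rw [comp_evalRdual rfl] at h3
  have e := braiding_swapRight (ψ.obj c) (φ.obj (op b)) (Hom⟪ψ, ldual φ⟫ : V) =≫
    (hevLdual φ ψ c ▷ φ.obj (op b) ≫ hevOpHom φ b c)
  simp only [Category.assoc] at e
  refine (congrArg tr (Category.assoc _ _ _).symm).trans (h1.trans ?_)
  refine (congrArg (fun t => _ ≫ _ ≫ t) h3).trans ?_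
  refine Eq.trans e ?_
  exact congrArg (fun t => _ ≫ _ ≫ _ ≫ t) h2.symm

lemma natLift_ofHom_hev {F G : EnrichedFunctor V C V} (f : ∀ X, F.obj X ⟶ G.obj X)
    (hf : ∀ X Y, act F X Y ≫ f Y = f X ▷ _ ≫ act G X Y) (x : C) :
    (natLift (VNat.ofHom f hf) : 𝟙_ V ⟶ (Hom⟪F, G⟫ : V)) ▷ F.obj x ≫ hev F G x =
      (λ_ _).hom ≫ f x := by
  refine (comp_hev (F := F) (G := G) _ x).trans ?_
  refine (congrArg (fun t => _ ≫ MonoidalClosed.uncurry t) (natLift_π _ x)).trans ?_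
  refine (congrArg (fun t => _ ≫ t) (uncurry_curry' (f x))).trans ?_
  simp

/-- Both sides induce the bilinear family given by evaluating `L φ` on `φ`: the unit because it
corresponds to the identity of `L φ`, the other by the definition of `θ`. -/
lemma isbellAdjunction_unit (φ : EnrichedFunctor V Cᵒᵖ V) [∀ b, IsIso ((opEvalPairing φ).θ b)] :
    (isbellAdjunction V C).unit φ = natLift (opEvalPairing φ).isoRdual.hom := by
  apply evalRdual_ext (φ := φ) (ψ := ldual φ)
  intro b c
  have h1 : natLift (opEvalPairing φ).isoRdual.hom ▷ φ.obj (op b) ≫ hevRdual φ (ldual φ) b =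
      (λ_ _).hom ≫ (opEvalPairing φ).θ b :=
    natLift_ofHom_hev (F := φ) (G := rdual (ldual φ)) (fun b => (opEvalPairing φ).θ b.unop)
      (fun i j => (opEvalPairing φ).act_comp_θ i j) (op b)
  have h2 : eId V (ldual φ) ▷ (Hom⟪φ, homFunctor V (op c)⟫ : V) ≫ hevLdual φ (ldual φ) c =
      (λ_ _).hom := eId_hev (ldual φ) c
  refine (comp_isbellIso_hom (ψ := ldual φ) h2).trans (Eq.trans ?_ (comp_evalRdual h1).symm)
  exact swapRight_unit_eq ((opEvalPairing φ).θ_hevHom b c)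

/-- The same comparison with the identity of `R ψ`. As a morphism of `[C, V]` the counit goes from
`ψ` to `L R ψ`, hence the exchanged pairing. -/
lemma isbellAdjunction_counit (ψ : EnrichedFunctor V C V)
    [∀ c, IsIso ((evalPairing ψ).swap.θ c)] :
    (isbellAdjunction V C).counit (op ψ) = natLift (evalPairing ψ).isoLdual.hom := by
  apply evalLdual_ext (φ := rdual ψ) (ψ := ψ)
  intro b c
  have h1 : natLift (evalPairing ψ).isoLdual.hom ▷ ψ.obj c ≫ hevLdual (rdual ψ) ψ c =
      (λ_ _).hom ≫ (evalPairing ψ).swap.θ (op c) :=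
    natLift_ofHom_hev (F := ψ) (G := ldual (rdual ψ)) (fun c => (evalPairing ψ).swap.θ (op c))
      (fun i j => (evalPairing ψ).act_comp_swap_θ i j) c
  have h2 : eId V (rdual ψ) ▷ (Hom⟪ψ, homFunctor V b⟫ : V) ≫ hevRdual (rdual ψ) ψ b =
      (λ_ _).hom := eId_hev (rdual ψ) (op b)
  refine (comp_isbellIso_inv (φ := rdual ψ) h2).trans (Eq.trans ?_ (comp_evalLdual h1).symm)
  exact eq_swapRight_unit ((evalPairing ψ).swap.θ_hevHom (op c) (op b))

end IsbellAdjunction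

end Isbell

namespace Isbell

/-! ### Pairings recovered from abstract isomorphisms `φ ≅ R ψ`. -/

section Components

variable {V : Type u} [Category.{v} V] [MonoidalCategory V] [SymmetricCategory V]
  [MonoidalClosed V]
variable {C : Type w} [EnrichedCategory V C] {F G : EnrichedFunctor V C V}

/-- The component of a `V`-natural transformation, as a morphism of `V`. -/
def VNat.component (α : VNat F G) (X : C) : F.obj X ⟶ G.obj X :=
  MonoidalClosed.uncurry' (α.ap X)

lemma uncurry_ap (α : VNat F G) (X : C) :
    MonoidalClosed.uncurry (A := F.obj X) (X := G.obj X) (α.ap X) =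
      (ρ_ _).hom ≫ α.component X := by
  simp [VNat.component, MonoidalClosed.uncurry']

/-- The hexagon for the unit grading, uncurried and with the unitors cancelled. -/
lemma VNat.act_comp_component (α : VNat F G) (X Y : C) :
    act F X Y ≫ α.component Y = α.component X ▷ (Hom⟪X, Y⟫ : V) ≫ act G X Y := by
  have h : F.obj X ◁ (β_ (𝟙_ V) (Hom⟪X, Y⟫ : V)).hom ≫ (α_ _ _ _).inv ≫ act F X Y ▷ 𝟙_ V ≫
      (ρ_ _).hom ≫ α.component Y =
      (α_ _ _ _).inv ≫ ((ρ_ _).hom ≫ α.component X) ▷ (Hom⟪X, Y⟫ : V) ≫ act G X Y := by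
    rw [← uncurry_ap, ← uncurry_ap]
    refine Eq.trans ?_ ((congrArg (fun t => MonoidalClosed.uncurry (A := F.obj X) (X := G.obj Y) t)
      (α.nat X Y)).trans (uncurry_ecmp (α.ap X) (G.map X Y)))
    refine Eq.trans ?_ (MonoidalClosed.uncurry_natural_left _ _).symm
    exact congrArg (fun t => _ ≫ t) (uncurry_ecmp (F.map X Y) (α.ap Y)).symm
  rw [rightUnitor_naturality_assoc, comp_whiskerRight_assoc] at h
  rw [← cancel_epi (F.obj X ◁ (λ_ (Hom⟪X, Y⟫ : V)).hom)]
  simpa using h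

lemma VNatIso.isIso_component (α : VNatIso F G) (X : C) : IsIso (α.hom.component X) := by
  have h : ∀ {P Q : V} (f : 𝟙_ V ⟶ (Hom⟪P, Q⟫ : V)) (g : 𝟙_ V ⟶ (Hom⟪Q, P⟫ : V)),
      preC f g = eId V P → MonoidalClosed.uncurry' f ≫ MonoidalClosed.uncurry' g = 𝟙 P := by
    intro P Q f g e
    have := preC_curry' (MonoidalClosed.uncurry' f) (MonoidalClosed.uncurry' g)
    rw [MonoidalClosed.curry'_uncurry', MonoidalClosed.curry'_uncurry', e, ← curry'_id] at this
    have := congrArg MonoidalClosed.uncurry' this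
    rwa [MonoidalClosed.uncurry'_curry', MonoidalClosed.uncurry'_curry', eq_comm] at this
  exact ⟨MonoidalClosed.uncurry' (α.inv.ap X), h _ _ (α.hom_inv_id X), h _ _ (α.inv_hom_id X)⟩

variable [HasLimits V] [VSmall V C]

/-- The pairing of `φ` and `ψ` corresponding to a `V`-natural transformation from `φ` to the dual
of `ψ`. -/
noncomputable def Pairing.ofVNat {φ : EnrichedFunctor V Cᵒᵖ V} {ψ : EnrichedFunctor V C V}
    (t : ∀ b : C, φ.obj (op b) ⟶ (Hom⟪ψ, homFunctor V b⟫ : V))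
    (ht : ∀ b b', lact φ b' b ≫ t b' = (Hom⟪b', b⟫ : V) ◁ t b ≫ lact (rdual ψ) b' b) :
    Pairing φ ψ where
  pair b c := t b ▷ ψ.obj c ≫ hevHom ψ b c
  naturality_right b c c' := by
    rw [whisker_exchange_assoc, hevHom_act, associator_inv_naturality_left_assoc,
      comp_whiskerRight_assoc]
  naturality_left b' b c := by
    rw [← comp_whiskerRight_assoc, ht]
    refine (congrArg (fun u => u ≫ _) (comp_whiskerRight _ _ _)).trans ?_
    refine (Category.assoc _ _ _).trans ?_
    refine (congrArg (fun u => _ ≫ u) (lact_rdual_hevHom ψ b' b c)).trans ?_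
    rw [MonoidalCategory.whiskerLeft_comp_assoc]
    exact associator_naturality_middle_assoc _ (t b) _ _

lemma Pairing.ofVNat_θ {φ : EnrichedFunctor V Cᵒᵖ V} {ψ : EnrichedFunctor V C V}
    (t : ∀ b : C, φ.obj (op b) ⟶ (Hom⟪ψ, homFunctor V b⟫ : V))
    (ht : ∀ b b', lact φ b' b ≫ t b' = (Hom⟪b', b⟫ : V) ◁ t b ≫ lact (rdual ψ) b' b) (b : C) :
    (Pairing.ofVNat t ht).θ b = t b :=
  hevHom_ext fun x => (Pairing.ofVNat t ht).θ_hevHom b x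

/-- Evaluation pulled back along the components of the isomorphism; its `θ` is given by those
components. -/
lemma VNatIso.exists_pairing {φ : EnrichedFunctor V Cᵒᵖ V} {ψ : EnrichedFunctor V C V}
    (α : VNatIso φ (rdual ψ)) : ∃ P : Pairing φ ψ, ∀ b, IsIso (P.θ b) := by
  refine ⟨Pairing.ofVNat (fun b => α.hom.component (op b)) (fun b b' => ?_), fun b => ?_⟩
  · have h := (β_ _ _).hom ≫= α.hom.act_comp_component (op b) (op b')
    refine (Category.assoc _ _ _).trans (h.trans ?_)
    exact (braiding_naturality_right_assoc _ _ _).symm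
  · exact (congrArg (fun t => IsIso t) (Pairing.ofVNat_θ (ψ := ψ) _ _ b)).mpr
      (α.isIso_component (op b))

end Components

section Opposite

variable {V : Type u} [Category.{v} V] [MonoidalCategory V] [SymmetricCategory V]
variable {C : Type w} [EnrichedCategory V C]

lemma preC_opposite {X Y Z : C} (f : 𝟙_ V ⟶ Hom⟪X, Y⟫) (g : 𝟙_ V ⟶ Hom⟪Y, Z⟫) :
    preC (C := Cᵒᵖ) (X := op Z) (Y := op Y) (Z := op X) g f = preC f g := by
  refine (congrArg (fun t => _ ≫ t) (ecmp_op f g)).trans ?_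
  simp [preC, unitors_inv_equal]

end Opposite

/-! ### Restriction of the adjunction to small projectives. -/

section IsbellAdjunction

variable {V : Type u} [Category.{v} V] [MonoidalCategory V] [SymmetricCategory V]
  [MonoidalClosed V] [HasLimits V] [HasColimits V]
variable {C : Type w} [EnrichedCategory V C] [VSmall V C]

/-- `HomIsCoend` for the evaluation pairing makes its covariant member `L φ` a small projective; for
`R ψ` the exchanged pairing is used. -/
lemma isSmallProjective_ldual {φ : EnrichedFunctor V Cᵒᵖ V} (h : IsSmallProjective V φ) :
    IsSmallProjective V (ldual φ) :=
  (homIsCoend_opEvalPairing h).isSmallProjective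

lemma isSmallProjective_rdual {ψ : EnrichedFunctor V C V} (h : IsSmallProjective V ψ) :
    IsSmallProjective V (rdual ψ) :=
  (homIsCoend_evalPairing h).swap.isSmallProjective

lemma exists_isbellAdjunction_unit_inv {φ : EnrichedFunctor V Cᵒᵖ V}
    (h : IsSmallProjective V φ) :
    ∃ g : 𝟙_ V ⟶ (Hom⟪rdual (ldual φ), φ⟫ : V),
      preC (X := φ) (Y := rdual (ldual φ)) ((isbellAdjunction V C).unit φ) g = eId V φ ∧
      preC (Y := φ) (Z := rdual (ldual φ)) g ((isbellAdjunction V C).unit φ) =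
        eId V (rdual (ldual φ)) := by
  have := (homIsCoend_opEvalPairing h).isIso_θ
  rw [isbellAdjunction_unit]
  exact ⟨_, (opEvalPairing φ).isoRdual.preC_natLift, (opEvalPairing φ).isoRdual.symm.preC_natLift⟩

lemma exists_isbellAdjunction_counit_inv {ψ : EnrichedFunctor V C V}
    (h : IsSmallProjective V ψ) :
    ∃ g : 𝟙_ V ⟶ (Hom⟪ldual (rdual ψ), ψ⟫ : V),
      preC (X := ψ) (Y := ldual (rdual ψ)) ((isbellAdjunction V C).counit (op ψ)) g = eId V ψ ∧
      preC (Y := ψ) (Z := ldual (rdual ψ)) g ((isbellAdjunction V C).counit (op ψ)) =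
        eId V (ldual (rdual ψ)) := by
  have := (homIsCoend_evalPairing h).swap.isIso_θ
  rw [isbellAdjunction_counit]
  exact ⟨_, (evalPairing ψ).isoLdual.preC_natLift, (evalPairing ψ).isoLdual.symm.preC_natLift⟩

variable (V C) in
/-- The unit of the Isbell adjunction, restricted to small projectives. -/
noncomputable def isbellUnitIso :
    VNatIso (EnrichedFunctor.id V (FullSub (IsSmallProjective V (𝒜 := EnrichedFunctor V Cᵒᵖ V))))
      ((restrictRight (isbellL V C) fun _ => isSmallProjective_ldual).comp V
        (restrictLeft (isbellR V C) fun _ => isSmallProjective_rdual)) :=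
  .ofInverse
    (GNat.mk' (fun φ => (isbellAdjunction V C).unit φ.obj)
      (fun φ φ' => (isbellAdjunction V C).unit_naturality φ.obj φ'.obj))
    (fun φ => (exists_isbellAdjunction_unit_inv φ.property).choose)
    (fun φ => (exists_isbellAdjunction_unit_inv φ.property).choose_spec.1)
    (fun φ => (exists_isbellAdjunction_unit_inv φ.property).choose_spec.2)

variable (V C) in
/-- The counit of the Isbell adjunction, restricted to small projectives. -/
noncomputable def isbellCounitIso :
    VNatIso ((restrictLeft (isbellR V C) fun _ => isSmallProjective_rdual).comp V
        (restrictRight (isbellL V C) fun _ => isSmallProjective_ldual))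
      (EnrichedFunctor.id V (FullSub (IsSmallProjective V (𝒜 := EnrichedFunctor V C V)))ᵒᵖ) :=
  .ofInverse
    (GNat.mk' (fun ψ => (isbellAdjunction V C).counit (op ψ.unop.obj))
      (fun ψ ψ' => (isbellAdjunction V C).counit_naturality (op ψ.unop.obj) (op ψ'.unop.obj)))
    (fun ψ => (exists_isbellAdjunction_counit_inv ψ.unop.property).choose)
    -- Composition is reversed in the opposite category, so the two inverse laws are used in the
    -- other order.
    (fun ψ => (preC_opposite (C := EnrichedFunctor V C V) _ _).trans
      (exists_isbellAdjunction_counit_inv ψ.unop.property).choose_spec.2)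
    (fun ψ => (preC_opposite (C := EnrichedFunctor V C V) _ _).trans
      (exists_isbellAdjunction_counit_inv ψ.unop.property).choose_spec.1)

end IsbellAdjunction

end Isbell

theorem mainTheorem4 {V : Type u} [Category.{v} V] [MonoidalCategory V] [SymmetricCategory V]
    [MonoidalClosed V] [HasLimits V] [HasColimits V] (B : Type w) [EnrichedCategory V B]
    [VSmall V B] :
    ∃ adj : VAdjunction (isbellL V B) (isbellR V B),
      -- the isomorphism `[B, V](ψ, L φ) ≅ [Bᵒᵖ, V](φ, R ψ)` is the canonical one
      (∀ (φ : EnrichedFunctor V Bᵒᵖ V) (ψ : EnrichedFunctor V B V) (b c : B),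
        tr ((adj.homIso φ (op ψ)).hom ≫ natπ φ ((isbellR V B).obj (op ψ)) (op b) ≫
            (ihom (φ.obj (op b))).map (natπ ψ ((coyonedaEmb V B).obj (op b)) c)) =
          (α_ (ψ.obj c) (φ.obj (op b)) (natObj ψ ((isbellL V B).obj φ).unop)).inv ≫
            (β_ _ _).hom ▷ _ ≫ (α_ _ _ _).hom ≫
            tr (natπ ψ ((isbellL V B).obj φ).unop c ≫
              (ihom (ψ.obj c)).map (natπ φ ((yonedaEmb V B).obj c) (op b)))) ∧
      -- it restricts to an equivalence between small projectives
      (∃ (hL : ∀ φ : EnrichedFunctor V Bᵒᵖ V, IsSmallProjective V φ →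
            IsSmallProjective V ((isbellL V B).obj φ).unop)
          (hR : ∀ ψ : EnrichedFunctor V B V, IsSmallProjective V ψ →
            IsSmallProjective V ((isbellR V B).obj (op ψ)))
          (E : VEquivalence (restrictRight (isbellL V B) hL) (restrictLeft (isbellR V B) hR)),
        (∀ φ, E.unitIso.hom.ap φ = adj.unit φ.obj) ∧
        (∀ ψ, E.counitIso.hom.ap ψ = adj.counit (op ψ.unop.obj))) ∧
      -- which is the correspondence between adjoint modules
      (∀ (φ : EnrichedFunctor V Bᵒᵖ V) (ψ : EnrichedFunctor V B V),
        Nonempty (ModuleAdjunction φ ψ) →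
          IsSmallProjective V φ ∧ IsSmallProjective V ψ ∧
          Nonempty (VNatIso φ ((isbellR V B).obj (op ψ))) ∧
          Nonempty (VNatIso ψ ((isbellL V B).obj φ).unop)) ∧
      (∀ ψ : EnrichedFunctor V B V, IsSmallProjective V ψ →
        Nonempty (ModuleAdjunction ((isbellR V B).obj (op ψ)) ψ)) ∧
      (∀ φ : EnrichedFunctor V Bᵒᵖ V, IsSmallProjective V φ →
        Nonempty (ModuleAdjunction φ ((isbellL V B).obj φ).unop)) ∧
      -- and corresponding `φ` and `ψ` satisfy `[B, V](ψ, -) ≅ φ * -`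
      (∀ (φ : EnrichedFunctor V Bᵒᵖ V) (ψ : EnrichedFunctor V B V),
        IsSmallProjective V φ → IsSmallProjective V ψ →
        Nonempty (VNatIso φ ((isbellR V B).obj (op ψ))) →
        Nonempty (VNatIso (homFunctor V ψ) (wcolimFunctor φ))) := by
  refine ⟨isbellAdjunction V B, fun φ ψ b c => isbellAdjunction_canonical φ ψ b c,
    ⟨fun _ => isSmallProjective_ldual, fun _ => isSmallProjective_rdual,
      -- These isomorphisms were built on the unit and counit of the adjunction, so the
      -- compatibility is definitional.
      ⟨isbellUnitIso V B, isbellCounitIso V B⟩, fun _ => rfl, fun _ => rfl⟩,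
    fun φ ψ ⟨M⟩ => ?_, fun ψ h => (homIsCoend_evalPairing h).nonempty_moduleAdjunction,
    fun φ h => (homIsCoend_opEvalPairing h).nonempty_moduleAdjunction,
    fun φ ψ _ hψ ⟨α⟩ => ?_⟩
  -- The counit of `M` settles `ψ` and the isomorphism `φ ≅ R ψ`; its exchange over `Bᵒᵖ` settles
  -- `φ` and `ψ ≅ L φ`.
  · have h := M.homIsCoend
    have := h.isIso_θ
    have := h.swap.isIso_θ
    exact ⟨h.swap.isSmallProjective, h.isSmallProjective, ⟨M.pairing.isoRdual⟩,
      ⟨M.pairing.isoLdual⟩⟩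
  -- The isomorphism is arbitrary, so the evaluation pairing of `ψ` is not directly available; a
  -- pairing with invertible `θ` is enough for the density argument.
  · obtain ⟨P, hP⟩ := VNatIso.exists_pairing (φ := φ) (ψ := ψ) α
    exact (P.homIsCoend_of_isSmallProjective hψ).nonempty_vnatIso
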